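/- Let $d\ge 0$ and let $\mathcal X=\mathbb R^d$ or $\mathcal X=\mathbb Z^d$, $\mathcal H=L^2(\mathcal X)$ (counting measure on $\mathbb Z^d$). Let $-\Delta$ be the self-adjoint Laplacian on $\mathcal H$ (with domain $H^2(\mathbb R^d)$ if $\mathcal X=\mathbb R^d$; $(-\Delta\psi)(n)=\sum_{j}(2\psi(n)-\psi(n+e_j)-\psi(n-e_j))$ if $\mathcal X=\mathbb Z^d$), let $V_0,V\in L^\infty(\mathcal X;\mathbb R)$ act by multiplication, and put $H_0=-\Delta+V_0$ (the free case is $V_0=0$) and $H=H_0+V$. Let $Q=(Q_1,\dots,Q_d)$ be the position operator, $|Q|$ multiplication by the Euclidean norm of the position, and $\Xi=-i[Q,-\Delta]$ the momentum operator, i.e. $\Xi_j=-2i\partial_j$ on $\mathbb R^d$ and $(\Xi_j\psi)(n)=-i(\psi(n+e_j)-\psi(n-e_j))$ on $\mathbb Z^d$. Let $$\|\psi\|_{S_1}=\Big(\|\psi\|^2+\|\tfrac12\Xi\psi\|^2+\|Q\psi\|^2\Big)^{1/2}\in[0,\infty],$$ where a norm $\|A\psi\|$ is $\infty$ if $\psi$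 is not in the domain of $A$. For a state $\psi$ and a Hamiltonian $K$ put $m(t)=\||Q|e^{-itK}\psi\|^2\in[0,\infty]$. For a function $m$ of time define $$A_m(T)=\frac2T\int_0^\infty e^{-2t/T}m(t)\,dt,\qquad C_m(T)=\frac1T\int_0^T m(t)\,dt .$$ Say that $m$ has ballistic norm growth if there are $c,C>0$ with $ct^2\le m(t)\le Ct^2$ for all sufficiently large $t$, and that it has ballistic exponents if $$\limsup_{t\to\infty}\frac{\log m(t)}{2\log t}=\liminf_{t\to\infty}\frac{\log m(t)}{2\log t}=1 .$$ The state $\psi$ exhibits ballistic transport under $K$ (for the second moment) in the norm-growth sense, the exponent sense, the Abel average norm-growth sense, the Abel average exponent sense, the Cesàro average norm-growth sense, or the Cesàro average exponent sense, if, respectively, $m$ has ballistic norm growth, $m$ has ballistic exponents, $A_m$ has ballistic norm growth, $A_m$ has ballistic exponents, $C_m$ has ballistic norm growth, or $C_m$ has ballistic exponents. Each of these six notions also has a version for the averaged position operator, in which $m$ is replaced by $\overline m(T)=\sum_j\|\langle Q_j\rangle(T)\psi\|^2$ with $\langle Q_j\rangle(T)\psi=\frac1T\int_0^T e^{itK}Q_je^{-itK}\psi\,dt$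 (and $\|\langle Q_j\rangle(T)\psi\|=\infty$ if the integral is not defined). Let $\psi\in\mathcal H$ satisfy $$\int_0^\infty(1+t)\,\|Ve^{-itH_0}\psi\|_{S_1}\,dt<\infty .$$ Then $\Omega\psi=\lim_{t\to\infty}e^{itH}e^{-itH_0}\psi$ exists, and 1. for each of the six notions: if $\psi$ exhibits ballistic transport in that sense under $H_0$, then $\Omega\psi$ exhibits ballistic transport in the same sense under $H$; 2. if $V_0=0$, so that $H_0=-\Delta$, the same holds for each of the six versions for the averaged position operator. -/

import Mathlib

open MeasureTheory Filter Topology Set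
open scoped ENNReal

noncomputable section

namespace Ballistic

/-! ### Unbounded operators and the unitary group they generate -/

section Operators

variable {E : Type*} [NormedAddCommGroup E] [InnerProductSpace ℂ E]

/-- The size `‖A ψ‖ ∈ [0, ∞]`, which is `∞` when `ψ` is not in the domain of `A`. -/
def opNorm (A : E →ₗ.[ℂ] E) (ψ : E) : ℝ≥0∞ :=
  open scoped Classical in
  if h : ψ ∈ A.domain then ‖A ⟨ψ, h⟩‖ₑ else ⊤

/-- `U t = e^{-itA}`: `U` is a strongly continuous one-parameter unitary group, and its generator
is exactly `A`: a vector `ψ` is in the domain of `A` with `A ψ = φ` if and only if `t ↦ U t ψ` is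
differentiable at `0` with derivative `-i φ`. -/
structure IsUnitaryGroupOf (A : E →ₗ.[ℂ] E) (U : ℝ → E ≃ₗᵢ[ℂ] E) : Prop where
  zero : U 0 = 1
  add : ∀ s t, U (s + t) = U s * U t
  continuous : ∀ ψ, Continuous fun t => U t ψ
  generator : ∀ ψ φ, (ψ, φ) ∈ A.graph ↔ HasDerivAt (fun t => U t ψ) (-Complex.I • φ) 0

/-- The orbits of vectors in the domain solve the Schrödinger equation. -/
theorem IsUnitaryGroupOf.mem_graph_and_hasDerivAt {A : E →ₗ.[ℂ] E} {U : ℝ → E ≃ₗᵢ[ℂ] E}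
    (hU : IsUnitaryGroupOf A U) {ψ φ : E} (h : (ψ, φ) ∈ A.graph) (s : ℝ) :
    (U s ψ, U s φ) ∈ A.graph ∧ HasDerivAt (fun t => U t ψ) (-Complex.I • U s φ) s := by
  have h0 := (hU.generator ψ φ).1 h
  have h1 : HasDerivAt (fun t => U s (U t ψ)) (-Complex.I • U s φ) 0 := by
    have := ((U s).toContinuousLinearEquiv.toContinuousLinearMap.restrictScalars
      ℝ).hasFDerivAt.comp_hasDerivAt (0 : ℝ) h0
    simpa [Function.comp_def] using this
  constructor
  · refine (hU.generator _ _).2 ?_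
    have e : (fun t => U t (U s ψ)) = fun t => U s (U t ψ) := by
      funext t
      have := congrArg (fun W : E ≃ₗᵢ[ℂ] E => W ψ) ((hU.add t s).symm.trans
        ((congrArg U (add_comm t s)).trans (hU.add s t)))
      simpa using this
    rw [e]
    exact h1
  · have e : (fun t => U t ψ) = fun t => (fun r => U s (U r ψ)) (t - s) := by
      funext t
      have := congrArg (fun W : E ≃ₗᵢ[ℂ] E => W ψ) (hU.add s (t - s))
      simpa using this
    rw [e]
    exact HasDerivAt.comp_sub_const s s (by rwa [sub_self])

/-- A densely defined operator generates at most one unitary group. -/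
theorem IsUnitaryGroupOf.unique {A : E →ₗ.[ℂ] E} (hA : Dense (A.domain : Set E))
    {U W : ℝ → E ≃ₗᵢ[ℂ] E} (hU : IsUnitaryGroupOf A U) (hW : IsUnitaryGroupOf A W) : U = W := by
  have hsymm : ∀ p q : E × E, p ∈ A.graph → q ∈ A.graph →
      inner ℂ p.1 (-Complex.I • q.2) + inner ℂ (-Complex.I • p.2) q.1 = 0 := by
    intro p q hp hq
    have h1 := ((hU.generator _ _).1 hp).inner ℂ ((hU.generator _ _).1 hq)
    simp only [LinearIsometryEquiv.inner_map_map, hU.zero] at h1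
    simpa using h1.unique (hasDerivAt_const (0 : ℝ) (inner ℂ p.1 q.1))
  funext t
  ext x
  revert x
  refine fun x => congrFun (Continuous.ext_on hA (U t).continuous (W t).continuous ?_) x
  intro ψ hψ
  have hg : (ψ, A ⟨ψ, hψ⟩) ∈ A.graph := A.mem_graph ⟨ψ, hψ⟩
  have hd : ∀ s, HasDerivAt (fun r => inner ℂ (U r ψ) (W r ψ)) 0 s := by
    intro s
    obtain ⟨hu, hu'⟩ := hU.mem_graph_and_hasDerivAt hg s
    obtain ⟨hw, hw'⟩ := hW.mem_graph_and_hasDerivAt hg s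
    have := hu'.inner ℂ hw'
    rwa [hsymm _ _ hu hw] at this
  have hc := is_const_of_deriv_eq_zero (fun s => (hd s).differentiableAt)
    (fun s => (hd s).deriv) t 0
  simp only [hU.zero, hW.zero] at hc
  have h2 : ‖U t ψ - W t ψ‖ ^ 2 = 0 := by
    have h3 : RCLike.re (inner ℂ ψ ψ) = ‖ψ‖ ^ 2 := inner_self_eq_norm_sq ψ
    rw [@norm_sub_sq ℂ, hc, LinearIsometryEquiv.norm_map, LinearIsometryEquiv.norm_map]
    change ‖ψ‖ ^ 2 - 2 * RCLike.re (inner ℂ ψ ψ) + ‖ψ‖ ^ 2 = 0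
    rw [h3]
    ring
  exact sub_eq_zero.1 (norm_eq_zero.1 (pow_eq_zero_iff two_ne_zero |>.1 h2))

/-- The propagator `t ↦ e^{-itA}` of a self-adjoint operator `A`. -/
def propagator (A : E →ₗ.[ℂ] E) : ℝ → E ≃ₗᵢ[ℂ] E :=
  open scoped Classical in
  if h : ∃ U, IsUnitaryGroupOf A U then h.choose else 1

/-- The Heisenberg evolved operator `A(t) = e^{itH} A e^{-itH}` on its natural domain
`{ψ | e^{-itH} ψ ∈ D(A)}`, where `U t = e^{-itH}`. -/
def heisenberg (U : ℝ → E ≃ₗᵢ[ℂ] E) (A : E →ₗ.[ℂ] E) (t : ℝ) : E →ₗ.[ℂ] E where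
  domain := A.domain.comap (U t).toLinearEquiv.toLinearMap
  toFun :=
    { toFun := fun ψ => U (-t) (A ⟨U t ψ, ψ.2⟩)
      map_add' := fun ψ φ => by
        rw [← map_add, ← A.map_add]
        congr 2
        exact Subtype.ext (map_add (U t) (ψ : E) φ)
      map_smul' := fun c ψ => by
        rw [RingHom.id_apply, ← map_smul, ← A.map_smul]
        congr 2
        exact Subtype.ext (map_smul (U t) c (ψ : E)) }

/-- `A(t) ψ`, extended by `0` to the times `t` at which `ψ` is not in the domain of `A(t)`. -/
def heisenbergOrbit (U : ℝ → E ≃ₗᵢ[ℂ] E) (A : E →ₗ.[ℂ] E) (ψ : E) (t : ℝ) : E :=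
  open scoped Classical in
  if h : ψ ∈ (heisenberg U A t).domain then heisenberg U A t ⟨ψ, h⟩ else 0

/-- The vectors for which `(1/T) ∫_0^T A(t) ψ dt` makes sense: `ψ` is in the domain of `A(t)` for
almost every `t ∈ (0, T]`, and `t ↦ A(t) ψ` is (Bochner) integrable there. -/
def CesaroDefined (U : ℝ → E ≃ₗᵢ[ℂ] E) (A : E →ₗ.[ℂ] E) (T : ℝ) (ψ : E) : Prop :=
  (∀ᵐ t ∂(volume.restrict (Ioc 0 T)), ψ ∈ (heisenberg U A t).domain) ∧
    IntegrableOn (heisenbergOrbit U A ψ) (Ioc 0 T)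

/-- The size `‖⟨A⟩(T) ψ‖ ∈ [0, ∞]` of the Cesàro averaged Heisenberg operator
`⟨A⟩(T) ψ = (1/T) ∫_0^T A(t) ψ dt`, which is `∞` when `ψ` is not in its domain. -/
def cesaroOpNorm (U : ℝ → E ≃ₗᵢ[ℂ] E) (A : E →ₗ.[ℂ] E) (T : ℝ) (ψ : E) : ℝ≥0∞ :=
  open scoped Classical in
  if CesaroDefined U A T ψ then ‖T⁻¹ • ∫ t in Ioc 0 T, heisenbergOrbit U A ψ t‖ₑ else ⊤

/-- The operator `S` on `E` given by `ι (S ψ) = T (ι ψ)`, for an injection `ι` of `E` in a larger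
space `D` on which `T` acts, with its maximal domain `{ψ | T (ι ψ) ∈ range ι}`. -/
def maximalRealization {D : Type*} [AddCommGroup D] [Module ℂ D] (ι : E →ₗ[ℂ] D)
    (hι : Function.Injective ι) (T : D →ₗ[ℂ] D) : E →ₗ.[ℂ] E where
  domain := (LinearMap.range ι).comap (T ∘ₗ ι)
  toFun :=
    { toFun := fun ψ => ψ.2.choose
      map_add' := fun ψ ψ' => hι <| by
        rw [(ψ + ψ').2.choose_spec, map_add, ψ.2.choose_spec, ψ'.2.choose_spec, ← map_add,
          Submodule.coe_add]
      map_smul' := fun c ψ => hι <| by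
        rw [(c • ψ).2.choose_spec, RingHom.id_apply, map_smul, ψ.2.choose_spec, ← map_smul,
          Submodule.coe_smul] }

/-- The wave operator `Ω ψ = lim_{t → ∞} e^{itH} e^{-itH₀} ψ`, defined on the vectors for which the
limit exists; here `U₀ t = e^{-itH₀}` and `U t = e^{-itH}`. -/
def waveOperator (U₀ U : ℝ → E ≃ₗᵢ[ℂ] E) : E →ₗ.[ℂ] E where
  domain :=
    { carrier := {ψ | ∃ φ, Tendsto (fun t => U (-t) (U₀ t ψ)) atTop (𝓝 φ)}
      add_mem' := by
        rintro ψ ψ' ⟨φ, h⟩ ⟨φ', h'⟩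
        exact ⟨φ + φ', by simpa using h.add h'⟩
      zero_mem' := ⟨0, by simp⟩
      smul_mem' := by
        rintro c ψ ⟨φ, h⟩
        exact ⟨c • φ, by simpa using h.const_smul c⟩ }
  toFun :=
    { toFun := fun ψ => ψ.2.choose
      map_add' := fun ψ ψ' => by
        refine tendsto_nhds_unique (ψ + ψ').2.choose_spec ?_
        simpa using ψ.2.choose_spec.add ψ'.2.choose_spec
      map_smul' := fun c ψ => by
        refine tendsto_nhds_unique (c • ψ).2.choose_spec ?_
        simpa using ψ.2.choose_spec.const_smul c }

end Operators

/-! ### Multiplication operators on `L²` -/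

section Multiplication

variable {X : Type*} [MeasurableSpace X] {μ : Measure X}

/-- The operator of multiplication by the real function `f`, with its maximal domain
`{ψ ∈ L² | f ψ ∈ L²}`. -/
def mulOperator (μ : Measure X) (f : X → ℝ) : Lp ℂ 2 μ →ₗ.[ℂ] Lp ℂ 2 μ where
  domain :=
    { carrier := {ψ | MemLp (fun x => (f x : ℂ) * ψ x) 2 μ}
      add_mem' := by
        intro ψ φ hψ hφ
        refine (memLp_congr_ae ?_).1 (MemLp.add hψ hφ)
        filter_upwards [Lp.coeFn_add ψ φ] with x hx
        rw [hx]
        exact (mul_add _ _ _).symm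
      zero_mem' := by
        refine (memLp_congr_ae ?_).1 (MemLp.zero' (ε := ℂ))
        filter_upwards [Lp.coeFn_zero ℂ 2 μ] with x hx
        rw [hx]
        exact (mul_zero _).symm
      smul_mem' := by
        intro c ψ hψ
        refine (memLp_congr_ae ?_).1 (MemLp.const_smul hψ c)
        filter_upwards [Lp.coeFn_smul c ψ] with x hx
        simp only [Pi.smul_apply, hx, smul_eq_mul]
        ring }
  toFun :=
    { toFun := fun ψ => MemLp.toLp _ ψ.2
      map_add' := fun ψ φ => by
        rw [← MemLp.toLp_add]
        refine MemLp.toLp_congr _ _ ?_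
        filter_upwards [Lp.coeFn_add (ψ : Lp ℂ 2 μ) φ] with x hx
        rw [Submodule.coe_add, hx]
        exact mul_add _ _ _
      map_smul' := fun c ψ => by
        rw [RingHom.id_apply, ← MemLp.toLp_const_smul]
        refine MemLp.toLp_congr _ _ ?_
        filter_upwards [Lp.coeFn_smul c (ψ : Lp ℂ 2 μ)] with x hx
        simp only [Submodule.coe_smul, hx, Pi.smul_apply, smul_eq_mul]
        ring }

/-- Multiplication by a bounded real potential `V ∈ L^∞`, as an everywhere defined operator. -/
def potential (V : Lp ℝ ∞ μ) : Lp ℂ 2 μ →ₗ[ℂ] Lp ℂ 2 μ where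
  toFun ψ := (V • ψ : Lp ℂ 2 μ)
  map_add' ψ φ := Lp.add_smul V ψ φ
  map_smul' c ψ := by
    refine MemLp.toLp_congr _ _ ?_ |>.trans (MemLp.toLp_const_smul c
      ((Lp.memLp ψ).smul (r := 2) (Lp.memLp V)))
    filter_upwards [Lp.coeFn_smul c ψ] with x hx
    simp only [Pi.smul_apply', hx, Pi.smul_apply, smul_comm c]

/-- The Hamiltonian `H + V`, with the domain of `H`. -/
def perturb (H : Lp ℂ 2 μ →ₗ.[ℂ] Lp ℂ 2 μ) (V : Lp ℝ ∞ μ) : Lp ℂ 2 μ →ₗ.[ℂ] Lp ℂ 2 μ :=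
  potential V +ᵥ H

/-- The components `Q_j` of the position operator `Q`, the position of `x : X` being `q x`. -/
def position (μ : Measure X) {d : ℕ} (q : X → EuclideanSpace ℝ (Fin d)) (j : Fin d) :
    Lp ℂ 2 μ →ₗ.[ℂ] Lp ℂ 2 μ :=
  mulOperator μ fun x => q x j

/-- The operator `|Q|` of multiplication by the Euclidean norm of the position. -/
def absPosition (μ : Measure X) {d : ℕ} (q : X → EuclideanSpace ℝ (Fin d)) :
    Lp ℂ 2 μ →ₗ.[ℂ] Lp ℂ 2 μ :=
  mulOperator μ fun x => ‖q x‖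

/-- The norm `‖ψ‖_{S₁} = (‖ψ‖² + ‖½ Ξ ψ‖² + ‖Q ψ‖²)^{1/2}`, with the value `∞` when `ψ ∉ S₁`, where
`Ξ = (Ξ_1, …, Ξ_d)` is the momentum operator. -/
def s1Norm {d : ℕ} (q : X → EuclideanSpace ℝ (Fin d))
    (Ξ : Fin d → Lp ℂ 2 μ →ₗ.[ℂ] Lp ℂ 2 μ) (ψ : Lp ℂ 2 μ) : ℝ≥0∞ :=
  (‖ψ‖ₑ ^ 2 + ∑ j, (opNorm (Ξ j) ψ / 2) ^ 2 + ∑ j, opNorm (position μ q j) ψ ^ 2) ^ (1 / 2 : ℝ)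

/-- The second moment `‖|Q|(t) ψ‖²`, in `[0, ∞]`, under the evolution `U`. -/
def secondMoment {d : ℕ} (q : X → EuclideanSpace ℝ (Fin d)) (U : ℝ → Lp ℂ 2 μ ≃ₗᵢ[ℂ] Lp ℂ 2 μ)
    (ψ : Lp ℂ 2 μ) (t : ℝ) : ℝ≥0∞ :=
  opNorm (heisenberg U (absPosition μ q) t) ψ ^ 2

/-- The second moment `‖⟨Q⟩(T) ψ‖² = ∑_j ‖⟨Q_j⟩(T) ψ‖²`, in `[0, ∞]`, of the Cesàro averaged
position operator under the evolution `U`. -/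
def averagedSecondMoment {d : ℕ} (q : X → EuclideanSpace ℝ (Fin d))
    (U : ℝ → Lp ℂ 2 μ ≃ₗᵢ[ℂ] Lp ℂ 2 μ) (ψ : Lp ℂ 2 μ) (T : ℝ) : ℝ≥0∞ :=
  ∑ j, cesaroOpNorm U (position μ q j) T ψ ^ 2

end Multiplication

/-! ### Notions of ballistic transport

They are properties of the second moment `m : ℝ → [0, ∞]` as a function of time. -/

/-- The Abel average `(2/T) ∫_0^∞ e^{-2t/T} m(t) dt`. -/
def abelAverage (m : ℝ → ℝ≥0∞) (T : ℝ) : ℝ≥0∞ :=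
  ENNReal.ofReal (2 / T) * ∫⁻ t in Ioi 0, ENNReal.ofReal (Real.exp (-(2 * t / T))) * m t

/-- The Cesàro average `(1/T) ∫_0^T m(t) dt`. -/
def cesaroAverage (m : ℝ → ℝ≥0∞) (T : ℝ) : ℝ≥0∞ :=
  ENNReal.ofReal (1 / T) * ∫⁻ t in Ioc 0 T, m t

/-- Ballistic upper and lower bounds `c t² ≤ m(t) ≤ C t²` for all large `t`. -/
def NormGrowth (m : ℝ → ℝ≥0∞) : Prop :=
  ∃ c C : ℝ, 0 < c ∧ 0 < C ∧
    ∀ᶠ t : ℝ in atTop, ENNReal.ofReal (c * t ^ 2) ≤ m t ∧ m t ≤ ENNReal.ofReal (C * t ^ 2)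

/-- The upper transport exponent `β⁺ = limsup_{t → ∞} log m(t) / (2 log t)`. -/
def upperExponent (m : ℝ → ℝ≥0∞) : EReal :=
  limsup (fun t : ℝ => ENNReal.log (m t) / ((2 * Real.log t : ℝ) : EReal)) atTop

/-- The lower transport exponent `β⁻ = liminf_{t → ∞} log m(t) / (2 log t)`. -/
def lowerExponent (m : ℝ → ℝ≥0∞) : EReal :=
  liminf (fun t : ℝ => ENNReal.log (m t) / ((2 * Real.log t : ℝ) : EReal)) atTop

/-- Both transport exponents are equal to `1`. -/
def ExponentOne (m : ℝ → ℝ≥0∞) : Prop :=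
  upperExponent m = 1 ∧ lowerExponent m = 1

/-- The notions of ballistic transport for the second moment other than strong and strong
resolvent ballistic transport. -/
inductive TransportNotion
  | normGrowth
  | exponent
  | abelNormGrowth
  | abelExponent
  | cesaroNormGrowth
  | cesaroExponent

/-- A state with second moment `m` exhibits ballistic transport in the given sense. -/
def TransportNotion.Holds : TransportNotion → (ℝ → ℝ≥0∞) → Prop
  | .normGrowth, m => NormGrowth m
  | .exponent, m => ExponentOne m
  | .abelNormGrowth, m => NormGrowth (abelAverage m)
  | .abelExponent, m => ExponentOne (abelAverage m)
  | .cesaroNormGrowth, m => NormGrowth (cesaroAverage m)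
  | .cesaroExponent, m => ExponentOne (cesaroAverage m)

/-! ### The continuum `ℝ^d` -/

section Continuum

open scoped SchwartzMap LineDeriv Laplacian

/-- `L²(ℝ^d)`. -/
abbrev L2R (d : ℕ) := Lp ℂ 2 (volume : Measure (EuclideanSpace ℝ (Fin d)))

/-- The embedding of `L²(ℝ^d)` in the tempered distributions. -/
abbrev toDistribution (d : ℕ) : L2R d →L[ℂ] 𝓢'(EuclideanSpace ℝ (Fin d), ℂ) :=
  Lp.toTemperedDistributionCLM ℂ volume 2

theorem toDistribution_injective (d : ℕ) : Function.Injective (toDistribution d) :=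
  LinearMap.ker_eq_bot.1 (Lp.ker_toTemperedDistributionCLM_eq_bot (F := ℂ)
    (μ := (volume : Measure (EuclideanSpace ℝ (Fin d)))) (p := 2))

/-- The realization on `L²(ℝ^d)`, with maximal domain, of a linear operator `T` acting on tempered
distributions: `ψ` is in the domain if and only if `T ψ ∈ L²`. -/
def realization (d : ℕ)
    (T : 𝓢'(EuclideanSpace ℝ (Fin d), ℂ) →L[ℂ] 𝓢'(EuclideanSpace ℝ (Fin d), ℂ)) :
    L2R d →ₗ.[ℂ] L2R d :=
  maximalRealization (toDistribution d).toLinearMap (toDistribution_injective d) T.toLinearMap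

/-- The self-adjoint operator `-Δ` on `L²(ℝ^d)`, with domain
`{ψ ∈ L² | Δψ ∈ L²} = H²(ℝ^d)`. -/
def negLaplacianR (d : ℕ) : L2R d →ₗ.[ℂ] L2R d :=
  realization d (-LineDeriv.laplacianCLM ℂ (EuclideanSpace ℝ (Fin d))
    𝓢'(EuclideanSpace ℝ (Fin d), ℂ))

/-- The components `Ξ_j = -i[Q_j, -Δ] = -2i ∂_j` of the momentum operator on `L²(ℝ^d)`; their
common domain is `H¹(ℝ^d)`. -/
def momentumR (d : ℕ) (j : Fin d) : L2R d →ₗ.[ℂ] L2R d :=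
  realization d ((-2 * Complex.I) • LineDeriv.lineDerivOpCLM ℂ
    𝓢'(EuclideanSpace ℝ (Fin d), ℂ) (EuclideanSpace.single j (1 : ℝ)))

end Continuum

/-! ### The lattice `ℤ^d` -/

section Lattice

/-- `ℓ²(ℤ^d)`, that is, `L²` of `ℤ^d` with the counting measure. -/
abbrev L2Z (d : ℕ) := Lp ℂ 2 (Measure.count : Measure (Fin d → ℤ))

/-- The shift `(S_k ψ)(n) = ψ(n + k)` on `ℓ²(ℤ^d)`. -/
def shift {d : ℕ} (k : Fin d → ℤ) : L2Z d →ₗ[ℂ] L2Z d :=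
  Lp.compMeasurePreservingₗ ℂ (fun n => n + k) (measurePreserving_add_right Measure.count k)

/-- The discrete Laplacian with its sign changed,
`(-Δψ)(n) = ∑_j (2 ψ(n) - ψ(n + e_j) - ψ(n - e_j))`, on all of `ℓ²(ℤ^d)`. -/
def negLaplacianZ (d : ℕ) : L2Z d →ₗ.[ℂ] L2Z d :=
  LinearMap.toPMap (∑ j : Fin d, ((2 : ℂ) • LinearMap.id - shift (Pi.single j 1)
    - shift (Pi.single j (-1)))) ⊤

/-- The components `Ξ_j = -i[Q_j, -Δ]` of the momentum operator on `ℓ²(ℤ^d)`, that is,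
`(Ξ_j ψ)(n) = -i (ψ(n + e_j) - ψ(n - e_j))`, on all of `ℓ²(ℤ^d)`. -/
def momentumZ (d : ℕ) (j : Fin d) : L2Z d →ₗ.[ℂ] L2Z d :=
  LinearMap.toPMap ((-Complex.I) • (shift (Pi.single j 1) - shift (Pi.single j (-1)))) ⊤

/-- The position of a lattice point, as a vector of the Euclidean space. -/
def latticePosition {d : ℕ} (n : Fin d → ℤ) : EuclideanSpace ℝ (Fin d) :=
  WithLp.toLp 2 fun j => (n j : ℝ)

end Lattice

end Ballistic

end

namespace Ballistic

/-! ### Strongly continuous families of isometries -/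

section Families

variable {E : Type*} [NormedAddCommGroup E] [InnerProductSpace ℂ E]

/-! The image state follows the original one with an error of bounded position. Cook's method gives
`e^{-itH} Ωψ - e^{-itH₀} ψ = ∫_t^∞ e^{-i(t-s)H} (i V e^{-isH₀} ψ) ds`. Under `H` the position grows
at most ballistically: `‖Q_j e^{-itH} u‖ ≤ K (1 + |t|) ‖u‖_{S₁}`. Since `|t - s| ≤ s` in the
integral, the position of the error is at most `K ∫ (1 + s) ‖V e^{-isH₀} ψ‖_{S₁} ds`, uniformly in
`t ≥ 0`. Hence each of the two second moments is at most twice the other plus a constant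
(`Comparable`). This relation passes to Abel and Cesàro averages and preserves both quadratic growth
and exponents equal to one.

The ballistic bound (`norm_conj_evolution_sub_le`, `IsFreeModel.exists_opNorm_position_le`) replaces
`Q_j` by the unitary group `M(s) = e^{-isQ_j}`. The derivative of `e^{irH} M(s) e^{-irH} v` involves
only the commutator of the free Hamiltonian with `M(s)`, because potentials commute with `M(s)`.
That commutator is of size `s` times the square root of the energy, and the energy is conserved up
to the bounded potential. Dividing by `s` and using Fatou's lemma gives back `Q_j`.

For the averaged position in the free case, a finite moment at one averaging time already puts
`e^{-itH₀} ψ` in the domain of `Q_j` for almost all times of an interval. The algebra of position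
and free evolution (Weyl relations on `ℝ^d`, shift-invariant commutators on `ℤ^d`) then forces
`e^{itH₀} Q_j e^{-itH₀} ψ = χ + t η` for every `t`. As `V` commutes with `Q_j`, the norm of `V
e^{-itH₀} (χ + t η)` is controlled by the `S₁` norm of `V e^{-itH₀} ψ`, hence integrable. So `t⁻¹
e^{itH} e^{-itH₀} (χ + t η)` has a limit `L` with `‖L‖ = ‖η‖` and error `O(1/t)`
(`exists_norm_sub_smul_le`). The position of `Ωψ` in the Heisenberg picture of `H` is therefore `t L
+ O(1)`. The Cesàro means under both evolutions have norm `(T/2) ‖η‖ + O(1)`, and the averaged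
moments are comparable too.

Both geometries enter only through the properties collected in `IsFreeModel`. -/

theorem tendsto_isometry_apply {ι : Type*} {l : Filter ι} {W : ℝ → E ≃ₗᵢ[ℂ] E}
    (hW : ∀ ψ, Continuous fun t => W t ψ) {r : ι → ℝ} {t : ℝ} (hr : Tendsto r l (𝓝 t))
    {x : ι → E} {y : E} (hx : Tendsto x l (𝓝 y)) :
    Tendsto (fun i => W (r i) (x i)) l (𝓝 (W t y)) := by
  have h1 : Tendsto (fun i => W (r i) y) l (𝓝 (W t y)) :=
    ((hW y).tendsto t).comp hr
  have h2 : Tendsto (fun i => W (r i) (x i) - W (r i) y) l (𝓝 0) := by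
    rw [tendsto_zero_iff_norm_tendsto_zero]
    simp_rw [← map_sub, LinearIsometryEquiv.norm_map]
    simpa using (hx.sub_const y).norm
  simpa using h2.add h1

theorem continuous_isometry_apply {α : Type*} [TopologicalSpace α] {W : ℝ → E ≃ₗᵢ[ℂ] E}
    (hW : ∀ ψ, Continuous fun t => W t ψ) {r : α → ℝ} (hr : Continuous r) {x : α → E}
    (hx : Continuous x) : Continuous fun a => W (r a) (x a) :=
  continuous_iff_continuousAt.2 fun a =>
    tendsto_isometry_apply hW (hr.tendsto a) (hx.tendsto a)

/-- Since `x t = 0`, the slope of `r ↦ W r (x r)` at `t` is `W r` applied to the slope of `x`, so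
strong continuity of `W` is enough and `W` itself need not be differentiable on any vector. -/
theorem hasDerivAt_isometry_apply_of_eq_zero {W : ℝ → E ≃ₗᵢ[ℂ] E}
    (hW : ∀ ψ, Continuous fun t => W t ψ) {x : ℝ → E} {x' : E} {t : ℝ}
    (hx : HasDerivAt x x' t) (h0 : x t = 0) :
    HasDerivAt (fun r => W r (x r)) (W t x') t := by
  rw [hasDerivAt_iff_tendsto_slope] at hx ⊢
  have h := tendsto_isometry_apply hW (tendsto_nhdsWithin_of_tendsto_nhds tendsto_id) hx
    (l := 𝓝[≠] t) (r := id)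
  refine h.congr fun r => ?_
  simp only [slope, vsub_eq_sub, h0, sub_zero, map_zero, id]
  exact ((W r).toLinearEquiv.toLinearMap.restrictScalars ℝ).map_smul _ _

variable {A : E →ₗ.[ℂ] E} {U : ℝ → E ≃ₗᵢ[ℂ] E}

theorem IsUnitaryGroupOf.add_apply (hU : IsUnitaryGroupOf A U) (s t : ℝ) (ψ : E) :
    U (s + t) ψ = U s (U t ψ) := by
  rw [hU.add]; rfl

theorem IsUnitaryGroupOf.zero_apply (hU : IsUnitaryGroupOf A U) (ψ : E) : U 0 ψ = ψ := by
  rw [hU.zero]; rfl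

theorem IsUnitaryGroupOf.neg_apply_apply (hU : IsUnitaryGroupOf A U) (t : ℝ) (ψ : E) :
    U (-t) (U t ψ) = ψ := by
  rw [← hU.add_apply, neg_add_cancel, hU.zero_apply]

theorem IsUnitaryGroupOf.apply_neg_apply (hU : IsUnitaryGroupOf A U) (t : ℝ) (ψ : E) :
    U t (U (-t) ψ) = ψ := by
  rw [← hU.add_apply, add_neg_cancel, hU.zero_apply]

theorem IsUnitaryGroupOf.continuous_neg (hU : IsUnitaryGroupOf A U) (ψ : E) :
    Continuous fun t => U (-t) ψ :=
  (hU.continuous ψ).comp continuous_id.neg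

/-- The product rule for `U (-t) x(t)` when `x(t)` is in the domain of the generator. -/
theorem IsUnitaryGroupOf.hasDerivAt_neg_apply (hU : IsUnitaryGroupOf A U) {x : ℝ → E} {x' y : E}
    {t : ℝ} (hx : HasDerivAt x x' t) (hy : (x t, y) ∈ A.graph) :
    HasDerivAt (fun r => U (-r) (x r)) (U (-t) (Complex.I • y + x')) t := by
  -- Split `x r = x t + (x r - x t)`. The first part lies in the domain of the generator; the second
  -- vanishes at `t` and needs only strong continuity.
  have h1 : HasDerivAt (fun r => U (-r) (x t)) (U (-t) (Complex.I • y)) t := by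
    have := (hU.mem_graph_and_hasDerivAt hy (-t)).2.scomp t (hasDerivAt_neg t)
    simpa [Function.comp_def] using this
  have h2 : HasDerivAt (fun r => U (-r) (x r - x t)) (U (-t) x') t :=
    hasDerivAt_isometry_apply_of_eq_zero (W := fun r => U (-r)) hU.continuous_neg
      (hx.sub_const _) (sub_self _)
  have h3 := h1.add h2
  rw [← map_add] at h3
  refine h3.congr_of_eventuallyEq (Eventually.of_forall fun r => ?_)
  simp

/-- The mean `∫_0^h U(s) ψ ds` is in the domain of the generator. -/
theorem IsUnitaryGroupOf.integral_mem_domain [CompleteSpace E] (hU : IsUnitaryGroupOf A U)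
    (ψ : E) (h : ℝ) : (∫ s in (0 : ℝ)..h, U s ψ) ∈ A.domain := by
  have hc := hU.continuous ψ
  have key : HasDerivAt (fun t => U t (∫ s in (0 : ℝ)..h, U s ψ)) (U h ψ - ψ) 0 := by
    have e : (fun t => U t (∫ s in (0 : ℝ)..h, U s ψ)) =
        fun t => (∫ s in (0 : ℝ)..(t + h), U s ψ) - ∫ s in (0 : ℝ)..t, U s ψ := by
      funext t
      have h1 := ((U t).toContinuousLinearEquiv.toContinuousLinearMap).intervalIntegral_comp_comm
        (hc.intervalIntegrable (μ := volume) 0 h)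
      change (∫ s in (0 : ℝ)..h, U t (U s ψ)) = U t _ at h1
      rw [← h1]
      simp_rw [← hU.add_apply]
      rw [intervalIntegral.integral_comp_add_left (fun s => U s ψ),
        intervalIntegral.integral_interval_sub_left (hc.intervalIntegrable _ _)
          (hc.intervalIntegrable _ _)]
      simp
    rw [e]
    have h1 : HasDerivAt (fun t => ∫ s in (0 : ℝ)..t, U s ψ) (U 0 ψ) 0 :=
      (hc.integral_hasStrictDerivAt 0 _).hasDerivAt
    have h2 : HasDerivAt (fun t => ∫ s in (0 : ℝ)..(t + h), U s ψ) (U h ψ) 0 := by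
      refine HasDerivAt.comp_add_const (𝕜 := ℝ) 0 h (f := fun t => ∫ s in (0 : ℝ)..t, U s ψ) ?_
      rw [zero_add]
      exact (hc.integral_hasStrictDerivAt 0 _).hasDerivAt
    have h3 := h2.sub h1
    rw [hU.zero_apply] at h3
    exact h3
  have := (hU.generator _ (Complex.I • (U h ψ - ψ))).2 (by
    simpa [smul_smul] using key)
  exact LinearPMap.mem_domain_of_mem_graph this

/-- The means `t⁻¹ ∫_0^t U s ψ ds` lie in the domain and converge to `ψ` as `t → 0`. -/
theorem IsUnitaryGroupOf.dense_domain [CompleteSpace E] (hU : IsUnitaryGroupOf A U) :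
    Dense (A.domain : Set E) := by
  intro ψ
  have hc := hU.continuous ψ
  have h1 : HasDerivAt (fun t => ∫ s in (0 : ℝ)..t, U s ψ) (U 0 ψ) 0 :=
    (hc.integral_hasStrictDerivAt 0 _).hasDerivAt
  rw [hasDerivAt_iff_tendsto_slope, hU.zero_apply] at h1
  refine mem_closure_of_tendsto h1 (Eventually.of_forall fun t => ?_)
  simp only [slope, vsub_eq_sub, intervalIntegral.integral_same, sub_zero]
  rw [← Complex.coe_smul]
  exact A.domain.smul_mem _ (hU.integral_mem_domain ψ t)

theorem isUnitaryGroupOf_propagator (h : ∃ U, IsUnitaryGroupOf A U) :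
    IsUnitaryGroupOf A (propagator A) := by
  rw [propagator, dif_pos h]
  exact h.choose_spec

end Families

/-! ### Global solutions of linear evolution equations -/

section Evolution

/-- A global Picard iteration in a weighted sup norm. Writing the unknown as `cosh (l t) • y t` with
`y` bounded and `l` large compared with the Lipschitz constant makes the integral operator a
contraction on the whole line at once, in both time directions. Continuity is asked only along
continuous curves, which is what a strongly continuous family provides. -/
theorem exists_forall_hasDerivAt_of_lipschitz {E : Type*} [NormedAddCommGroup E]
    [NormedSpace ℝ E] [CompleteSpace E] {f : ℝ → E → E} {K : ℝ} (hK : 0 ≤ K)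
    (hc : ∀ y : ℝ → E, Continuous y → Continuous fun t => f t (y t))
    (hl : ∀ t x y, ‖f t x - f t y‖ ≤ K * ‖x - y‖) (h0 : ∀ t, f t 0 = 0) (ψ : E) :
    ∃ x : ℝ → E, x 0 = ψ ∧ ∀ t, HasDerivAt x (f t (x t)) t := by
  -- The contraction factor is `K / l`; this choice makes it at most `1 / 2` and keeps `l` positive
  -- when `K = 0`.
  set l : ℝ := 2 * K + 1 with hl_def
  have hlpos : 0 < l := by positivity
  let w : ℝ → ℝ := fun t => Real.cosh (l * t)
  have hwpos : ∀ t, 0 < w t := fun t => Real.cosh_pos _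
  have hwc : Continuous w := Real.continuous_cosh.comp (continuous_const.mul continuous_id)
  have hint : ∀ t, |∫ s in (0 : ℝ)..t, w s| ≤ w t / l := by
    intro t
    have hd : ∀ s ∈ uIcc 0 t, HasDerivAt (fun s => Real.sinh (l * s) / l) (w s) s := by
      intro s _
      have := (((hasDerivAt_id s).const_mul l).sinh).div_const l
      simpa [w, hlpos.ne'] using this
    rw [intervalIntegral.integral_eq_sub_of_hasDerivAt hd (hwc.intervalIntegrable _ _)]
    simp only [mul_zero, Real.sinh_zero, zero_div, sub_zero, abs_div, abs_of_pos hlpos]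
    gcongr
    exact abs_le.2 ⟨by
      have := Real.cosh_pos (l * t); have h2 := Real.sinh_lt_cosh (-(l * t))
      rw [Real.sinh_neg, Real.cosh_neg] at h2; simp only [w]; linarith,
      (Real.sinh_lt_cosh _).le⟩
  have hyc : ∀ y : BoundedContinuousFunction ℝ E, Continuous fun s => f s (w s • y s) :=
    fun y => hc _ (hwc.smul y.continuous)
  have hbd : ∀ (g : ℝ → E) (b : ℝ), 0 ≤ b → (∀ s, ‖g s‖ ≤ K * (w s * b)) → ∀ t,
      ‖(w t)⁻¹ • ∫ s in (0 : ℝ)..t, g s‖ ≤ 1 / 2 * b := by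
    intro g b hb hg t
    have h1 : ‖∫ s in (0 : ℝ)..t, g s‖ ≤ |∫ s in (0 : ℝ)..t, w s * (K * b)| :=
      intervalIntegral.norm_integral_le_abs_of_norm_le
        (Eventually.of_forall fun s => (hg s).trans_eq (by ring))
        ((hwc.mul continuous_const).intervalIntegrable _ _)
    rw [intervalIntegral.integral_mul_const, abs_mul, abs_of_nonneg (mul_nonneg hK hb)] at h1
    rw [norm_smul, norm_inv, Real.norm_of_nonneg (hwpos t).le]
    calc (w t)⁻¹ * ‖∫ s in (0 : ℝ)..t, g s‖ ≤ (w t)⁻¹ * (w t / l * (K * b)) := by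
          refine mul_le_mul_of_nonneg_left (h1.trans ?_) (inv_nonneg.2 (hwpos t).le)
          exact mul_le_mul_of_nonneg_right (hint t) (mul_nonneg hK hb)
      _ = K / l * b := by field_simp [(hwpos t).ne']
      _ ≤ 1 / 2 * b := by
          refine mul_le_mul_of_nonneg_right ?_ hb
          rw [div_le_iff₀ hlpos, hl_def]
          linarith
  have hf_norm : ∀ t x, ‖f t x‖ ≤ K * ‖x‖ := fun t x => by simpa [h0] using hl t x 0
  have hw1 : ∀ t, 1 ≤ w t := fun t => Real.one_le_cosh _
  let Φ : BoundedContinuousFunction ℝ E → BoundedContinuousFunction ℝ E := fun y =>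
    BoundedContinuousFunction.ofNormedAddCommGroup
      (fun t => (w t)⁻¹ • (ψ + ∫ s in (0 : ℝ)..t, f s (w s • y s)))
      ((hwc.inv₀ fun t => (hwpos t).ne').smul
        (continuous_const.add (intervalIntegral.continuous_primitive
          (fun a b => (hyc y).intervalIntegrable a b) 0)))
      (‖ψ‖ + 1 / 2 * ‖y‖) (by
        intro t
        rw [smul_add]
        refine (norm_add_le _ _).trans (add_le_add ?_ (hbd _ _ (norm_nonneg y) (fun s => ?_) t))
        · rw [norm_smul, norm_inv, Real.norm_of_nonneg (hwpos t).le]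
          exact mul_le_of_le_one_left (norm_nonneg _) (inv_le_one_of_one_le₀ (hw1 t))
        · refine (hf_norm _ _).trans ?_
          rw [norm_smul, Real.norm_of_nonneg (hwpos s).le]
          exact mul_le_mul_of_nonneg_left (mul_le_mul_of_nonneg_left (y.norm_coe_le_norm s)
            (hwpos s).le) hK)
  have hΦ : ContractingWith (1 / 2 : NNReal) Φ := by
    refine ⟨by simp [← NNReal.coe_lt_coe]; norm_num, LipschitzWith.of_dist_le_mul fun y z => ?_⟩
    rw [BoundedContinuousFunction.dist_le (by positivity)]
    intro t
    have e : Φ y t - Φ z t = (w t)⁻¹ • ∫ s in (0 : ℝ)..t,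
        (f s (w s • y s) - f s (w s • z s)) := by
      rw [intervalIntegral.integral_sub ((hyc y).intervalIntegrable _ _)
        ((hyc z).intervalIntegrable _ _)]
      change (w t)⁻¹ • (ψ + _) - (w t)⁻¹ • (ψ + _) = _
      rw [← smul_sub, add_sub_add_left_eq_sub]
    rw [dist_eq_norm, e]
    refine (hbd _ (dist y z) dist_nonneg (fun s => ?_) t).trans_eq (by norm_num)
    refine (hl _ _ _).trans ?_
    rw [← smul_sub, norm_smul, Real.norm_of_nonneg (hwpos s).le, ← dist_eq_norm]
    exact mul_le_mul_of_nonneg_left (mul_le_mul_of_nonneg_left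
      (BoundedContinuousFunction.dist_coe_le_dist s) (hwpos s).le) hK
  obtain ⟨y, hy⟩ : ∃ y, Φ y = y := ⟨_, hΦ.fixedPoint_isFixedPt⟩
  have hx : ∀ t, w t • y t = ψ + ∫ s in (0 : ℝ)..t, f s (w s • y s) := by
    intro t
    have h1 : (w t)⁻¹ • (ψ + ∫ s in (0 : ℝ)..t, f s (w s • y s)) = y t := DFunLike.congr_fun hy t
    rw [← h1, smul_smul, mul_inv_cancel₀ (hwpos t).ne', one_smul]
  refine ⟨fun t => w t • y t, by simp [hx 0], fun t => ?_⟩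
  have h1 := ((hyc y).integral_hasStrictDerivAt 0 t).hasDerivAt.const_add ψ
  exact h1.congr_of_eventuallyEq (Eventually.of_forall hx)

end Evolution

/-! ### Bounded symmetric perturbations -/

section Perturbation

variable {E : Type*} [NormedAddCommGroup E] [InnerProductSpace ℂ E]
  {A : E →ₗ.[ℂ] E} {U W : ℝ → E ≃ₗᵢ[ℂ] E} {B : E →L[ℂ] E}

theorem mem_graph_vadd_iff {B : E →ₗ[ℂ] E} {ψ φ : E} :
    (ψ, φ) ∈ (B +ᵥ A).graph ↔ (ψ, φ - B ψ) ∈ A.graph := by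
  simp only [LinearPMap.mem_graph_iff, LinearPMap.vadd_apply]
  constructor
  · rintro ⟨y, rfl, rfl⟩
    exact ⟨y, rfl, by simp⟩
  · rintro ⟨y, rfl, h⟩
    exact ⟨y, rfl, by
      change B y + A y = φ
      rw [h]; abel⟩

/-- The generator of the evolution in the interaction picture. -/
def interaction (U : ℝ → E ≃ₗᵢ[ℂ] E) (B : E →L[ℂ] E) (t : ℝ) (x : E) : E :=
  -Complex.I • U (-t) (B (U t x))

theorem interaction_sub (t : ℝ) (x y : E) :
    interaction U B t (x - y) = interaction U B t x - interaction U B t y := by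
  simp [interaction, sub_eq_add_neg, add_comm]

theorem norm_interaction_le (t : ℝ) (x : E) : ‖interaction U B t x‖ ≤ ‖B‖ * ‖x‖ := by
  rw [interaction, norm_smul, norm_neg, Complex.norm_I, one_mul, LinearIsometryEquiv.norm_map]
  exact (B.le_opNorm _).trans_eq (by rw [LinearIsometryEquiv.norm_map])

theorem IsUnitaryGroupOf.continuous_interaction (hU : IsUnitaryGroupOf A U) {y : ℝ → E}
    (hy : Continuous y) : Continuous fun t => interaction U B t (y t) :=
  (continuous_isometry_apply (W := fun t => U (-t)) hU.continuous_neg continuous_id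
    (B.continuous.comp (continuous_isometry_apply hU.continuous continuous_id hy))).const_smul _

theorem IsUnitaryGroupOf.exists_interaction_solution [CompleteSpace E]
    (hU : IsUnitaryGroupOf A U) (B : E →L[ℂ] E) (ψ : E) :
    ∃ x : ℝ → E, x 0 = ψ ∧ ∀ t, HasDerivAt x (interaction U B t (x t)) t :=
  exists_forall_hasDerivAt_of_lipschitz (norm_nonneg B)
    (fun _ hy => hU.continuous_interaction hy)
    (fun t x y => by rw [← interaction_sub]; exact norm_interaction_le t _)
    (fun t => by simp [interaction]) ψ

/-- The operator `U (-t) B (U t)` is symmetric, so `⟨x, x⟩` has derivative zero. Applied to a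
difference of solutions, this also gives uniqueness. -/
theorem norm_eq_of_interaction_solution (hU : IsUnitaryGroupOf A U)
    (hB : ∀ x y, inner ℂ (B x) y = inner ℂ x (B y)) {x : ℝ → E}
    (hx : ∀ t, HasDerivAt x (interaction U B t (x t)) t) (t : ℝ) : ‖x t‖ = ‖x 0‖ := by
  have hd : ∀ s, HasDerivAt (fun r => inner ℂ (x r) (x r)) (0 : ℂ) s := by
    intro s
    have h := (hx s).inner ℂ (hx s)
    have e : ∀ u v : E, inner ℂ u (U (-s) v) = inner ℂ (U s u) v := fun u v => by
      rw [← (U s).inner_map_map u, hU.apply_neg_apply]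
    have e' : ∀ u v : E, inner ℂ (U (-s) u) v = inner ℂ u (U s v) := fun u v => by
      rw [← (U s).inner_map_map _ v, hU.apply_neg_apply]
    have h0 : inner ℂ (x s) (interaction U B s (x s)) + inner ℂ (interaction U B s (x s)) (x s)
        = (0 : ℂ) := by
      rw [interaction, inner_smul_left, inner_smul_right, e, e', hB]
      simp
    rwa [h0] at h
  have h1 := is_const_of_deriv_eq_zero (fun s => (hd s).differentiableAt)
    (fun s => (hd s).deriv) t 0
  rw [inner_self_eq_norm_sq_to_K, inner_self_eq_norm_sq_to_K] at h1
  have h2 : ‖x t‖ ^ 2 = ‖x 0‖ ^ 2 := by exact_mod_cast h1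
  exact (pow_left_inj₀ (norm_nonneg _) (norm_nonneg _) two_ne_zero).1 h2

theorem interaction_solution_unique (hU : IsUnitaryGroupOf A U)
    (hB : ∀ x y, inner ℂ (B x) y = inner ℂ x (B y)) {x y : ℝ → E}
    (hx : ∀ t, HasDerivAt x (interaction U B t (x t)) t)
    (hy : ∀ t, HasDerivAt y (interaction U B t (y t)) t) (h0 : x 0 = y 0) : x = y := by
  funext t
  have := norm_eq_of_interaction_solution hU hB (x := fun s => x s - y s)
    (fun s => by rw [interaction_sub]; exact (hx s).sub (hy s)) t
  rw [h0, sub_self, norm_zero, norm_eq_zero] at this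
  exact sub_eq_zero.1 this

/-- A bounded symmetric perturbation of the generator of a unitary group generates a unitary
group. -/
theorem IsUnitaryGroupOf.exists_vadd [CompleteSpace E] (hU : IsUnitaryGroupOf A U)
    (hB : ∀ x y, inner ℂ (B x) y = inner ℂ x (B y)) :
    ∃ W, IsUnitaryGroupOf ((B : E →ₗ[ℂ] E) +ᵥ A) W := by
  -- The perturbed group will be `W t ψ = U t (x ψ t)`, with `x ψ` the solution in the interaction
  -- picture. Linearity and the group law come from uniqueness of solutions.
  choose x hx0 hx using hU.exists_interaction_solution B
  have hadd : ∀ ψ φ t, x (ψ + φ) t = x ψ t + x φ t := fun ψ φ t => by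
    refine congrFun (interaction_solution_unique hU hB (hx _) (y := fun s => x ψ s + x φ s)
      (fun s => ?_) (by simp [hx0])) t
    have := (hx ψ s).add (hx φ s)
    have e : interaction U B s (x ψ s) + interaction U B s (x φ s) =
        interaction U B s (x ψ s + x φ s) := by simp [interaction]
    rwa [e] at this
  have hsmul : ∀ (c : ℂ) ψ t, x (c • ψ) t = c • x ψ t := fun c ψ t => by
    refine congrFun (interaction_solution_unique hU hB (hx _) (y := fun s => c • x ψ s)
      (fun s => ?_) (by simp [hx0])) t
    have := (hx ψ s).const_smul c
    have e : c • interaction U B s (x ψ s) = interaction U B s (c • x ψ s) := by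
      simp [interaction, smul_smul, mul_comm]
    rwa [e] at this
  have hgrp : ∀ s t ψ, U (s + t) (x ψ (s + t)) = U s (x (U t (x ψ t)) s) := by
    intro s t ψ
    -- Shifting time by `t` and applying `U t` sends a solution to a solution, with initial value `U
    -- t (x ψ t)`.
    have h1 : (fun r => U t (x ψ (r + t))) = x (U t (x ψ t)) := by
      refine interaction_solution_unique hU hB (fun r => ?_) (hx _) (by simp [hx0])
      have h2 : HasDerivAt (fun r => x ψ (r + t)) (interaction U B (r + t) (x ψ (r + t))) r :=
        HasDerivAt.comp_add_const r t (hx ψ (r + t))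
      have h3 := ((U t).toContinuousLinearEquiv.toContinuousLinearMap.restrictScalars
        ℝ).hasFDerivAt.comp_hasDerivAt r h2
      have e : interaction U B r (U t (x ψ (r + t))) =
          U t (interaction U B (r + t) (x ψ (r + t))) := by
        simp only [interaction, map_smul]
        rw [← hU.add_apply, ← hU.add_apply, show t + -(r + t) = -r by ring]
      rw [e]
      exact h3
    rw [← h1, hU.add_apply]
  let X : ℝ → E →ₗᵢ[ℂ] E := fun t =>
    { toFun := fun ψ => U t (x ψ t)
      map_add' := fun ψ φ => by rw [hadd, map_add]
      map_smul' := fun c ψ => by rw [hsmul, map_smul]; rfl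
      norm_map' := fun ψ => by
        change ‖U t (x ψ t)‖ = _
        rw [LinearIsometryEquiv.norm_map, norm_eq_of_interaction_solution hU hB (hx ψ), hx0] }
  have hX : ∀ t ψ, X t ψ = U t (x ψ t) := fun _ _ => rfl
  let W : ℝ → E ≃ₗᵢ[ℂ] E := fun t => LinearIsometryEquiv.ofSurjective (X t) fun ψ => by
    refine ⟨X (-t) ψ, ?_⟩
    rw [hX, hX, ← hgrp, add_neg_cancel, hx0, hU.zero_apply]
  have hW : ∀ t ψ, W t ψ = U t (x ψ t) := fun _ _ => rfl
  refine ⟨W, ⟨?_, fun s t => ?_, fun ψ => ?_, fun ψ φ => ?_⟩⟩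
  · ext ψ
    rw [hW, hx0, hU.zero_apply]; rfl
  · ext ψ
    rw [hW, hgrp]; rfl
  · exact continuous_isometry_apply hU.continuous continuous_id
      (continuous_iff_continuousAt.2 fun t => (hx ψ t).continuousAt)
  · rw [mem_graph_vadd_iff, hU.generator]
    -- The difference `W t ψ - U t ψ` is differentiable at `0` for every `ψ`. Hence `W t ψ` and `U t
    -- ψ` are differentiable at `0` for the same vectors, so the domain is unchanged.
    have h1 : HasDerivAt (fun t => U t (x ψ t - ψ)) (-Complex.I • B ψ) 0 := by
      have h2 := hasDerivAt_isometry_apply_of_eq_zero hU.continuous ((hx ψ 0).sub_const ψ)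
        (by rw [hx0, sub_self])
      simpa [interaction, hU.zero_apply, hx0] using h2
    constructor
    · intro h
      have := h.add h1
      refine (this.congr_deriv (by rw [smul_sub]; exact sub_add_cancel _ _)).congr_of_eventuallyEq
        (Eventually.of_forall fun t => ?_)
      simp [hW]
    · intro h
      have := h.sub h1
      refine (this.congr_deriv (by rw [smul_sub]; rfl)).congr_of_eventuallyEq
        (Eventually.of_forall fun t => ?_)
      simp [hW]

/-- Duhamel's formula. -/
theorem IsUnitaryGroupOf.duhamel [CompleteSpace E] (hU : IsUnitaryGroupOf A U)
    (hW : IsUnitaryGroupOf ((B : E →ₗ[ℂ] E) +ᵥ A) W) (ψ : E) (t : ℝ) :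
    W (-t) (U t ψ) = ψ + ∫ s in (0 : ℝ)..t, W (-s) (Complex.I • B (U s ψ)) := by
  have hcont : ∀ ψ, Continuous fun s => W (-s) (Complex.I • B (U s ψ)) := fun ψ =>
    continuous_isometry_apply (W := fun t => W (-t)) hW.continuous_neg continuous_id
      ((B.continuous.comp (hU.continuous ψ)).const_smul _)
  -- Both sides of the formula are continuous in `ψ`, so it suffices to differentiate `W (-r) (U r
  -- ψ)` for `ψ` in the dense domain, where the unbounded parts of the two generators cancel.
  have hint : Continuous fun ψ => ∫ s in (0 : ℝ)..t, W (-s) (Complex.I • B (U s ψ)) := by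
    have hb : ∀ ψ φ, ‖(∫ s in (0 : ℝ)..t, W (-s) (Complex.I • B (U s ψ))) -
        ∫ s in (0 : ℝ)..t, W (-s) (Complex.I • B (U s φ))‖ ≤ ‖B‖ * |t| * ‖ψ - φ‖ := by
      intro ψ φ
      rw [← intervalIntegral.integral_sub ((hcont _).intervalIntegrable _ _)
        ((hcont _).intervalIntegrable _ _)]
      refine (intervalIntegral.norm_integral_le_of_norm_le_const
        (C := ‖B‖ * ‖ψ - φ‖) fun s _ => ?_).trans_eq (by rw [sub_zero]; ring)
      rw [← map_sub, ← smul_sub, ← map_sub, ← map_sub, LinearIsometryEquiv.norm_map, norm_smul,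
        Complex.norm_I, one_mul]
      exact (B.le_opNorm _).trans_eq (by rw [LinearIsometryEquiv.norm_map])
    refine (LipschitzWith.of_dist_le_mul (K := ⟨‖B‖ * |t|, by positivity⟩) fun ψ φ => ?_).continuous
    rw [dist_eq_norm, dist_eq_norm]
    exact hb ψ φ
  refine congrFun (Continuous.ext_on hU.dense_domain
    ((W (-t)).continuous.comp (U t).continuous) (continuous_id.add hint) fun ψ hψ => ?_) ψ
  have hg : (ψ, A ⟨ψ, hψ⟩) ∈ A.graph := A.mem_graph ⟨ψ, hψ⟩
  have hd : ∀ s, HasDerivAt (fun r => W (-r) (U r ψ)) (W (-s) (Complex.I • B (U s ψ))) s := by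
    intro s
    obtain ⟨h1, h2⟩ := hU.mem_graph_and_hasDerivAt hg s
    have h3 : (U s ψ, U s (A ⟨ψ, hψ⟩) + B (U s ψ)) ∈ ((B : E →ₗ[ℂ] E) +ᵥ A).graph :=
      mem_graph_vadd_iff.2 (by simpa using h1)
    exact (hW.hasDerivAt_neg_apply h2 h3).congr_deriv (by simp [smul_add, add_comm])
  have := intervalIntegral.integral_eq_sub_of_hasDerivAt (fun s _ => hd s)
    ((hcont ψ).intervalIntegrable 0 t)
  simp only [Function.comp_apply, Pi.add_apply, id]
  rw [this]
  simp [hU.zero_apply, hW.zero_apply]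

/-- No domain condition on `ψ` is needed: the integrand in Duhamel's formula is continuous for every
`ψ`. -/
theorem IsUnitaryGroupOf.hasDerivAt_duhamel [CompleteSpace E] (hU : IsUnitaryGroupOf A U)
    (hW : IsUnitaryGroupOf ((B : E →ₗ[ℂ] E) +ᵥ A) W) (ψ : E) (t : ℝ) :
    HasDerivAt (fun t => W (-t) (U t ψ)) (W (-t) (Complex.I • B (U t ψ))) t := by
  have hcont : Continuous fun s => W (-s) (Complex.I • B (U s ψ)) :=
    continuous_isometry_apply (W := fun t => W (-t)) hW.continuous_neg continuous_id
      ((B.continuous.comp (hU.continuous ψ)).const_smul _)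
  exact ((hcont.integral_hasStrictDerivAt 0 t).hasDerivAt.const_add ψ).congr_of_eventuallyEq
    (Eventually.of_forall fun s => hU.duhamel hW ψ s)

end Perturbation

/-! ### Stability of the notions of ballistic transport -/

section Stability

/-- Two moments bound each other for positive times, up to a factor and a constant. -/
def Comparable (m₀ m : ℝ → ℝ≥0∞) : Prop :=
  ∃ D : ℝ, 0 ≤ D ∧ ∀ t, 0 < t →
    m t ≤ 2 * m₀ t + ENNReal.ofReal D ∧ m₀ t ≤ 2 * m t + ENNReal.ofReal D

theorem two_mul_ofReal_add_ofReal {x D : ℝ} (hx : 0 ≤ x) (hD : 0 ≤ D) :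
    2 * ENNReal.ofReal x + ENNReal.ofReal D = ENNReal.ofReal (2 * x + D) := by
  rw [ENNReal.ofReal_add (by positivity) hD, ENNReal.ofReal_mul (p := 2) (by simp)]
  simp

theorem NormGrowth.of_comparable {m₀ m : ℝ → ℝ≥0∞} (h : Comparable m₀ m) (h₀ : NormGrowth m₀) :
    NormGrowth m := by
  obtain ⟨D, hD, h⟩ := h
  obtain ⟨c, C, hc, hC, hm⟩ := h₀
  -- Once `D ≤ (c / 2) t²`, having `m t < (c / 4) t²` would give `m₀ t < c t²`. For the upper bound,
  -- `D ≤ D t²` when `t ≥ 1`.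
  refine ⟨c / 4, 2 * C + D, by positivity, by positivity, ?_⟩
  have ev : ∀ᶠ t : ℝ in atTop, D ≤ c / 2 * t ^ 2 :=
    ((tendsto_pow_atTop two_ne_zero).const_mul_atTop (by positivity)).eventually_ge_atTop D
  filter_upwards [hm, ev, eventually_ge_atTop 1] with t ht hDt ht1
  obtain ⟨h1, h2⟩ := h t (by linarith)
  constructor
  · by_contra! hlt
    have h3 : 2 * m t + ENNReal.ofReal D < ENNReal.ofReal (c * t ^ 2) := by
      calc 2 * m t + ENNReal.ofReal D
          < 2 * ENNReal.ofReal (c / 4 * t ^ 2) + ENNReal.ofReal D := by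
            refine ENNReal.add_lt_add_right ENNReal.ofReal_ne_top ?_
            exact (ENNReal.mul_lt_mul_iff_right (by simp) (by simp)).2 hlt
        _ = ENNReal.ofReal (2 * (c / 4 * t ^ 2) + D) := by
            exact two_mul_ofReal_add_ofReal (by positivity) hD
        _ ≤ ENNReal.ofReal (c * t ^ 2) := ENNReal.ofReal_le_ofReal (by linarith)
    exact absurd (ht.1.trans h2) (not_le.2 h3)
  · calc m t ≤ 2 * ENNReal.ofReal (C * t ^ 2) + ENNReal.ofReal D := h1.trans (by gcongr; exact ht.2)
      _ = ENNReal.ofReal (2 * (C * t ^ 2) + D) := by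
            exact two_mul_ofReal_add_ofReal (by positivity) hD
      _ ≤ _ := ENNReal.ofReal_le_ofReal (by
        nlinarith [mul_le_mul_of_nonneg_left (one_le_pow₀ ht1 : 1 ≤ t ^ 2) hD])

theorem exponentOne_iff_tendsto {m : ℝ → ℝ≥0∞} : ExponentOne m ↔
    Tendsto (fun t : ℝ => ENNReal.log (m t) / ((2 * Real.log t : ℝ) : EReal)) atTop (𝓝 1) :=
  ⟨fun h => tendsto_of_liminf_eq_limsup h.2 h.1, fun h => ⟨h.limsup_eq, h.liminf_eq⟩⟩

theorem log_ofReal_exp (x : ℝ) : ENNReal.log (ENNReal.ofReal (Real.exp x)) = x := by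
  rw [ENNReal.log_ofReal_of_pos (Real.exp_pos x), Real.log_exp]

theorem coe_lt_log_div_iff {m : ℝ≥0∞} {a l : ℝ} (hl : 0 < l) :
    (a : EReal) < ENNReal.log m / (l : EReal) ↔ ENNReal.ofReal (Real.exp (a * l)) < m := by
  rw [EReal.lt_div_iff (by exact_mod_cast hl) (EReal.coe_ne_top _), ← EReal.coe_mul,
    ← log_ofReal_exp, ENNReal.log_lt_log_iff]

theorem log_div_lt_coe_iff {m : ℝ≥0∞} {a l : ℝ} (hl : 0 < l) :
    ENNReal.log m / (l : EReal) < (a : EReal) ↔ m < ENNReal.ofReal (Real.exp (a * l)) := by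
  rw [EReal.div_lt_iff (by exact_mod_cast hl) (EReal.coe_ne_top _), ← EReal.coe_mul,
    ← log_ofReal_exp, ENNReal.log_lt_log_iff]

theorem eventually_two_mul_exp_add_lt {a b : ℝ} (hab : a < b) (hb : 0 < b) (D : ℝ) :
    ∀ᶠ u : ℝ in atTop, 2 * Real.exp (a * u) + D < Real.exp (b * u) := by
  have h : ∀ c : ℝ, 0 < c → Tendsto (fun u : ℝ => Real.exp (-(c * u))) atTop (𝓝 0) := fun c hc =>
    Real.tendsto_exp_neg_atTop_nhds_zero.comp (tendsto_id.const_mul_atTop hc)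
  have h1 : Tendsto (fun u : ℝ => 2 * Real.exp (-((b - a) * u)) + D * Real.exp (-(b * u))) atTop
      (𝓝 (2 * 0 + D * 0)) := ((h _ (sub_pos.2 hab)).const_mul 2).add ((h b hb).const_mul D)
  filter_upwards [h1.eventually_lt_const (u := 1) (by norm_num)] with u hu
  have h2 := mul_lt_mul_of_pos_right hu (Real.exp_pos (b * u))
  rw [add_mul, mul_assoc, mul_assoc, ← Real.exp_add, ← Real.exp_add] at h2
  ring_nf at h2 ⊢
  simpa using h2

theorem tendsto_two_mul_log : Tendsto (fun t : ℝ => 2 * Real.log t) atTop atTop :=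
  Real.tendsto_log_atTop.const_mul_atTop two_pos

theorem ExponentOne.of_comparable {m₀ m : ℝ → ℝ≥0∞} (h : Comparable m₀ m) (h₀ : ExponentOne m₀) :
    ExponentOne m := by
  obtain ⟨D, hD, h⟩ := h
  rw [exponentOne_iff_tendsto, tendsto_order] at h₀ ⊢
  have hlog : ∀ᶠ t : ℝ in atTop, 0 < 2 * Real.log t :=
    tendsto_two_mul_log.eventually_gt_atTop 0
  constructor
  · intro a ha
    obtain ⟨x, hax, hx1⟩ := EReal.lt_iff_exists_real_btwn.1 ha
    have hx1' : x < 1 := by exact_mod_cast hx1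
    -- The exponent `b` is chosen above `0` as well as above `x`, so that `e^{b u}` absorbs the
    -- constant `D` even when `x` is negative.
    obtain ⟨b, hb, hb1⟩ := exists_between (max_lt hx1' one_pos)
    have hexp := tendsto_two_mul_log.eventually (eventually_two_mul_exp_add_lt
      ((le_max_left _ _).trans_lt hb) ((le_max_right _ _).trans_lt hb) D)
    filter_upwards [h₀.1 b (by exact_mod_cast hb1), hlog, hexp, eventually_gt_atTop 0]
      with t ht hl he ht0
    refine hax.trans ((coe_lt_log_div_iff hl).2 ?_)
    rw [coe_lt_log_div_iff hl] at ht
    by_contra! hlt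
    have : m₀ t < ENNReal.ofReal (Real.exp (b * (2 * Real.log t))) := by
      refine (h t ht0).2.trans_lt ?_
      calc 2 * m t + ENNReal.ofReal D
          ≤ 2 * ENNReal.ofReal (Real.exp (x * (2 * Real.log t))) + ENNReal.ofReal D := by gcongr
        _ < _ := by
          rw [two_mul_ofReal_add_ofReal (Real.exp_pos _).le hD]
          exact (ENNReal.ofReal_lt_ofReal_iff (Real.exp_pos _)).2 he
    exact lt_asymm ht this
  · intro a ha
    obtain ⟨x, hx1, hax⟩ := EReal.lt_iff_exists_real_btwn.1 ha
    have hx1' : 1 < x := by exact_mod_cast hx1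
    obtain ⟨b, hb1, hb⟩ := exists_between hx1'
    have hexp := tendsto_two_mul_log.eventually (eventually_two_mul_exp_add_lt hb
      (one_pos.trans hx1') D)
    filter_upwards [h₀.2 b (by exact_mod_cast hb1), hlog, hexp, eventually_gt_atTop 0]
      with t ht hl he ht0
    refine lt_trans ((log_div_lt_coe_iff hl).2 ?_) hax
    rw [log_div_lt_coe_iff hl] at ht
    refine (h t ht0).1.trans_lt ?_
    calc 2 * m₀ t + ENNReal.ofReal D
        ≤ 2 * ENNReal.ofReal (Real.exp (b * (2 * Real.log t))) + ENNReal.ofReal D := by gcongr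
      _ < _ := by
        rw [two_mul_ofReal_add_ofReal (Real.exp_pos _).le hD]
        exact (ENNReal.ofReal_lt_ofReal_iff (Real.exp_pos _)).2 he

/-! ### Averages of comparable moments -/

/-- The affine bound is integrated against a weight of total mass at most one, which leaves the
constant `D` unchanged. The moments need not be measurable: additivity of the integral is used with
only the summand `w t * D` measurable. -/
theorem weighted_average_le {m₀ m : ℝ → ℝ≥0∞} {w : ℝ → ℝ≥0∞} (hw : Measurable w) {S : Set ℝ}
    (hS : MeasurableSet S) {c D : ℝ≥0∞} (h : ∀ t ∈ S, m t ≤ 2 * m₀ t + D)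
    (hc : c * ∫⁻ t in S, w t ≤ 1) :
    c * ∫⁻ t in S, w t * m t ≤ 2 * (c * ∫⁻ t in S, w t * m₀ t) + D := by
  calc c * ∫⁻ t in S, w t * m t
      ≤ c * ∫⁻ t in S, (2 * (w t * m₀ t) + w t * D) := by
        gcongr 1
        refine setLIntegral_mono' hS fun t ht => (mul_le_mul_right (h t ht) _).trans_eq ?_
        ring
    _ = 2 * (c * ∫⁻ t in S, w t * m₀ t) + (c * ∫⁻ t in S, w t) * D := by
        rw [lintegral_add_right _ (hw.mul_const _), lintegral_const_mul' _ _ (by simp),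
          lintegral_mul_const _ hw]
        ring
    _ ≤ _ := by gcongr; exact mul_le_of_le_one_left zero_le hc

theorem abel_weight {T : ℝ} (hT : 0 < T) : ENNReal.ofReal (2 / T) *
    ∫⁻ t in Ioi (0 : ℝ), ENNReal.ofReal (Real.exp (-(2 * t / T))) = 1 := by
  have h2 : 0 < 2 / T := by positivity
  have e : (fun t : ℝ => Real.exp (-(2 * t / T))) = fun t => Real.exp (-(2 / T) * t) := by
    funext t; congr 1; ring
  rw [← ofReal_integral_eq_lintegral_ofReal, ← ENNReal.ofReal_mul h2.le]
  · simp_rw [e]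
    rw [integral_exp_mul_Ioi (neg_lt_zero.2 h2)]
    have : 2 / T * (-Real.exp (-(2 / T) * 0) / -(2 / T)) = 1 := by
      simp only [mul_zero, Real.exp_zero]; field_simp
    rw [this, ENNReal.ofReal_one]
  · rw [e]
    exact integrableOn_exp_mul_Ioi (neg_lt_zero.2 h2) 0
  · exact Eventually.of_forall fun t => (Real.exp_pos _).le

theorem Comparable.abelAverage {m₀ m : ℝ → ℝ≥0∞} (h : Comparable m₀ m) :
    Comparable (abelAverage m₀) (abelAverage m) := by
  obtain ⟨D, hD, h⟩ := h
  have hw : ∀ T, Measurable fun t : ℝ => ENNReal.ofReal (Real.exp (-(2 * t / T))) := fun T => by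
    fun_prop
  exact ⟨D, hD, fun T hT =>
    ⟨weighted_average_le (hw T) measurableSet_Ioi (fun t ht => (h t ht).1) (abel_weight hT).le,
     weighted_average_le (hw T) measurableSet_Ioi (fun t ht => (h t ht).2) (abel_weight hT).le⟩⟩

theorem cesaro_weight {T : ℝ} (hT : 0 < T) :
    ENNReal.ofReal (1 / T) * ∫⁻ _ in Ioc (0 : ℝ) T, 1 = 1 := by
  rw [lintegral_one, Measure.restrict_apply_univ, Real.volume_Ioc, sub_zero,
    ← ENNReal.ofReal_mul (by positivity), one_div_mul_cancel hT.ne', ENNReal.ofReal_one]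

theorem Comparable.cesaroAverage {m₀ m : ℝ → ℝ≥0∞} (h : Comparable m₀ m) :
    Comparable (cesaroAverage m₀) (cesaroAverage m) := by
  obtain ⟨D, hD, h⟩ := h
  refine ⟨D, hD, fun T hT => ?_⟩
  have h1 := weighted_average_le (m₀ := m₀) (m := m) (w := 1) measurable_one measurableSet_Ioc
    (fun t ht => (h t ht.1).1) (cesaro_weight hT).le
  have h2 := weighted_average_le (m₀ := m) (m := m₀) (w := 1) measurable_one measurableSet_Ioc
    (fun t ht => (h t ht.1).2) (cesaro_weight hT).le
  simp only [Pi.one_apply, one_mul] at h1 h2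
  exact ⟨h1, h2⟩

theorem TransportNotion.Holds.of_comparable {m₀ m : ℝ → ℝ≥0∞} {N : TransportNotion}
    (h₀ : N.Holds m₀) (h : Comparable m₀ m) : N.Holds m := by
  cases N
  · exact NormGrowth.of_comparable h h₀
  · exact ExponentOne.of_comparable h h₀
  · exact NormGrowth.of_comparable h.abelAverage h₀
  · exact ExponentOne.of_comparable h.abelAverage h₀
  · exact NormGrowth.of_comparable h.cesaroAverage h₀
  · exact ExponentOne.of_comparable h.cesaroAverage h₀

/-! ### Finiteness of the moment at some time -/

theorem NormGrowth.exists_lt_top {m : ℝ → ℝ≥0∞} (h : NormGrowth m) : ∃ t, 0 < t ∧ m t < ∞ := by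
  obtain ⟨c, C, -, -, h⟩ := h
  obtain ⟨t, ht, ht0⟩ := (h.and (eventually_gt_atTop 0)).exists
  exact ⟨t, ht0, ht.2.trans_lt ENNReal.ofReal_lt_top⟩

theorem ExponentOne.exists_lt_top {m : ℝ → ℝ≥0∞} (h : ExponentOne m) : ∃ t, 0 < t ∧ m t < ∞ := by
  have h1 := (exponentOne_iff_tendsto.1 h).eventually_lt_const (u := ((2 : ℝ) : EReal))
    (by exact_mod_cast one_lt_two)
  obtain ⟨t, ht, hl, ht0⟩ := (h1.and ((tendsto_two_mul_log.eventually_gt_atTop 0).and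
    (eventually_gt_atTop 0))).exists
  exact ⟨t, ht0, ((log_div_lt_coe_iff hl).1 ht).trans ENNReal.ofReal_lt_top⟩

/-- A moment that is infinite at all positive times has infinite average, because the weight has
total mass one. -/
theorem exists_lt_top_of_abelAverage {m : ℝ → ℝ≥0∞} {T : ℝ} (hT : 0 < T)
    (h : abelAverage m T < ∞) : ∃ t, 0 < t ∧ m t < ∞ := by
  by_contra! hm
  have e : abelAverage m T = abelAverage (fun _ => ∞) T := by
    rw [abelAverage, abelAverage, setLIntegral_congr_fun measurableSet_Ioi]
    intro t ht
    simp [top_le_iff.1 (hm t ht)]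
  rw [e, abelAverage, lintegral_mul_const _ (by fun_prop), ← mul_assoc, abel_weight hT] at h
  simp at h

theorem exists_lt_top_of_cesaroAverage {m : ℝ → ℝ≥0∞} {T : ℝ} (hT : 0 < T)
    (h : cesaroAverage m T < ∞) : ∃ t, 0 < t ∧ m t < ∞ := by
  by_contra! hm
  have e : cesaroAverage m T = ENNReal.ofReal (1 / T) * ∫⁻ _ in Ioc (0 : ℝ) T, 1 * ∞ := by
    rw [cesaroAverage, setLIntegral_congr_fun measurableSet_Ioc]
    intro t ht
    simp [top_le_iff.1 (hm t ht.1)]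
  rw [e, lintegral_mul_const _ measurable_const, ← mul_assoc, cesaro_weight hT] at h
  simp at h

/-- This is how the averaged case learns that the position operators can be applied to the evolved
state at all. -/
theorem TransportNotion.Holds.exists_lt_top {m : ℝ → ℝ≥0∞} {N : TransportNotion}
    (h : N.Holds m) : ∃ t, 0 < t ∧ m t < ∞ := by
  cases N
  · exact NormGrowth.exists_lt_top h
  · exact ExponentOne.exists_lt_top h
  · obtain ⟨T, hT, h⟩ := NormGrowth.exists_lt_top h
    exact exists_lt_top_of_abelAverage hT h
  · obtain ⟨T, hT, h⟩ := ExponentOne.exists_lt_top h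
    exact exists_lt_top_of_abelAverage hT h
  · obtain ⟨T, hT, h⟩ := NormGrowth.exists_lt_top h
    exact exists_lt_top_of_cesaroAverage hT h
  · obtain ⟨T, hT, h⟩ := ExponentOne.exists_lt_top h
    exact exists_lt_top_of_cesaroAverage hT h

end Stability

/-! ### Multiplication operators and their unitary groups -/

section MultiplicationGroups

variable {X : Type*} [MeasurableSpace X] {μ : Measure X}

theorem hasDerivAt_zero_iff_tendsto {E : Type*} [NormedAddCommGroup E] [InnerProductSpace ℂ E]
    {x : ℝ → E} {y : E} : HasDerivAt x y 0 ↔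
      Tendsto (fun t : ℝ => ((t⁻¹ : ℝ) : ℂ) • (x t - x 0)) (𝓝[≠] 0) (𝓝 y) := by
  rw [hasDerivAt_iff_tendsto_slope]
  refine tendsto_congr fun t => ?_
  rw [slope, vsub_eq_sub, sub_zero, Complex.coe_smul]

theorem mem_graph_mulOperator_iff {f : X → ℝ} {ψ φ : Lp ℂ 2 μ} :
    (ψ, φ) ∈ (mulOperator μ f).graph ↔ φ =ᵐ[μ] fun x => (f x : ℂ) * ψ x := by
  rw [LinearPMap.mem_graph_iff]
  constructor
  · rintro ⟨y, rfl, rfl⟩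
    exact MemLp.coeFn_toLp (f := fun x => (f x : ℂ) * (y : Lp ℂ 2 μ) x) y.2
  · intro h
    have hm : MemLp (fun x => (f x : ℂ) * ψ x) 2 μ := (memLp_congr_ae h).1 (Lp.memLp φ)
    refine ⟨⟨ψ, hm⟩, rfl, Lp.ext ?_⟩
    exact (MemLp.coeFn_toLp hm).trans h.symm

theorem aestronglyMeasurable_mul {f : X → ℝ} (hf : Measurable f) (ψ : Lp ℂ 2 μ) :
    AEStronglyMeasurable (fun x => (f x : ℂ) * ψ x) μ :=
  (Complex.measurable_ofReal.comp hf).aestronglyMeasurable.mul (Lp.aestronglyMeasurable ψ)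

/-- With `f` measurable, the product is measurable, so a vector fails to be in the domain only
because the `L²` norm is infinite; the two conventions for the value `∞` then agree. -/
theorem opNorm_mulOperator {f : X → ℝ} (hf : Measurable f) (ψ : Lp ℂ 2 μ) :
    opNorm (mulOperator μ f) ψ = eLpNorm (fun x => (f x : ℂ) * ψ x) 2 μ := by
  unfold opNorm
  split_ifs with h
  · exact Lp.enorm_toLp (f := fun x => (f x : ℂ) * ψ x) h
  · by_contra hne
    exact h ⟨aestronglyMeasurable_mul hf ψ, lt_top_iff_ne_top.2 (Ne.symm hne)⟩

theorem opNorm_mulOperator_lt_top_iff {f : X → ℝ} {ψ : Lp ℂ 2 μ} :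
    opNorm (mulOperator μ f) ψ < ∞ ↔ ψ ∈ (mulOperator μ f).domain := by
  unfold opNorm
  split_ifs with h
  · simp [h, enorm_lt_top]
  · simp [h]

theorem opNorm_eq_of_mem_graph {E : Type*} [NormedAddCommGroup E] [InnerProductSpace ℂ E]
    {A : E →ₗ.[ℂ] E} {ψ φ : E} (h : (ψ, φ) ∈ A.graph) : opNorm A ψ = ‖φ‖ₑ := by
  rw [LinearPMap.mem_graph_iff] at h
  obtain ⟨y, rfl, rfl⟩ := h
  rw [opNorm, dif_pos y.2]

theorem opNorm_mulOperator_add_le {f : X → ℝ} (hf : Measurable f) (ψ φ : Lp ℂ 2 μ) :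
    opNorm (mulOperator μ f) (ψ + φ) ≤ opNorm (mulOperator μ f) ψ + opNorm (mulOperator μ f) φ := by
  rw [opNorm_mulOperator hf, opNorm_mulOperator hf, opNorm_mulOperator hf]
  refine (eLpNorm_congr_ae ?_).trans_le (eLpNorm_add_le (aestronglyMeasurable_mul hf ψ)
    (aestronglyMeasurable_mul hf φ) (by norm_num))
  filter_upwards [Lp.coeFn_add ψ φ] with x hx
  rw [hx]
  exact mul_add _ _ _

/-- The factor `e^{-i a}`. -/
noncomputable def phaseFactor (a : ℝ) : ℂ := Complex.exp (Complex.I * ((-a : ℝ) : ℂ))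

theorem norm_phaseFactor (a : ℝ) : ‖phaseFactor a‖ = 1 := by
  rw [phaseFactor, mul_comm, Complex.norm_exp_ofReal_mul_I]

theorem phaseFactor_zero : phaseFactor 0 = 1 := by simp [phaseFactor]

theorem phaseFactor_add (a b : ℝ) : phaseFactor (a + b) = phaseFactor a * phaseFactor b := by
  rw [phaseFactor, phaseFactor, phaseFactor, ← Complex.exp_add]
  congr 1
  push_cast
  ring

theorem continuous_phaseFactor : Continuous phaseFactor := by
  unfold phaseFactor; fun_prop

theorem norm_phaseFactor_sub_one_le (a : ℝ) : ‖phaseFactor a - 1‖ ≤ |a| := by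
  have := Real.norm_exp_I_mul_ofReal_sub_one_le (x := -a)
  rwa [Real.norm_eq_abs, abs_neg] at this

theorem hasDerivAt_phaseFactor_mul (a : ℝ) :
    HasDerivAt (fun t : ℝ => phaseFactor (t * a)) (-Complex.I * a) 0 := by
  have h : HasDerivAt (fun t : ℝ => ((-(t * a) : ℝ) : ℂ)) ((-a : ℝ) : ℂ) 0 := by
    have := ((hasDerivAt_id (0 : ℝ)).mul_const a).neg
    simpa using this.ofReal_comp
  have h2 := (h.const_mul Complex.I).cexp
  simpa [phaseFactor] using h2

theorem memLp_phaseFactor_mul {f : X → ℝ} (hf : Measurable f) (ψ : Lp ℂ 2 μ) :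
    MemLp (fun x => phaseFactor (f x) * ψ x) 2 μ := by
  refine (Lp.memLp ψ).of_le ((continuous_phaseFactor.measurable.comp
    hf).aestronglyMeasurable.mul (Lp.aestronglyMeasurable ψ)) (Eventually.of_forall fun x => ?_)
  rw [norm_mul, norm_phaseFactor, one_mul]

/-- Multiplication by `e^{-i f}` as an isometry of `L²`. -/
noncomputable def phaseIsometry (μ : Measure X) (f : X → ℝ) (hf : Measurable f) :
    Lp ℂ 2 μ →ₗᵢ[ℂ] Lp ℂ 2 μ where
  toFun ψ := (memLp_phaseFactor_mul hf ψ).toLp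
  map_add' ψ φ := by
    rw [← MemLp.toLp_add]
    refine MemLp.toLp_congr _ _ ?_
    filter_upwards [Lp.coeFn_add ψ φ] with x hx
    rw [hx]
    exact mul_add _ _ _
  map_smul' c ψ := by
    rw [RingHom.id_apply, ← MemLp.toLp_const_smul]
    refine MemLp.toLp_congr _ _ ?_
    filter_upwards [Lp.coeFn_smul c ψ] with x hx
    simp only [hx, Pi.smul_apply, smul_eq_mul]
    ring
  norm_map' ψ := by
    change ‖(memLp_phaseFactor_mul hf ψ).toLp‖ = _
    rw [Lp.norm_toLp, Lp.norm_def]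
    congr 1
    refine eLpNorm_congr_norm_ae (Eventually.of_forall fun x => ?_)
    rw [norm_mul, norm_phaseFactor, one_mul]

theorem coeFn_phaseIsometry {f : X → ℝ} (hf : Measurable f) (ψ : Lp ℂ 2 μ) :
    phaseIsometry μ f hf ψ =ᵐ[μ] fun x => phaseFactor (f x) * ψ x :=
  MemLp.coeFn_toLp (memLp_phaseFactor_mul hf ψ)

/-- Multiplication by `e^{-i f}` as a unitary operator of `L²`. -/
noncomputable def phase (μ : Measure X) (f : X → ℝ) (hf : Measurable f) :
    Lp ℂ 2 μ ≃ₗᵢ[ℂ] Lp ℂ 2 μ :=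
  LinearIsometryEquiv.ofSurjective (phaseIsometry μ f hf) fun ψ => by
    refine ⟨phaseIsometry μ (-f) hf.neg ψ, Lp.ext ?_⟩
    filter_upwards [coeFn_phaseIsometry hf (phaseIsometry μ (-f) hf.neg ψ),
      coeFn_phaseIsometry hf.neg ψ] with x h1 h2
    rw [h1, h2, ← mul_assoc, ← phaseFactor_add, Pi.neg_apply, add_neg_cancel, phaseFactor_zero,
      one_mul]

theorem coeFn_phase {f : X → ℝ} (hf : Measurable f) (ψ : Lp ℂ 2 μ) :
    phase μ f hf ψ =ᵐ[μ] fun x => phaseFactor (f x) * ψ x :=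
  coeFn_phaseIsometry hf ψ

/-- The unitary group `s ↦ e^{-i s f}` of multiplication operators. -/
noncomputable def phaseGroup (μ : Measure X) (f : X → ℝ) (hf : Measurable f) (s : ℝ) :
    Lp ℂ 2 μ ≃ₗᵢ[ℂ] Lp ℂ 2 μ :=
  phase μ (fun x => s * f x) (hf.const_mul s)

theorem coeFn_phaseGroup {f : X → ℝ} (hf : Measurable f) (s : ℝ) (ψ : Lp ℂ 2 μ) :
    phaseGroup μ f hf s ψ =ᵐ[μ] fun x => phaseFactor (s * f x) * ψ x :=
  coeFn_phase _ ψ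

/-- Dominated convergence in `L²`. -/
theorem tendsto_Lp_of_dominated {ι : Type*} {l : Filter ι} [l.IsCountablyGenerated]
    {F : ι → Lp ℂ 2 μ} {G : Lp ℂ 2 μ} {f : ι → X → ℂ} {g : X → ℂ} {b : X → ℂ}
    (hF : ∀ i, F i =ᵐ[μ] f i) (hG : G =ᵐ[μ] g) (hb : MemLp b 2 μ)
    (hbound : ∀ i x, ‖f i x - g x‖ ≤ ‖b x‖)
    (hlim : ∀ x, Tendsto (fun i => f i x) l (𝓝 (g x))) : Tendsto F l (𝓝 G) := by
  rw [Lp.tendsto_Lp_iff_tendsto_eLpNorm']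
  have e : ∀ i, eLpNorm (⇑(F i) - ⇑G) 2 μ = (∫⁻ x, ‖f i x - g x‖ₑ ^ (2 : ℝ) ∂μ) ^ (1 / 2 : ℝ) := by
    intro i
    rw [eLpNorm_congr_ae ((hF i).sub hG), eLpNorm_eq_lintegral_rpow_enorm_toReal (by norm_num)
      (by norm_num)]
    rfl
  simp_rw [e]
  have hfm : ∀ i, AEStronglyMeasurable (f i) μ := fun i =>
    (Lp.aestronglyMeasurable (F i)).congr (hF i)
  have hgm : AEStronglyMeasurable g μ := (Lp.aestronglyMeasurable G).congr hG
  have h := tendsto_lintegral_filter_of_dominated_convergence' (μ := μ) (l := l)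
    (F := fun i x => ‖f i x - g x‖ₑ ^ (2 : ℝ)) (f := fun _ => 0) (fun x => ‖b x‖ₑ ^ (2 : ℝ))
    (Eventually.of_forall fun i => ((hfm i).sub hgm).enorm.pow_const _)
    (Eventually.of_forall fun i => Eventually.of_forall fun x =>
      ENNReal.rpow_le_rpow (enorm_le_iff_norm_le.2 (hbound i x)) (by norm_num))
    (by
      have := lintegral_rpow_enorm_lt_top_of_eLpNorm_lt_top (by norm_num) (by norm_num) hb.2
      exact this.ne)
    (Eventually.of_forall fun x => by
      have h1 : Tendsto (fun i => ‖f i x - g x‖ₑ) l (𝓝 0) := by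
        have := ((hlim x).sub_const (g x)).enorm
        simpa using this
      have h2 := (ENNReal.continuous_rpow_const (y := (2 : ℝ))).tendsto 0 |>.comp h1
      simpa [Function.comp_def] using h2)
  have h3 := (ENNReal.continuous_rpow_const (y := (1 / 2 : ℝ))).tendsto _ |>.comp h
  simpa [Function.comp_def] using h3

/-- Multiplication by the real function `f` generates the unitary group `e^{-i s f}`. -/
theorem isUnitaryGroupOf_phaseGroup {f : X → ℝ} (hf : Measurable f) :
    IsUnitaryGroupOf (mulOperator μ f) (phaseGroup μ f hf) := by
  refine ⟨?_, fun s t => ?_, fun ψ => ?_, fun ψ φ => ?_⟩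
  · ext1 ψ
    refine Lp.ext ?_
    filter_upwards [coeFn_phaseGroup hf 0 ψ] with x hx
    rw [hx, zero_mul, phaseFactor_zero, one_mul]; rfl
  · ext1 ψ
    refine Lp.ext ?_
    change phaseGroup μ f hf (s + t) ψ =ᵐ[μ] phaseGroup μ f hf s (phaseGroup μ f hf t ψ)
    filter_upwards [coeFn_phaseGroup hf (s + t) ψ, coeFn_phaseGroup hf t ψ,
      coeFn_phaseGroup hf s (phaseGroup μ f hf t ψ)] with x h1 h2 h3
    rw [h1, h3, h2, add_mul, phaseFactor_add, mul_assoc]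
  · refine continuous_iff_continuousAt.2 fun t => ?_
    refine tendsto_Lp_of_dominated (fun s => coeFn_phaseGroup hf s ψ) (coeFn_phaseGroup hf t ψ)
      (b := fun x => (2 : ℂ) * ψ x) ((Lp.memLp ψ).const_mul _) (fun s x => ?_) fun x => ?_
    · rw [← sub_mul, norm_mul, norm_mul]
      refine mul_le_mul_of_nonneg_right ((norm_sub_le _ _).trans_eq ?_) (norm_nonneg _)
      rw [norm_phaseFactor, norm_phaseFactor]; norm_num
    · have : Continuous fun s => phaseFactor (s * f x) * ψ x :=
        (continuous_phaseFactor.comp (continuous_id.mul continuous_const)).mul continuous_const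
      exact this.tendsto t
  · refine mem_graph_mulOperator_iff.trans (Iff.trans ?_ hasDerivAt_zero_iff_tendsto.symm)
    have hslope : ∀ t : ℝ, ((t⁻¹ : ℝ) : ℂ) • (phaseGroup μ f hf t ψ - phaseGroup μ f hf 0 ψ) =ᵐ[μ]
        fun x => ((t⁻¹ : ℝ) : ℂ) * ((phaseFactor (t * f x) - 1) * ψ x) := by
      intro t
      filter_upwards [Lp.coeFn_smul ((t⁻¹ : ℝ) : ℂ) (phaseGroup μ f hf t ψ - phaseGroup μ f hf 0 ψ),
        Lp.coeFn_sub (phaseGroup μ f hf t ψ) (phaseGroup μ f hf 0 ψ), coeFn_phaseGroup hf t ψ,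
        coeFn_phaseGroup hf 0 ψ] with x h1 h2 h3 h4
      rw [h1, Pi.smul_apply, h2, Pi.sub_apply, h3, h4, zero_mul, phaseFactor_zero, smul_eq_mul,
        sub_mul]
    have hlim : ∀ x, Tendsto (fun t : ℝ => ((t⁻¹ : ℝ) : ℂ) * ((phaseFactor (t * f x) - 1) * ψ x))
        (𝓝[≠] 0) (𝓝 (-Complex.I * (f x * ψ x))) := by
      intro x
      have h := (hasDerivAt_phaseFactor_mul (f x)).mul_const (ψ x)
      rw [hasDerivAt_iff_tendsto_slope] at h
      rw [← mul_assoc]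
      refine h.congr fun t => ?_
      simp only [slope, vsub_eq_sub, sub_zero, zero_mul, phaseFactor_zero, one_mul]
      rw [← Complex.coe_smul, smul_eq_mul, sub_mul, one_mul]
    constructor
    · intro h
      have hm : MemLp (fun x => (f x : ℂ) * ψ x) 2 μ := (memLp_congr_ae h).1 (Lp.memLp φ)
      refine tendsto_Lp_of_dominated hslope (g := fun x => -Complex.I * (f x * ψ x)) ?_
        (hm.const_mul 2) (fun t x => ?_) hlim
      · filter_upwards [Lp.coeFn_smul (-Complex.I) φ, h] with x h1 h2
        rw [h1, Pi.smul_apply, h2, smul_eq_mul]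
      · have h1 : ‖((t⁻¹ : ℝ) : ℂ) * ((phaseFactor (t * f x) - 1) * ψ x)‖ ≤ ‖(f x : ℂ) * ψ x‖ := by
          rw [norm_mul, norm_mul, norm_mul, Complex.norm_real, Complex.norm_real, ← mul_assoc]
          refine mul_le_mul_of_nonneg_right ?_ (norm_nonneg _)
          rcases eq_or_ne t 0 with rfl | ht
          · simp
          · rw [norm_inv, inv_mul_le_iff₀ (norm_pos_iff.2 ht), Real.norm_eq_abs, Real.norm_eq_abs,
              ← abs_mul]
            exact norm_phaseFactor_sub_one_le _
        have h2 : ‖-Complex.I * ((f x : ℂ) * ψ x)‖ = ‖(f x : ℂ) * ψ x‖ := by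
          rw [norm_mul, norm_neg, Complex.norm_I, one_mul]
        refine (norm_sub_le _ _).trans ?_
        rw [h2, norm_mul 2, Complex.norm_ofNat]
        linarith
    · intro h
      -- Convergence in `L²` along `1 / (n + 1)` yields a subsequence converging almost everywhere.
      -- Its pointwise limit is `-i f ψ`, which must be `-i φ`; so `f ψ` is in `L²` because `φ` is.
      have h1 : Tendsto (fun n : ℕ => (1 / ((n : ℝ) + 1))) atTop (𝓝[≠] 0) :=
        tendsto_nhdsWithin_iff.2 ⟨tendsto_one_div_add_atTop_nhds_zero_nat,
          Eventually.of_forall fun n => (by positivity : (0 : ℝ) < 1 / ((n : ℝ) + 1)).ne'⟩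
      obtain ⟨ns, hns, hae⟩ := (tendstoInMeasure_of_tendsto_Lp (h.comp h1)).exists_seq_tendsto_ae
      have hall : ∀ᵐ x ∂μ, ∀ n : ℕ, ((((1 / ((n : ℝ) + 1))⁻¹ : ℝ) : ℂ) •
          (phaseGroup μ f hf (1 / ((n : ℝ) + 1)) ψ - phaseGroup μ f hf 0 ψ) : Lp ℂ 2 μ) x =
          (((1 / ((n : ℝ) + 1))⁻¹ : ℝ) : ℂ) * ((phaseFactor (1 / ((n : ℝ) + 1) * f x) - 1) * ψ x) :=
        ae_all_iff.2 fun n => hslope _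
      filter_upwards [hae, hall, Lp.coeFn_smul (-Complex.I) φ] with x hx1 hx2 hx3
      have h2 := (hlim x).comp (h1.comp hns.tendsto_atTop)
      have h3 := tendsto_nhds_unique (hx1.congr fun i => hx2 (ns i)) h2
      rw [hx3, Pi.smul_apply, smul_eq_mul] at h3
      exact mul_left_cancel₀ (neg_ne_zero.2 Complex.I_ne_zero) h3

/-- From `|e^{-isf} - 1| ≤ |s f|`. With the converse bound below, the size of `f ψ` is read off from
the increments of the bounded group `e^{-isf}`, without knowing in advance that `ψ` is in the
domain. -/
theorem enorm_phaseGroup_sub_le {f : X → ℝ} (hf : Measurable f) (s : ℝ) (ψ : Lp ℂ 2 μ) :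
    ‖phaseGroup μ f hf s ψ - ψ‖ₑ ≤ ‖s‖ₑ * opNorm (mulOperator μ f) ψ := by
  rw [opNorm_mulOperator hf, Lp.enorm_def, ← eLpNorm_const_smul s]
  refine eLpNorm_mono_ae ?_
  filter_upwards [Lp.coeFn_sub (phaseGroup μ f hf s ψ) ψ, coeFn_phaseGroup hf s ψ] with x h1 h2
  rw [h1, Pi.sub_apply, h2, ← sub_one_mul, norm_mul, Pi.smul_apply, norm_smul, norm_mul,
    ← mul_assoc]
  refine mul_le_mul_of_nonneg_right ?_ (norm_nonneg _)
  rw [Complex.norm_real, ← norm_mul]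
  exact norm_phaseFactor_sub_one_le _

/-- Fatou's lemma for the difference quotients `i s⁻¹ (e^{-isf} - 1) ψ`, which converge pointwise to
`f ψ`. Membership in the domain is a consequence when `K < ∞`. -/
theorem opNorm_mulOperator_le_of_forall {f : X → ℝ} (hf : Measurable f) (ψ : Lp ℂ 2 μ) {K : ℝ≥0∞}
    (h : ∀ s : ℝ, 0 < s → s ≤ 1 → ‖phaseGroup μ f hf s ψ - ψ‖ₑ ≤ ‖s‖ₑ * K) :
    opNorm (mulOperator μ f) ψ ≤ K := by
  rw [opNorm_mulOperator hf]
  let s : ℕ → ℝ := fun n => 1 / ((n : ℝ) + 1)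
  have hs : ∀ n, 0 < s n := fun n => by positivity
  have hs1 : ∀ n, s n ≤ 1 := fun n => by
    simp only [s]; rw [div_le_one (by positivity)]; linarith [n.cast_nonneg (α := ℝ)]
  have h1 : Tendsto s atTop (𝓝[≠] 0) :=
    tendsto_nhdsWithin_iff.2 ⟨tendsto_one_div_add_atTop_nhds_zero_nat,
      Eventually.of_forall fun n => (hs n).ne'⟩
  have hsm : ∀ n, AEStronglyMeasurable
      (fun x => Complex.I * (((s n)⁻¹ : ℝ) * ((phaseFactor (s n * f x) - 1) * ψ x))) μ := fun n =>
    ((((continuous_phaseFactor.measurable.comp (hf.const_mul _)).sub_const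
      1).aestronglyMeasurable.mul (Lp.aestronglyMeasurable ψ)).const_mul _).const_mul _
  refine (Lp.eLpNorm_lim_le_liminf_eLpNorm hsm _ (Eventually.of_forall fun x => ?_)).trans ?_
  · have h := (hasDerivAt_phaseFactor_mul (f x)).mul_const (ψ x)
    rw [hasDerivAt_iff_tendsto_slope] at h
    have h2 := (h.comp h1).const_mul Complex.I
    have e : Complex.I * (-Complex.I * f x * ψ x) = f x * ψ x := by
      rw [← mul_assoc, ← mul_assoc, mul_neg, Complex.I_mul_I, neg_neg, one_mul]
    rw [e] at h2
    refine h2.congr fun n => ?_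
    simp only [Function.comp_apply, slope, vsub_eq_sub, sub_zero, zero_mul, phaseFactor_zero,
      one_mul]
    rw [← Complex.coe_smul, smul_eq_mul, sub_mul, one_mul]
  · refine liminf_le_of_le (by isBoundedDefault) fun b hb => ?_
    obtain ⟨n, hn⟩ := hb.exists
    refine hn.trans ?_
    have e : eLpNorm (fun x => Complex.I * (((s n)⁻¹ : ℝ) * ((phaseFactor (s n * f x) - 1) * ψ x)))
        2 μ = ‖(s n)⁻¹‖ₑ * ‖phaseGroup μ f hf (s n) ψ - ψ‖ₑ := by
      rw [Lp.enorm_def, ← eLpNorm_const_smul]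
      refine eLpNorm_congr_norm_ae ?_
      filter_upwards [Lp.coeFn_sub (phaseGroup μ f hf (s n) ψ) ψ, coeFn_phaseGroup hf (s n) ψ]
        with x h1 h2
      rw [Pi.smul_apply, h1, Pi.sub_apply, h2, norm_mul, Complex.norm_I, one_mul, norm_mul,
        norm_smul, sub_one_mul, Complex.norm_real]
    rw [e]
    calc ‖(s n)⁻¹‖ₑ * ‖phaseGroup μ f hf (s n) ψ - ψ‖ₑ ≤ ‖(s n)⁻¹‖ₑ * (‖s n‖ₑ * K) := by
          gcongr; exact h _ (hs n) (hs1 n)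
      _ = K := by
          rw [← mul_assoc, ← enorm_mul, inv_mul_cancel₀ (hs n).ne', enorm_one, one_mul]

end MultiplicationGroups

/-! ### Bounded potentials -/

section Potential

variable {X : Type*} [MeasurableSpace X] {μ : Measure X}

theorem coeFn_potential (V : Lp ℝ ∞ μ) (ψ : Lp ℂ 2 μ) :
    potential V ψ =ᵐ[μ] fun x => (V x : ℂ) * ψ x := by
  filter_upwards [Lp.coeFn_lpSMul (r := 2) V ψ] with x hx
  change (V • ψ : Lp ℂ 2 μ) x = _
  rw [hx, Pi.smul_apply', Complex.real_smul]

/-- Multiplication by a bounded potential as a bounded operator. -/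
noncomputable def potentialCLM (V : Lp ℝ ∞ μ) : Lp ℂ 2 μ →L[ℂ] Lp ℂ 2 μ :=
  (potential V).mkContinuous ‖V‖ fun ψ => Lp.norm_smul_le V ψ

theorem potentialCLM_apply (V : Lp ℝ ∞ μ) (ψ : Lp ℂ 2 μ) : potentialCLM V ψ = potential V ψ := rfl

theorem inner_potentialCLM (V : Lp ℝ ∞ μ) (ψ φ : Lp ℂ 2 μ) :
    inner ℂ (potentialCLM V ψ) φ = inner ℂ ψ (potentialCLM V φ) := by
  rw [L2.inner_def, L2.inner_def]
  refine integral_congr_ae ?_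
  filter_upwards [coeFn_potential V ψ, coeFn_potential V φ] with x h1 h2
  rw [potentialCLM_apply, potentialCLM_apply, h1, h2]
  simp only [RCLike.inner_apply, map_mul, Complex.conj_ofReal]
  ring

/-- Potentials drop out of the commutator with the phase group, so the speed of the position is
governed by the free Hamiltonian alone. -/
theorem potential_phase {f : X → ℝ} (hf : Measurable f) (V : Lp ℝ ∞ μ) (ψ : Lp ℂ 2 μ) :
    potential V (phase μ f hf ψ) = phase μ f hf (potential V ψ) := by
  refine Lp.ext ?_
  filter_upwards [coeFn_potential V (phase μ f hf ψ), coeFn_potential V ψ, coeFn_phase hf ψ,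
    coeFn_phase hf (potential V ψ)] with x h1 h2 h3 h4
  rw [h1, h3, h4, h2]
  ring

theorem potential_mem_graph_mulOperator {f : X → ℝ} (V : Lp ℝ ∞ μ) {ψ φ : Lp ℂ 2 μ}
    (h : (ψ, φ) ∈ (mulOperator μ f).graph) :
    (potential V ψ, potential V φ) ∈ (mulOperator μ f).graph := by
  rw [mem_graph_mulOperator_iff] at h ⊢
  filter_upwards [h, coeFn_potential V ψ, coeFn_potential V φ] with x h1 h2 h3
  rw [h3, h1, h2]
  ring

end Potential

/-! ### Position operators -/

section Position

variable {X : Type*} [MeasurableSpace X] {μ : Measure X} {d : ℕ}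
  {q : X → EuclideanSpace ℝ (Fin d)}

theorem measurable_coord (hq : Measurable q) (j : Fin d) : Measurable fun x => q x j :=
  (EuclideanSpace.proj (𝕜 := ℝ) j).continuous.measurable.comp hq

theorem opNorm_absPosition_le (hq : Measurable q) (ψ : Lp ℂ 2 μ) :
    opNorm (absPosition μ q) ψ ≤ ∑ j, opNorm (position μ q j) ψ := by
  rw [absPosition, opNorm_mulOperator hq.norm]
  simp_rw [position, opNorm_mulOperator (measurable_coord hq _)]
  calc eLpNorm (fun x => ((‖q x‖ : ℝ) : ℂ) * ψ x) 2 μ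
      ≤ eLpNorm (∑ j, fun x => ‖((q x j : ℝ) : ℂ) * ψ x‖) 2 μ := by
        refine eLpNorm_mono_real fun x => ?_
        rw [Finset.sum_apply]
        simp_rw [norm_mul, ← Finset.sum_mul]
        refine mul_le_mul_of_nonneg_right ?_ (norm_nonneg _)
        simp only [Complex.norm_real, norm_norm]
        calc ‖q x‖ = ‖∑ j, EuclideanSpace.single j (q x j)‖ := by
              congr 1
              ext i
              simp [Finset.sum_apply, Pi.single_apply]
          _ ≤ ∑ j, ‖q x j‖ := (norm_sum_le _ _).trans_eq (by simp)
    _ ≤ ∑ j, eLpNorm (fun x => ‖((q x j : ℝ) : ℂ) * ψ x‖) 2 μ :=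
        eLpNorm_sum_le (fun j _ => (aestronglyMeasurable_mul (measurable_coord hq j) ψ).norm)
          (by norm_num)
    _ = _ := by simp_rw [eLpNorm_norm]

theorem opNorm_heisenberg {E : Type*} [NormedAddCommGroup E] [InnerProductSpace ℂ E]
    (U : ℝ → E ≃ₗᵢ[ℂ] E) (A : E →ₗ.[ℂ] E) (t : ℝ) (ψ : E) :
    opNorm (heisenberg U A t) ψ = opNorm A (U t ψ) := by
  unfold opNorm
  by_cases h : U t ψ ∈ A.domain
  · rw [dif_pos h, dif_pos (show ψ ∈ (heisenberg U A t).domain from h)]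
    exact (U (-t)).enorm_map _
  · rw [dif_neg h, dif_neg (show ψ ∉ (heisenberg U A t).domain from h)]

theorem enorm_le_s1Norm (Ξ : Fin d → Lp ℂ 2 μ →ₗ.[ℂ] Lp ℂ 2 μ) (ψ : Lp ℂ 2 μ) :
    ‖ψ‖ₑ ≤ s1Norm q Ξ ψ := by
  rw [s1Norm, one_div, ENNReal.le_rpow_inv_iff (by norm_num)]
  rw [ENNReal.rpow_two, add_assoc]
  exact le_self_add

theorem opNorm_position_le_s1Norm (Ξ : Fin d → Lp ℂ 2 μ →ₗ.[ℂ] Lp ℂ 2 μ) (ψ : Lp ℂ 2 μ)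
    (j : Fin d) : opNorm (position μ q j) ψ ≤ s1Norm q Ξ ψ := by
  rw [s1Norm, one_div, ENNReal.le_rpow_inv_iff (by norm_num)]
  rw [ENNReal.rpow_two]
  exact (Finset.single_le_sum (f := fun j => opNorm (position μ q j) ψ ^ 2)
    (fun _ _ => zero_le) (Finset.mem_univ j)).trans le_add_self

theorem sum_opNorm_momentum_le_s1Norm (Ξ : Fin d → Lp ℂ 2 μ →ₗ.[ℂ] Lp ℂ 2 μ) (ψ : Lp ℂ 2 μ) :
    ∑ j, (opNorm (Ξ j) ψ / 2) ^ 2 ≤ s1Norm q Ξ ψ ^ 2 := by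
  rw [s1Norm, ← ENNReal.rpow_two, ← ENNReal.rpow_mul]
  norm_num
  exact le_add_self.trans le_self_add

end Position

/-! ### Ballistic upper bounds -/

section Model

variable {X : Type*} [MeasurableSpace X] {μ : Measure X} {d : ℕ}

/-- The properties of the free Hamiltonian `A` and the momentum operator `Ξ` that the scattering
theory relies on. -/
structure IsFreeModel (q : X → EuclideanSpace ℝ (Fin d)) (hq : Measurable q)
    (A : Lp ℂ 2 μ →ₗ.[ℂ] Lp ℂ 2 μ) (Ξ : Fin d → Lp ℂ 2 μ →ₗ.[ℂ] Lp ℂ 2 μ) : Prop where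
  exists_group : ∃ U, IsUnitaryGroupOf A U
  -- Here `b` is the commutator term: conjugating `A` by `e^{-isQ_j}` adds to it an operator of size
  -- `s` relative to the square root of the energy. Only small `s` matter, since `s` tends to `0` in
  -- the end.
  exists_conj : ∃ C₁ C₂ : ℝ, 0 ≤ C₁ ∧ 0 ≤ C₂ ∧ ∀ (j : Fin d) (s : ℝ), 0 < s → s ≤ 1 →
    ∀ u w : Lp ℂ 2 μ, (u, w) ∈ A.graph → ∃ b : Lp ℂ 2 μ,
      (phaseGroup μ (fun x => q x j) (measurable_coord hq j) s u,
        phaseGroup μ (fun x => q x j) (measurable_coord hq j) s (w + b)) ∈ A.graph ∧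
      ‖b‖ ^ 2 ≤ s ^ 2 * (C₁ * ‖u‖ ^ 2 + C₂ * RCLike.re (inner ℂ u w))
  -- A state in `S₁` need not be in the domain of `A`. It is approximated in norm by states that
  -- are, with energy bounded by the `S₁` norm.
  exists_approx : ∃ C : ℝ, 0 ≤ C ∧ ∀ u : Lp ℂ 2 μ, s1Norm q Ξ u < ∞ → ∀ ε > 0,
    ∃ v w : Lp ℂ 2 μ, (v, w) ∈ A.graph ∧ ‖v - u‖ < ε ∧
      RCLike.re (inner ℂ v w) ≤ C * (s1Norm q Ξ u).toReal ^ 2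
  -- For the free evolution, the position in the Heisenberg picture is affine in time as soon as it
  -- is defined at almost all times of an interval.
  heisenberg : ∀ U, IsUnitaryGroupOf A U → ∀ (j : Fin d) (ψ : Lp ℂ 2 μ) (T : ℝ), 0 < T →
    (∀ᵐ t ∂volume.restrict (Ioc 0 T), U t ψ ∈ (position μ q j).domain) →
    ∃ χ η : Lp ℂ 2 μ, ∀ t : ℝ, (U t ψ, U t (χ + (t : ℂ) • η)) ∈ (position μ q j).graph

variable {q : X → EuclideanSpace ℝ (Fin d)} {hq : Measurable q} {A : Lp ℂ 2 μ →ₗ.[ℂ] Lp ℂ 2 μ}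
  {Ξ : Fin d → Lp ℂ 2 μ →ₗ.[ℂ] Lp ℂ 2 μ} {B : Lp ℂ 2 μ →L[ℂ] Lp ℂ 2 μ}
  {U : ℝ → Lp ℂ 2 μ ≃ₗᵢ[ℂ] Lp ℂ 2 μ}

section Commutator

variable {E : Type*} [NormedAddCommGroup E] [InnerProductSpace ℂ E] {A : E →ₗ.[ℂ] E}
  {B : E →L[ℂ] E} {U : ℝ → E ≃ₗᵢ[ℂ] E}

/-- If the commutator of the unperturbed operator with a unitary operator `M` is bounded in terms
of the energy, then `M` evolves at a bounded speed. -/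
theorem norm_conj_evolution_sub_le (M : E ≃ₗᵢ[ℂ] E)
    (hU : IsUnitaryGroupOf ((B : E →ₗ[ℂ] E) +ᵥ A) U) (hM : ∀ u, B (M u) = M (B u))
    {C₁ C₂ s : ℝ} (hC₂ : 0 ≤ C₂) (hs : 0 ≤ s)
    (hconj : ∀ u w : E, (u, w) ∈ A.graph → ∃ b : E, (M u, M (w + b)) ∈ A.graph ∧
      ‖b‖ ^ 2 ≤ s ^ 2 * (C₁ * ‖u‖ ^ 2 + C₂ * RCLike.re (inner ℂ u w)))
    {v w : E} (hv : (v, w) ∈ A.graph) (t : ℝ) :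
    ‖U (-t) (M (U t v)) - M v‖ ≤ s *
      √(C₁ * ‖v‖ ^ 2 + C₂ * (RCLike.re (inner ℂ v w) + 2 * ‖B‖ * ‖v‖ ^ 2)) * |t| := by
  have hvH : (v, w + B v) ∈ ((B : E →ₗ[ℂ] E) +ᵥ A).graph := mem_graph_vadd_iff.2 (by simpa using hv)
  have hB : ∀ u : E, |RCLike.re (inner ℂ u (B u))| ≤ ‖B‖ * ‖u‖ ^ 2 := fun u => by
    refine (RCLike.abs_re_le_norm _).trans ((norm_inner_le_norm _ _).trans ?_)
    have := mul_le_mul_of_nonneg_left (B.le_opNorm u) (norm_nonneg u)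
    nlinarith
  have hd : ∀ r, ∃ b : E, HasDerivAt (fun r => U (-r) (M (U r v))) (U (-r) (Complex.I • M b)) r ∧
      ‖b‖ ≤ s * √(C₁ * ‖v‖ ^ 2 + C₂ * (RCLike.re (inner ℂ v w) + 2 * ‖B‖ * ‖v‖ ^ 2)) := by
    intro r
    obtain ⟨h1, h2⟩ := hU.mem_graph_and_hasDerivAt hvH r
    obtain ⟨b, hb, hbn⟩ := hconj _ _ (mem_graph_vadd_iff.1 h1)
    refine ⟨b, ?_, ?_⟩
    · have h3 : (M (U r v), M (U r (w + B v) + b)) ∈ ((B : E →ₗ[ℂ] E) +ᵥ A).graph := by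
        refine mem_graph_vadd_iff.2 ?_
        convert hb using 2
        change M (U r (w + B v) + b) - B (M (U r v)) = M (U r (w + B v) - B (U r v) + b)
        rw [hM]
        simp only [map_add, map_sub]
        abel
      have h4 : HasDerivAt (fun r => M (U r v)) (M (-Complex.I • U r (w + B v))) r :=
        (M.toContinuousLinearEquiv.toContinuousLinearMap.restrictScalars
          ℝ).hasFDerivAt.comp_hasDerivAt r h2
      refine (hU.hasDerivAt_neg_apply h4 h3).congr_deriv ?_
      congr 1
      rw [map_smul, map_add, smul_add]
      simp only [neg_smul]
      abel
    · rw [← Real.sqrt_sq hs, ← Real.sqrt_mul (sq_nonneg s)]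
      refine Real.le_sqrt_of_sq_le (hbn.trans ?_)
      rw [LinearIsometryEquiv.norm_map]
      gcongr
      -- The total energy, with `B` included, is conserved. The unperturbed energy therefore changes
      -- by at most `2 ‖B‖ ‖v‖²`.
      have e1 : RCLike.re (inner ℂ (U r v) (U r (w + B v) - B (U r v))) =
          RCLike.re (inner ℂ v w) + RCLike.re (inner ℂ v (B v)) -
            RCLike.re (inner ℂ (U r v) (B (U r v))) := by
        rw [inner_sub_right, LinearIsometryEquiv.inner_map_map, inner_add_right, map_sub, map_add]
      have h5 := abs_le.1 (hB v)
      have h6 := abs_le.1 (hB (U r v))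
      rw [LinearIsometryEquiv.norm_map] at h6
      change RCLike.re (inner ℂ (U r v) (U r (w + B v) - B (U r v))) ≤ _
      rw [e1]
      linarith [h5.2, h6.1]
  have h := Convex.norm_image_sub_le_of_norm_hasDerivWithin_le (𝕜 := ℝ)
    (f := fun r => U (-r) (M (U r v))) (s := univ) (x := 0) (y := t)
    (fun r _ => (hd r).choose_spec.1.hasDerivWithinAt)
    (fun r _ => by
      rw [LinearIsometryEquiv.norm_map, norm_smul, Complex.norm_I, one_mul,
        LinearIsometryEquiv.norm_map]
      exact (hd r).choose_spec.2) convex_univ (mem_univ _) (mem_univ _)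
  simpa [hU.zero_apply] using h

end Commutator

/-- Under `A + B`, the position grows at most ballistically. -/
theorem IsFreeModel.exists_opNorm_position_le (hA : IsFreeModel q hq A Ξ)
    (hU : IsUnitaryGroupOf ((B : Lp ℂ 2 μ →ₗ[ℂ] Lp ℂ 2 μ) +ᵥ A) U)
    (hB : ∀ (f : X → ℝ) (hf : Measurable f) u, B (phase μ f hf u) = phase μ f hf (B u)) :
    ∃ K : ℝ, 0 ≤ K ∧ ∀ (j : Fin d) (t : ℝ) (u : Lp ℂ 2 μ),
      opNorm (position μ q j) (U t u) ≤ ENNReal.ofReal (K * (1 + |t|)) * s1Norm q Ξ u := by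
  obtain ⟨C₁, C₂, hC₁, hC₂, hconj⟩ := hA.exists_conj
  obtain ⟨C₃, hC₃, happ⟩ := hA.exists_approx
  set K := √(C₁ + C₂ * (C₃ + 2 * ‖B‖)) with hK
  have hK0 : 0 ≤ K := Real.sqrt_nonneg _
  -- The initial position contributes `1` and the motion `K |t|`; then `1 + K |t| ≤ (1 + K) (1 +
  -- |t|)`. The constant is positive, which makes the bound trivial when the `S₁` norm is infinite.
  refine ⟨1 + K, by positivity, fun j t u => ?_⟩
  rcases eq_or_ne (s1Norm q Ξ u) ∞ with htop | htop
  · rw [htop, ENNReal.mul_top]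
    · exact le_top
    · exact (ENNReal.ofReal_pos.2 (by positivity)).ne'
  set N := (s1Norm q Ξ u).toReal with hN
  have huN : ‖u‖ ≤ N := by
    have := ENNReal.toReal_mono htop (enorm_le_s1Norm (q := q) Ξ u)
    rwa [toReal_enorm] at this
  have hN0 : 0 ≤ N := ENNReal.toReal_nonneg
  set M := phaseGroup μ (fun x => q x j) (measurable_coord hq j) with hM
  have key : ∀ s : ℝ, 0 < s → s ≤ 1 → ‖U (-t) (M s (U t u)) - M s u‖ ≤ s * (K * N) * |t| := by
    intro s hs hs1
    -- For fixed `s` all operators in the estimate are bounded, so it passes from the approximations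
    -- in the domain to `u`; only the bound on their energy is kept.
    choose v w hvw hvu hre using fun n : ℕ =>
      happ u (lt_top_iff_ne_top.2 htop) (1 / ((n : ℝ) + 1)) (by positivity)
    have hlim : Tendsto v atTop (𝓝 u) := by
      rw [tendsto_iff_norm_sub_tendsto_zero]
      exact squeeze_zero (fun _ => norm_nonneg _) (fun n => (hvu n).le)
        tendsto_one_div_add_atTop_nhds_zero_nat
    have hle : ∀ n, ‖U (-t) (M s (U t (v n))) - M s (v n)‖ ≤
        s * √(C₁ * ‖v n‖ ^ 2 + C₂ * (C₃ * N ^ 2 + 2 * ‖B‖ * ‖v n‖ ^ 2)) * |t| := by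
      intro n
      refine (norm_conj_evolution_sub_le (M s) hU (fun x => hB _ _ x) hC₂ hs.le
        (fun x y hxy => hconj j s hs hs1 x y hxy) (hvw n) t).trans ?_
      gcongr
      exact hre n
    have hcont : Continuous fun x : Lp ℂ 2 μ => U (-t) (M s (U t x)) - M s x :=
      ((U (-t)).continuous.comp ((M s).continuous.comp (U t).continuous)).sub (M s).continuous
    have h1 := le_of_tendsto_of_tendsto ((hcont.tendsto u).comp hlim).norm
      (((((((hlim.norm.pow 2).const_mul C₁).add ((((hlim.norm.pow 2).const_mul
        (2 * ‖B‖)).const_add (C₃ * N ^ 2)).const_mul C₂)).sqrt).const_mul s).mul_const |t|))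
      (Eventually.of_forall hle)
    refine h1.trans ?_
    gcongr
    rw [hK, ← Real.sqrt_sq hN0, ← Real.sqrt_mul (by positivity), Real.sqrt_sq hN0]
    refine Real.sqrt_le_sqrt ?_
    have : ‖u‖ ^ 2 ≤ N ^ 2 := by gcongr
    nlinarith [mul_le_mul_of_nonneg_left this hC₁, mul_le_mul_of_nonneg_left this
      (mul_nonneg hC₂ (norm_nonneg B))]
  refine opNorm_mulOperator_le_of_forall (measurable_coord hq j) _ fun s hs hs1 => ?_
  have hsplit : ‖M s (U t u) - U t u‖ₑ ≤
      ‖U (-t) (M s (U t u)) - M s u‖ₑ + ‖M s u - u‖ₑ := by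
    have e : M s (U t u) - U t u = U t ((U (-t) (M s (U t u)) - M s u) + (M s u - u)) := by
      rw [sub_add_sub_cancel, map_sub, hU.apply_neg_apply]
    rw [e, LinearIsometryEquiv.enorm_map]
    exact enorm_add_le _ _
  refine hsplit.trans ?_
  have h1 : ‖U (-t) (M s (U t u)) - M s u‖ₑ ≤ ‖s‖ₑ * (ENNReal.ofReal (K * |t|) * s1Norm q Ξ u) := by
    rw [← ofReal_norm]
    refine (ENNReal.ofReal_le_ofReal (key s hs hs1)).trans_eq ?_
    rw [← ENNReal.ofReal_toReal htop, ← hN, Real.enorm_of_nonneg hs.le,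
      ← ENNReal.ofReal_mul (by positivity), ← ENNReal.ofReal_mul hs.le]
    congr 1
    ring
  have h2 : ‖M s u - u‖ₑ ≤ ‖s‖ₑ * s1Norm q Ξ u :=
    (enorm_phaseGroup_sub_le (measurable_coord hq j) s u).trans (by
      gcongr; exact opNorm_position_le_s1Norm Ξ u j)
  refine (add_le_add h1 h2).trans ?_
  rw [← mul_add, ← add_one_mul]
  gcongr
  rw [← ENNReal.ofReal_one, ← ENNReal.ofReal_add (by positivity) zero_le_one]
  refine ENNReal.ofReal_le_ofReal ?_
  nlinarith [abs_nonneg t]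

end Model

/-! ### Cook's method -/

section Cook

variable {E : Type*} [NormedAddCommGroup E] [InnerProductSpace ℂ E]
  {A : E →ₗ.[ℂ] E} {B : E →L[ℂ] E} {U W : ℝ → E ≃ₗᵢ[ℂ] E}

theorem continuous_cook_integrand (hU : IsUnitaryGroupOf A U)
    (hW : IsUnitaryGroupOf ((B : E →ₗ[ℂ] E) +ᵥ A) W) (ψ : E) :
    Continuous fun s => W (-s) (Complex.I • B (U s ψ)) :=
  continuous_isometry_apply (W := fun t => W (-t)) hW.continuous_neg continuous_id
    ((B.continuous.comp (hU.continuous ψ)).const_smul _)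

theorem enorm_cook_integrand (s : ℝ) (ψ : E) :
    ‖W (-s) (Complex.I • B (U s ψ))‖ₑ = ‖B (U s ψ)‖ₑ := by
  rw [LinearIsometryEquiv.enorm_map, enorm_smul, ← ofReal_norm Complex.I, Complex.norm_I,
    ENNReal.ofReal_one, one_mul]

/-- The wave operator exists, with an integral formula for the remainder. -/
theorem exists_tendsto_of_lintegral_lt_top [CompleteSpace E] (hU : IsUnitaryGroupOf A U)
    (hW : IsUnitaryGroupOf ((B : E →ₗ[ℂ] E) +ᵥ A) W) {ψ : E}
    (h : ∫⁻ t in Ioi (0 : ℝ), ‖B (U t ψ)‖ₑ < ∞) :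
    ∃ φ, Tendsto (fun t => W (-t) (U t ψ)) atTop (𝓝 φ) ∧ ∀ t, 0 ≤ t →
      IntegrableOn (fun s => W (-s) (Complex.I • B (U s ψ))) (Ioi t) ∧
      φ - W (-t) (U t ψ) = ∫ s in Ioi t, W (-s) (Complex.I • B (U s ψ)) := by
  have hint : IntegrableOn (fun s => W (-s) (Complex.I • B (U s ψ))) (Ioi 0) :=
    ⟨(continuous_cook_integrand hU hW ψ).aestronglyMeasurable, by
      simp_rw [HasFiniteIntegral, enorm_cook_integrand]; exact h⟩
  have hlim := (intervalIntegral_tendsto_integral_Ioi 0 hint tendsto_id).const_add ψ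
  have hlim' : Tendsto (fun t => W (-t) (U t ψ)) atTop
      (𝓝 (ψ + ∫ s in Ioi (0 : ℝ), W (-s) (Complex.I • B (U s ψ)))) :=
    hlim.congr fun t => (hU.duhamel hW ψ t).symm
  refine ⟨_, hlim', fun t ht => ?_⟩
  have hint' := hint.mono_set (Ioi_subset_Ioi ht)
  exact ⟨hint', (integral_Ioi_of_hasDerivAt_of_tendsto' (fun s _ => hU.hasDerivAt_duhamel hW ψ s)
    hint' hlim').symm⟩

/-- The interaction picture evolution of `χ + t η` is asymptotically linear in `t`, if
`t ↦ B e^{-itA} (χ + t η)` is integrable. -/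
theorem exists_norm_sub_smul_le [CompleteSpace E] (hU : IsUnitaryGroupOf A U)
    (hW : IsUnitaryGroupOf ((B : E →ₗ[ℂ] E) +ᵥ A) W) {χ η : E}
    (h : ∫⁻ t in Ioi (0 : ℝ), ‖B (U t (χ + (t : ℂ) • η))‖ₑ < ∞) :
    ∃ (L : E) (K : ℝ), ‖L‖ = ‖η‖ ∧ ∀ t, 0 < t →
      ‖W (-t) (U t (χ + (t : ℂ) • η)) - (t : ℂ) • L‖ ≤ K := by
  set g : ℝ → E := fun t => χ + (t : ℂ) • η with hg
  have hgc : Continuous g := continuous_const.add (Complex.continuous_ofReal.smul continuous_const)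
  have hfc : Continuous fun t => B (U t (g t)) :=
    B.continuous.comp (continuous_isometry_apply hU.continuous continuous_id hgc)
  have hf : IntegrableOn (fun t => B (U t (g t))) (Ioi 0) :=
    ⟨hfc.aestronglyMeasurable, h⟩
  set J := ∫ t in Ioi (0 : ℝ), ‖B (U t (g t))‖ with hJ
  -- Dividing by `t` makes the derivative integrable: it is `t⁻¹` times the integrable function `W
  -- (-t) (i B (U t (g t)))`, minus `t⁻²` times a vector of norm `‖χ‖`.
  set y : ℝ → E := fun t => t⁻¹ • W (-t) (U t χ) + W (-t) (U t η) with hy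
  set y' : ℝ → E := fun t => t⁻¹ • W (-t) (Complex.I • B (U t (g t))) +
    (-(t ^ 2)⁻¹) • W (-t) (U t χ) with hy'
  have hyg : ∀ t, 0 < t → t • y t = W (-t) (U t (g t)) := by
    intro t ht
    simp only [hy, hg, map_add, map_smul, smul_add]
    rw [smul_smul, mul_inv_cancel₀ ht.ne', one_smul, Complex.coe_smul]
  have hd : ∀ t, 0 < t → HasDerivAt y (y' t) t := by
    intro t ht
    have h1 := ((hasDerivAt_inv ht.ne').smul (hU.hasDerivAt_duhamel hW χ t)).add
      (hU.hasDerivAt_duhamel hW η t)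
    refine h1.congr_deriv ?_
    simp only [hy', hg, map_add, map_smul, smul_add]
    have e : ∀ z : E, t⁻¹ • Complex.I • (t : ℂ) • z = Complex.I • z := fun z => by
      rw [Complex.coe_smul, smul_comm Complex.I t z, smul_smul, inv_mul_cancel₀ ht.ne', one_smul]
    rw [e]
    abel
  have hWc : ∀ {x : ℝ → E}, Continuous x → Continuous fun t => W (-t) (x t) := fun hx =>
    continuous_isometry_apply (W := fun t => W (-t)) hW.continuous_neg continuous_id hx
  have hbound : ∀ a, 0 < a → ∀ t ∈ Ioi a, ‖y' t‖ ≤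
      a⁻¹ * ‖B (U t (g t))‖ + ‖χ‖ * t ^ (-2 : ℝ) := by
    intro a ha t ht
    have ht0 : 0 < t := ha.trans ht
    refine (norm_add_le _ _).trans (add_le_add ?_ (le_of_eq ?_))
    · rw [norm_smul, LinearIsometryEquiv.norm_map, norm_smul, Complex.norm_I, one_mul, norm_inv,
        Real.norm_of_nonneg ht0.le]
      gcongr
      exact le_of_lt ht
    · rw [norm_smul, LinearIsometryEquiv.norm_map, LinearIsometryEquiv.norm_map, norm_neg,
        norm_inv, Real.norm_of_nonneg (by positivity), mul_comm, Real.rpow_neg ht0.le,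
        Real.rpow_two]
  have hbi : ∀ a, 0 < a → IntegrableOn (fun t : ℝ => a⁻¹ * ‖B (U t (g t))‖ +
      ‖χ‖ * t ^ (-2 : ℝ)) (Ioi a) := fun a ha =>
    ((hf.mono_set (Ioi_subset_Ioi ha.le)).norm.const_mul _).add
      ((integrableOn_Ioi_rpow_of_lt (by norm_num) ha).const_mul _)
  have hy'c : ContinuousOn y' (Ioi 0) := by
    have h1 : ContinuousOn (fun t : ℝ => t⁻¹) (Ioi 0) :=
      continuousOn_inv₀.mono fun t ht => ne_of_gt ht
    have h2 : ContinuousOn (fun t : ℝ => -(t ^ 2)⁻¹) (Ioi 0) := by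
      refine ContinuousOn.neg (ContinuousOn.inv₀ (by fun_prop) fun t (ht : 0 < t) => ?_)
      positivity
    exact (h1.smul (hWc (hfc.const_smul Complex.I)).continuousOn).add
      (h2.smul (hWc (hU.continuous χ)).continuousOn)
  have hint : ∀ a, 0 < a → IntegrableOn y' (Ioi a) := fun a ha =>
    (hbi a ha).mono' ((hy'c.mono (Ioi_subset_Ioi ha.le)).aestronglyMeasurable measurableSet_Ioi)
      ((ae_restrict_mem measurableSet_Ioi).mono (hbound a ha))
  have hlim := tendsto_limUnder_of_hasDerivAt_of_integrableOn_Ioi (a := 1)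
    (fun t ht => hd t (one_pos.trans ht)) (hint 1 one_pos)
  set L := limUnder atTop y
  refine ⟨L, J + ‖χ‖, ?_, fun a ha => ?_⟩
  -- All maps are isometries, so `‖y t‖ = ‖t⁻¹ χ + η‖`, which tends to `‖η‖`.
  · have h1 : Tendsto (fun t : ℝ => ‖t⁻¹ • χ + η‖) atTop (𝓝 ‖η‖) := by
      have := ((tendsto_inv_atTop_zero (𝕜 := ℝ)).smul_const χ).add_const η
      simpa using this.norm
    refine tendsto_nhds_unique hlim.norm (h1.congr fun t => ?_)
    have e : y t = W (-t) (U t (t⁻¹ • χ + η)) := by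
      simp only [hy, map_add]
      rw [← Complex.coe_smul, ← Complex.coe_smul, map_smul, map_smul]
    rw [e, LinearIsometryEquiv.norm_map, LinearIsometryEquiv.norm_map]
  · have h1 : ∫ t in Ioi a, y' t = L - y a :=
      integral_Ioi_of_hasDerivAt_of_tendsto' (fun t ht => hd t (ha.trans_le ht)) (hint a ha) hlim
    -- The tail of the derivative beyond `a` is of order `a⁻¹`, so multiplication by `a` leaves a
    -- bounded error.
    have h2 : ‖L - y a‖ ≤ a⁻¹ * (J + ‖χ‖) := by
      rw [← h1]
      refine (norm_integral_le_of_norm_le (hbi a ha) ((ae_restrict_mem measurableSet_Ioi).mono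
        (hbound a ha))).trans ?_
      rw [integral_add ((hf.mono_set (Ioi_subset_Ioi ha.le)).norm.const_mul _)
        ((integrableOn_Ioi_rpow_of_lt (by norm_num) ha).const_mul _), integral_const_mul,
        integral_const_mul, integral_Ioi_rpow_of_lt (by norm_num) ha, mul_add]
      refine add_le_add ?_ (le_of_eq ?_)
      · refine mul_le_mul_of_nonneg_left ?_ (inv_nonneg.2 ha.le)
        exact setIntegral_mono_set hf.norm (Eventually.of_forall fun _ => norm_nonneg _)
          (Ioi_subset_Ioi ha.le).eventuallyLE
      · have : (-2 : ℝ) + 1 = -1 := by norm_num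
        rw [this, Real.rpow_neg_one, neg_div_neg_eq, div_one, mul_comm]
    rw [← hyg a ha, Complex.coe_smul, ← smul_sub, norm_smul, Real.norm_of_nonneg ha.le,
      norm_sub_rev]
    calc a * ‖L - y a‖ ≤ a * (a⁻¹ * (J + ‖χ‖)) := by gcongr
      _ = J + ‖χ‖ := by rw [← mul_assoc, mul_inv_cancel₀ ha.ne', one_mul]

end Cook

/-! ### Scattering and ballistic transport -/

section Scattering

variable {X : Type*} [MeasurableSpace X] {μ : Measure X} {d : ℕ}
  {q : X → EuclideanSpace ℝ (Fin d)}

theorem add_sq_le_ennreal (a b : ℝ≥0∞) : (a + b) ^ 2 ≤ 2 * a ^ 2 + 2 * b ^ 2 := by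
  have h := ENNReal.rpow_add_le_mul_rpow_add_rpow a b (p := 2) (by norm_num)
  norm_num at h
  rw [← mul_add]
  exact h

/-- The Cesàro mean of an asymptotically linear Heisenberg orbit. -/
theorem cesaroOpNorm_asymptotic {E : Type*} [NormedAddCommGroup E] [InnerProductSpace ℂ E]
    [CompleteSpace E] {Q A : E →ₗ.[ℂ] E} {U : ℝ → E ≃ₗᵢ[ℂ] E} (hU : IsUnitaryGroupOf A U) {φ L : E}
    {r : ℝ → E} {K : ℝ} (hr : ∀ t, 0 < t → (U t φ, U t (r t)) ∈ Q.graph)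
    (hK : ∀ t : ℝ, 0 < t → ‖r t - (t : ℂ) • L‖ ≤ K) {T : ℝ} (hT : 0 < T)
    (hmeas : AEStronglyMeasurable r (volume.restrict (Ioc 0 T))) :
    cesaroOpNorm U Q T φ ≤ ENNReal.ofReal (T / 2 * ‖L‖ + K) ∧
      ENNReal.ofReal (T / 2 * ‖L‖) ≤ cesaroOpNorm U Q T φ + ENNReal.ofReal K := by
  simp only [Complex.coe_smul] at hK
  have hdom : ∀ t, 0 < t → φ ∈ (heisenberg U Q t).domain := fun t ht =>
    show U t φ ∈ Q.domain from LinearPMap.mem_domain_of_mem_graph (hr t ht)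
  have horb : ∀ t, 0 < t → heisenbergOrbit U Q φ t = r t := by
    intro t ht
    rw [heisenbergOrbit, dif_pos (hdom t ht)]
    change U (-t) (Q ⟨U t φ, _⟩) = r t
    have h1 : Q ⟨U t φ, hdom t ht⟩ = U t (r t) :=
      ((LinearPMap.image_iff (show U t φ ∈ Q.domain from hdom t ht)).2 (hr t ht)).symm
    rw [h1, hU.neg_apply_apply]
  have hlin : IntegrableOn (fun t : ℝ => t • L) (Ioc 0 T) :=
    ((continuous_id.smul continuous_const).integrableOn_Icc).mono_set Ioc_subset_Icc_self
  have hdiff : IntegrableOn (fun t => r t - t • L) (Ioc 0 T) := by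
    refine Integrable.mono' (g := fun _ => K) (integrable_const _)
      (hmeas.sub hlin.aestronglyMeasurable) ?_
    filter_upwards [ae_restrict_mem measurableSet_Ioc] with t ht using hK t ht.1
  have hrint : IntegrableOn r (Ioc 0 T) := by
    refine (hdiff.add hlin).congr (Eventually.of_forall fun t => ?_)
    exact sub_add_cancel _ _
  have hdef : CesaroDefined U Q T φ := by
    refine ⟨?_, hrint.congr_fun (fun t ht => (horb t ht.1).symm) measurableSet_Ioc⟩
    filter_upwards [ae_restrict_mem measurableSet_Ioc] with t ht using hdom t ht.1
  have hval : cesaroOpNorm U Q T φ =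
      ENNReal.ofReal ‖T⁻¹ • ∫ t in Ioc 0 T, r t‖ := by
    rw [cesaroOpNorm, if_pos hdef, setIntegral_congr_fun measurableSet_Ioc
      (fun t ht => horb t ht.1), ofReal_norm]
  -- The mean of `t L` over `(0, T]` is `(T / 2) L`, and a bounded error in `r` gives an error of at
  -- most `K` in the mean.
  have hlinint : ∫ t in Ioc 0 T, t • L = (T ^ 2 / 2) • L := by
    rw [integral_smul_const, ← intervalIntegral.integral_of_le hT.le, integral_id]
    simp
  have hmain : ‖(T⁻¹ • ∫ t in Ioc 0 T, r t) - (T / 2) • L‖ ≤ K := by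
    have e : (T⁻¹ • ∫ t in Ioc 0 T, r t) - (T / 2) • L =
        T⁻¹ • ∫ t in Ioc 0 T, (r t - t • L) := by
      rw [integral_sub hrint hlin, hlinint, smul_sub, smul_smul]
      congr 2
      field_simp
    rw [e, norm_smul, norm_inv, Real.norm_of_nonneg hT.le]
    have h1 := norm_setIntegral_le_of_norm_le_const (μ := volume) (s := Ioc 0 T) (C := K)
      (f := fun t => r t - t • L) (by simp) (fun t ht => hK t ht.1)
    rw [Measure.real, Real.volume_Ioc, sub_zero, ENNReal.toReal_ofReal hT.le] at h1
    rw [inv_mul_le_iff₀ hT, mul_comm]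
    exact h1
  have hK0 : 0 ≤ K := (norm_nonneg _).trans hmain
  have hnorm : ‖(T / 2) • L‖ = T / 2 * ‖L‖ := by
    rw [norm_smul, Real.norm_of_nonneg (by positivity)]
  rw [hval]
  constructor
  · refine ENNReal.ofReal_le_ofReal ?_
    have := norm_le_norm_add_norm_sub' (T⁻¹ • ∫ t in Ioc 0 T, r t) ((T / 2) • L)
    rw [hnorm] at this
    linarith
  · rw [← ENNReal.ofReal_add (norm_nonneg _) hK0]
    refine ENNReal.ofReal_le_ofReal ?_
    have := norm_le_norm_add_norm_sub' ((T / 2) • L) (T⁻¹ • ∫ t in Ioc 0 T, r t)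
    rw [hnorm, norm_sub_rev] at this
    linarith

/-- The orbit is a pointwise limit of continuous functions of `t`: the unbounded operator is
replaced by the difference quotients of the unitary group `e^{-isf}`. -/
theorem aestronglyMeasurable_heisenberg {f : X → ℝ} (hf : Measurable f)
    {A : Lp ℂ 2 μ →ₗ.[ℂ] Lp ℂ 2 μ} {U : ℝ → Lp ℂ 2 μ ≃ₗᵢ[ℂ] Lp ℂ 2 μ}
    (hU : IsUnitaryGroupOf A U) {φ : Lp ℂ 2 μ} {r : ℝ → Lp ℂ 2 μ}
    (hr : ∀ t, 0 < t → (U t φ, U t (r t)) ∈ (mulOperator μ f).graph) (T : ℝ) :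
    AEStronglyMeasurable r (volume.restrict (Ioc 0 T)) := by
  have hM := isUnitaryGroupOf_phaseGroup (μ := μ) hf
  refine aestronglyMeasurable_of_tendsto_ae atTop (f := fun (n : ℕ) t => U (-t) (Complex.I •
    ((((1 / ((n : ℝ) + 1))⁻¹ : ℝ) : ℂ) • (phaseGroup μ f hf (1 / ((n : ℝ) + 1)) (U t φ) -
      phaseGroup μ f hf 0 (U t φ))))) (fun n => ?_) ?_
  · have hc : ∀ s, Continuous fun t => phaseGroup μ f hf s (U t φ) := fun s =>
      (phaseGroup μ f hf s).continuous.comp (hU.continuous φ)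
    exact Continuous.aestronglyMeasurable (continuous_isometry_apply (W := fun t => U (-t))
      hU.continuous_neg continuous_id ((((hc _).fun_sub (hc 0)).fun_const_smul _).fun_const_smul _))
  · filter_upwards [ae_restrict_mem measurableSet_Ioc] with t ht
    have h1 := hasDerivAt_zero_iff_tendsto.1 ((hM.generator _ _).1 (hr t ht.1))
    have h2 : Tendsto (fun n : ℕ => (1 / ((n : ℝ) + 1))) atTop (𝓝[≠] 0) :=
      tendsto_nhdsWithin_iff.2 ⟨tendsto_one_div_add_atTop_nhds_zero_nat,
        Eventually.of_forall fun n => (by positivity : (0 : ℝ) < 1 / ((n : ℝ) + 1)).ne'⟩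
    have h3 := ((U (-t)).continuous.tendsto _).comp ((h1.comp h2).const_smul Complex.I)
    rw [smul_smul, mul_neg, Complex.I_mul_I, neg_neg, one_smul, hU.neg_apply_apply] at h3
    exact h3

variable {hq : Measurable q} {A : Lp ℂ 2 μ →ₗ.[ℂ] Lp ℂ 2 μ}
  {Ξ : Fin d → Lp ℂ 2 μ →ₗ.[ℂ] Lp ℂ 2 μ}

/-- The remainder `e^{-itH} Ω ψ - e^{-itH₀} ψ` has bounded position. -/
theorem exists_opNorm_position_remainder_le (hA : IsFreeModel q hq A Ξ)
    {H₀ : Lp ℂ 2 μ →ₗ.[ℂ] Lp ℂ 2 μ} {U₀ U : ℝ → Lp ℂ 2 μ ≃ₗᵢ[ℂ] Lp ℂ 2 μ}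
    {B B' : Lp ℂ 2 μ →L[ℂ] Lp ℂ 2 μ}
    (hU : IsUnitaryGroupOf ((B : Lp ℂ 2 μ →ₗ[ℂ] Lp ℂ 2 μ) +ᵥ H₀) U)
    (hU' : IsUnitaryGroupOf ((B' : Lp ℂ 2 μ →ₗ[ℂ] Lp ℂ 2 μ) +ᵥ A) U)
    (hB' : ∀ (f : X → ℝ) (hf : Measurable f) u, B' (phase μ f hf u) = phase μ f hf (B' u))
    {ψ φ : Lp ℂ 2 μ}
    (hJ : ∫⁻ t in Ioi (0 : ℝ), ENNReal.ofReal (1 + t) * s1Norm q Ξ (B (U₀ t ψ)) < ∞)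
    (hφ : ∀ t, 0 ≤ t → IntegrableOn (fun s => U (-s) (Complex.I • B (U₀ s ψ))) (Ioi t) ∧
      φ - U (-t) (U₀ t ψ) = ∫ s in Ioi t, U (-s) (Complex.I • B (U₀ s ψ))) :
    ∃ κ : ℝ≥0∞, κ < ∞ ∧ ∀ j t, 0 ≤ t → opNorm (position μ q j) (U t φ - U₀ t ψ) ≤ κ := by
  obtain ⟨K, hK, hbound⟩ := hA.exists_opNorm_position_le hU' hB'
  refine ⟨ENNReal.ofReal K * ∫⁻ t in Ioi (0 : ℝ), ENNReal.ofReal (1 + t) *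
    s1Norm q Ξ (B (U₀ t ψ)), ENNReal.mul_lt_top ENNReal.ofReal_lt_top hJ, fun j t ht => ?_⟩
  refine opNorm_mulOperator_le_of_forall (measurable_coord hq j) _ fun s hs hs1 => ?_
  set M := phaseGroup μ (fun x => q x j) (measurable_coord hq j) s
  obtain ⟨hint, hrem⟩ := hφ t ht
  -- The bounded operator `(M - 1) U t` can be taken inside Cook's integral, which would need
  -- justification for `Q_j` itself.
  let Λ : Lp ℂ 2 μ →L[ℂ] Lp ℂ 2 μ :=
    (M.toContinuousLinearEquiv.toContinuousLinearMap - ContinuousLinearMap.id ℂ _) ∘L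
      (U t).toContinuousLinearEquiv.toContinuousLinearMap
  have hΛ : ∀ x, Λ x = M (U t x) - U t x := fun x => rfl
  have e : M (U t φ - U₀ t ψ) - (U t φ - U₀ t ψ) =
      ∫ r in Ioi t, Λ (U (-r) (Complex.I • B (U₀ r ψ))) := by
    rw [Λ.integral_comp_comm hint, ← hrem, hΛ, map_sub (U t), hU.apply_neg_apply]
  have hpt : ∀ r ∈ Ioi t, ‖Λ (U (-r) (Complex.I • B (U₀ r ψ)))‖ₑ ≤
      ‖s‖ₑ * ENNReal.ofReal K * (ENNReal.ofReal (1 + r) * s1Norm q Ξ (B (U₀ r ψ))) := by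
    intro r hr
    have e1 : Λ (U (-r) (Complex.I • B (U₀ r ψ))) =
        Complex.I • (M (U (t + -r) (B (U₀ r ψ))) - U (t + -r) (B (U₀ r ψ))) := by
      rw [hΛ, ← hU.add_apply, map_smul, map_smul, smul_sub]
    rw [e1, enorm_smul, ← ofReal_norm Complex.I, Complex.norm_I, ENNReal.ofReal_one, one_mul]
    refine (enorm_phaseGroup_sub_le (measurable_coord hq j) s _).trans ?_
    rw [mul_assoc]
    gcongr
    refine (hbound j _ _).trans ?_
    rw [← mul_assoc, ← ENNReal.ofReal_mul hK]
    gcongr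
    -- The evolution runs for the time `t - r` with `0 ≤ t < r`, and `|t - r| = r - t ≤ r`. This is
    -- why the weight `1 + r` in the hypothesis gives a bound independent of `t`.
    rw [abs_of_nonpos (by linarith [mem_Ioi.1 hr])]
    linarith
  rw [e]
  calc ‖∫ r in Ioi t, Λ (U (-r) (Complex.I • B (U₀ r ψ)))‖ₑ
      ≤ ∫⁻ r in Ioi t, ‖Λ (U (-r) (Complex.I • B (U₀ r ψ)))‖ₑ := enorm_integral_le_lintegral_enorm _
    _ ≤ ∫⁻ r in Ioi t, ‖s‖ₑ * ENNReal.ofReal K *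
          (ENNReal.ofReal (1 + r) * s1Norm q Ξ (B (U₀ r ψ))) :=
        setLIntegral_mono' measurableSet_Ioi hpt
    _ ≤ ∫⁻ r in Ioi (0 : ℝ), ‖s‖ₑ * ENNReal.ofReal K *
          (ENNReal.ofReal (1 + r) * s1Norm q Ξ (B (U₀ r ψ))) :=
        lintegral_mono_set (Ioi_subset_Ioi ht)
    _ = _ := by
        rw [lintegral_const_mul' _ _ (ENNReal.mul_ne_top (by simp) ENNReal.ofReal_ne_top),
          mul_assoc]

/-- Both directions are the triangle inequality for `|Q|` with an error of size at most `d κ`,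
squared by means of `(a + b)² ≤ 2 a² + 2 b²`. -/
theorem comparable_secondMoment (hq : Measurable q) {U₀ U : ℝ → Lp ℂ 2 μ ≃ₗᵢ[ℂ] Lp ℂ 2 μ}
    {ψ φ : Lp ℂ 2 μ} {κ : ℝ≥0∞} (hκ : κ < ∞)
    (h : ∀ j t, 0 ≤ t → opNorm (position μ q j) (U t φ - U₀ t ψ) ≤ κ) :
    Comparable (secondMoment q U₀ ψ) (secondMoment q U φ) := by
  set D : ℝ≥0∞ := 2 * (∑ _j : Fin d, κ) ^ 2 with hD
  have hDtop : D ≠ ∞ := ENNReal.mul_ne_top (by simp) (ENNReal.pow_ne_top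
    (ENNReal.sum_ne_top.2 fun _ _ => hκ.ne))
  have hneg : ∀ u : Lp ℂ 2 μ, opNorm (absPosition μ q) (-u) = opNorm (absPosition μ q) u := by
    intro u
    rw [absPosition, opNorm_mulOperator hq.norm, opNorm_mulOperator hq.norm]
    refine eLpNorm_congr_norm_ae ?_
    filter_upwards [Lp.coeFn_neg u] with x hx
    rw [hx, Pi.neg_apply, mul_neg, norm_neg]
  have hbd : ∀ t, 0 ≤ t → opNorm (absPosition μ q) (U t φ - U₀ t ψ) ≤ ∑ _j : Fin d, κ :=
    fun t ht => (opNorm_absPosition_le hq _).trans (Finset.sum_le_sum fun j _ => h j t ht)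
  have hstep : ∀ u v : Lp ℂ 2 μ, opNorm (absPosition μ q) v ≤ ∑ _j : Fin d, κ →
      opNorm (absPosition μ q) (u + v) ^ 2 ≤ 2 * opNorm (absPosition μ q) u ^ 2 + D := by
    intro u v hv
    calc opNorm (absPosition μ q) (u + v) ^ 2
        ≤ (opNorm (absPosition μ q) u + ∑ _j : Fin d, κ) ^ 2 := by
          gcongr
          exact (opNorm_mulOperator_add_le hq.norm u v).trans (add_le_add le_rfl hv)
      _ ≤ _ := add_sq_le_ennreal _ _
  refine ⟨D.toReal, ENNReal.toReal_nonneg, fun t ht => ?_⟩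
  rw [ENNReal.ofReal_toReal hDtop, secondMoment, secondMoment, opNorm_heisenberg,
    opNorm_heisenberg]
  constructor
  · have := hstep (U₀ t ψ) (U t φ - U₀ t ψ) (hbd t ht.le)
    rwa [add_sub_cancel] at this
  · have := hstep (U t φ) (-(U t φ - U₀ t ψ)) (by rw [hneg]; exact hbd t ht.le)
    rwa [neg_sub, add_sub_cancel] at this

/-- Componentwise, both Cesàro means have norm `(T / 2) ‖η j‖` up to a constant. Under `U₀` this is
the assumed affine form. Under `U` the orbit is, up to `κ`, the interaction picture image of that
affine orbit, which is asymptotically `t L j` with `‖L j‖ = ‖η j‖`. -/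
theorem comparable_averagedSecondMoment (hq : Measurable q)
    {H₀ : Lp ℂ 2 μ →ₗ.[ℂ] Lp ℂ 2 μ} {U₀ U : ℝ → Lp ℂ 2 μ ≃ₗᵢ[ℂ] Lp ℂ 2 μ}
    {V : Lp ℝ ∞ μ} (hU₀ : IsUnitaryGroupOf H₀ U₀)
    (hU : IsUnitaryGroupOf ((potentialCLM V : Lp ℂ 2 μ →ₗ[ℂ] Lp ℂ 2 μ) +ᵥ H₀) U)
    {ψ φ : Lp ℂ 2 μ} {κ : ℝ≥0∞} (hκ : κ < ∞)
    (h : ∀ j t, 0 ≤ t → opNorm (position μ q j) (U t φ - U₀ t ψ) ≤ κ)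
    (hJ : ∫⁻ t in Ioi (0 : ℝ), ENNReal.ofReal (1 + t) * s1Norm q Ξ (potential V (U₀ t ψ)) < ∞)
    {χ η : Fin d → Lp ℂ 2 μ}
    (hg : ∀ j t, (U₀ t ψ, U₀ t (χ j + ((t : ℝ) : ℂ) • η j)) ∈ (position μ q j).graph) :
    Comparable (averagedSecondMoment q U₀ ψ) (averagedSecondMoment q U φ) := by
  -- The vector `U₀ t (χ j + t η j)` is `Q_j U₀ t ψ`, and `V` commutes with `Q_j`; so the integrand
  -- is the norm of `Q_j V U₀ t ψ`, controlled by the `S₁` norm in `hJ`.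
  have hVg : ∀ j, ∫⁻ t in Ioi (0 : ℝ), ‖potentialCLM V (U₀ t (χ j + (t : ℂ) • η j))‖ₑ < ∞ := by
    intro j
    refine lt_of_le_of_lt (setLIntegral_mono' measurableSet_Ioi fun t ht => ?_) hJ
    rw [potentialCLM_apply, ← opNorm_eq_of_mem_graph (potential_mem_graph_mulOperator V (hg j t))]
    refine (opNorm_position_le_s1Norm Ξ _ j).trans (le_mul_of_one_le_left zero_le ?_)
    rw [← ENNReal.ofReal_one]
    exact ENNReal.ofReal_le_ofReal (by linarith [mem_Ioi.1 ht])
  choose L K hL hK using fun j => exists_norm_sub_smul_le hU₀ hU (hVg j)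
  have hdiff : ∀ j t, 0 ≤ t → U t φ - U₀ t ψ ∈ (position μ q j).domain := fun j t ht =>
    opNorm_mulOperator_lt_top_iff.1 ((h j t ht).trans_lt hκ)
  -- Here `r` is `U (-t) Q_j U t φ`. Writing `U t φ` as the sum of the remainder and `U₀ t ψ` shows
  -- that it exists and is within `κ` of the transported free orbit.
  have hex : ∀ j t, 0 ≤ t → ∃ r, (U t φ, U t r) ∈ (position μ q j).graph ∧
      ‖r - U (-t) (U₀ t (χ j + (t : ℂ) • η j))‖ ≤ κ.toReal := by
    intro j t ht
    obtain ⟨y, hy⟩ := LinearPMap.mem_domain_iff.1 (hdiff j t ht)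
    have hsum := (position μ q j).graph.add_mem hy (hg j t)
    rw [Prod.mk_add_mk, sub_add_cancel] at hsum
    refine ⟨U (-t) (y + U₀ t (χ j + (t : ℂ) • η j)), ?_, ?_⟩
    · rwa [hU.apply_neg_apply]
    · rw [← map_sub, add_sub_cancel_right, LinearIsometryEquiv.norm_map, ← toReal_enorm,
        ← opNorm_eq_of_mem_graph hy]
      exact ENNReal.toReal_mono hκ.ne (h j t ht)
  choose! r hr hrκ using hex
  have h1 : ∀ (j) (T : ℝ), 0 < T → _ := fun j T hT => cesaroOpNorm_asymptotic (Q := position μ q j) hU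
    (L := L j) (K := κ.toReal + K j) (r := r j) (fun t ht => hr j t ht.le) (fun t ht => by
      have := norm_sub_le_norm_sub_add_norm_sub (r j t) (U (-t) (U₀ t (χ j + (t : ℂ) • η j)))
        ((t : ℂ) • L j)
      exact this.trans (add_le_add (hrκ j t ht.le) (hK j t ht))) hT
    (aestronglyMeasurable_heisenberg (measurable_coord hq j) hU (fun t ht => hr j t ht.le) T)
  have h0 : ∀ (j) (T : ℝ), 0 < T → _ := fun j T hT => cesaroOpNorm_asymptotic (Q := position μ q j) hU₀
    (L := η j) (K := ‖χ j‖) (r := fun t => χ j + (t : ℂ) • η j) (fun t _ => hg j t) (fun t _ => by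
      rw [add_sub_cancel_right]) hT
    (aestronglyMeasurable_heisenberg (measurable_coord hq j) hU₀ (fun t _ => hg j t) T)
  have hK0 : ∀ j, 0 ≤ K j := fun j => (norm_nonneg _).trans (hK j 1 one_pos)
  set N : Fin d → ℝ := fun j => κ.toReal + K j + ‖χ j‖ with hN
  have hN0 : ∀ j, 0 ≤ N j := fun j => by
    have := hK0 j
    have : 0 ≤ κ.toReal := ENNReal.toReal_nonneg
    positivity
  have hle : ∀ j T, 0 < T → cesaroOpNorm U (position μ q j) T φ ≤
      cesaroOpNorm U₀ (position μ q j) T ψ + ENNReal.ofReal (N j) ∧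
      cesaroOpNorm U₀ (position μ q j) T ψ ≤
      cesaroOpNorm U (position μ q j) T φ + ENNReal.ofReal (N j) := by
    intro j T hT
    have hκ0 : 0 ≤ κ.toReal + K j := add_nonneg ENNReal.toReal_nonneg (hK0 j)
    have hTL : 0 ≤ T / 2 * ‖η j‖ := by positivity
    obtain ⟨a1, a2⟩ := h1 j T hT
    obtain ⟨b1, b2⟩ := h0 j T hT
    rw [hL, ENNReal.ofReal_add hTL hκ0] at a1
    rw [hL] at a2
    rw [ENNReal.ofReal_add hTL (norm_nonneg _)] at b1
    -- The common term `T / 2 * ‖η j‖` is eliminated between the two asymptotics, so their errors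
    -- add up to `N j`.
    have eN : ENNReal.ofReal (N j) = ENNReal.ofReal (κ.toReal + K j) + ENNReal.ofReal ‖χ j‖ :=
      ENNReal.ofReal_add hκ0 (norm_nonneg _)
    rw [eN]
    constructor
    · refine a1.trans ((add_le_add b2 le_rfl).trans_eq ?_)
      ring
    · refine b1.trans ((add_le_add a2 le_rfl).trans_eq ?_)
      ring
  set D : ℝ≥0∞ := ∑ j, 2 * ENNReal.ofReal (N j) ^ 2 with hD
  have hDtop : D ≠ ∞ := ENNReal.sum_ne_top.2 fun _ _ =>
    ENNReal.mul_ne_top (by simp) (ENNReal.pow_ne_top ENNReal.ofReal_ne_top)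
  refine ⟨D.toReal, ENNReal.toReal_nonneg, fun T hT => ?_⟩
  rw [ENNReal.ofReal_toReal hDtop, averagedSecondMoment, averagedSecondMoment, Finset.mul_sum,
    Finset.mul_sum, hD, ← Finset.sum_add_distrib, ← Finset.sum_add_distrib]
  exact ⟨Finset.sum_le_sum fun j _ =>
      (pow_le_pow_left₀ zero_le (hle j T hT).1 2).trans (add_sq_le_ennreal _ _),
    Finset.sum_le_sum fun j _ =>
      (pow_le_pow_left₀ zero_le (hle j T hT).2 2).trans (add_sq_le_ennreal _ _)⟩

theorem perturb_perturb (A : Lp ℂ 2 μ →ₗ.[ℂ] Lp ℂ 2 μ) (V₀ V : Lp ℝ ∞ μ) :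
    perturb (perturb A V₀) V =
      ((potentialCLM V + potentialCLM V₀ : Lp ℂ 2 μ →L[ℂ] Lp ℂ 2 μ) : Lp ℂ 2 μ →ₗ[ℂ] Lp ℂ 2 μ) +ᵥ A :=
  vadd_vadd _ _ _

theorem potential_zero : potential (0 : Lp ℝ ∞ μ) = 0 := by
  ext1 ψ
  refine Lp.ext ?_
  filter_upwards [coeFn_potential 0 ψ, Lp.coeFn_zero ℝ ∞ μ, Lp.coeFn_zero ℂ 2 μ] with x h1 h2 h3
  rw [h1, h2, LinearMap.zero_apply, h3, Pi.zero_apply, Pi.zero_apply, Complex.ofReal_zero, zero_mul]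

theorem perturb_zero (A : Lp ℂ 2 μ →ₗ.[ℂ] Lp ℂ 2 μ) : perturb A (0 : Lp ℝ ∞ μ) = A := by
  rw [perturb, potential_zero, zero_vadd]

/-- Ballistic transport is inherited by the image of the wave operator. -/
theorem IsFreeModel.transport_waveOperator (hA : IsFreeModel q hq A Ξ) (V₀ V : Lp ℝ ∞ μ)
    (ψ : Lp ℂ 2 μ) (H₀ H : Lp ℂ 2 μ →ₗ.[ℂ] Lp ℂ 2 μ) (U₀ U : ℝ → Lp ℂ 2 μ ≃ₗᵢ[ℂ] Lp ℂ 2 μ)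
    (hH₀ : H₀ = perturb A V₀) (hH : H = perturb H₀ V) (hU₀ : U₀ = propagator H₀)
    (hU : U = propagator H)
    (hJ : ∫⁻ t in Ioi (0 : ℝ), ENNReal.ofReal (1 + t) * s1Norm q Ξ (potential V (U₀ t ψ)) < ∞) :
    ∃ h : ψ ∈ (waveOperator U₀ U).domain,
      (∀ N : TransportNotion, N.Holds (secondMoment q U₀ ψ) →
        N.Holds (secondMoment q U (waveOperator U₀ U ⟨ψ, h⟩))) ∧
      (V₀ = 0 → ∀ N : TransportNotion, N.Holds (averagedSecondMoment q U₀ ψ) →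
        N.Holds (averagedSecondMoment q U (waveOperator U₀ U ⟨ψ, h⟩))) := by
  obtain ⟨W, hW⟩ := hA.exists_group
  have gU₀ : IsUnitaryGroupOf H₀ U₀ := by
    rw [hU₀, hH₀]
    exact isUnitaryGroupOf_propagator (hW.exists_vadd (inner_potentialCLM V₀))
  have gU : IsUnitaryGroupOf ((potentialCLM V : Lp ℂ 2 μ →ₗ[ℂ] Lp ℂ 2 μ) +ᵥ H₀) U := by
    rw [hU, hH]
    exact isUnitaryGroupOf_propagator (gU₀.exists_vadd (inner_potentialCLM V))
  -- The same group is also generated by a bounded perturbation `V + V₀` of the free operator.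
  -- Cook's method uses the perturbation `V` of `H₀`; the ballistic bound uses this one.
  have gU' : IsUnitaryGroupOf (((potentialCLM V + potentialCLM V₀ : Lp ℂ 2 μ →L[ℂ] Lp ℂ 2 μ) :
      Lp ℂ 2 μ →ₗ[ℂ] Lp ℂ 2 μ) +ᵥ A) U := by
    rw [← perturb_perturb, ← hH₀]
    exact gU
  have hcook : ∫⁻ t in Ioi (0 : ℝ), ‖potentialCLM V (U₀ t ψ)‖ₑ < ∞ := by
    refine lt_of_le_of_lt (setLIntegral_mono' measurableSet_Ioi fun t ht => ?_) hJ
    refine (enorm_le_s1Norm (q := q) Ξ _).trans (le_mul_of_one_le_left zero_le ?_)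
    rw [← ENNReal.ofReal_one]
    exact ENNReal.ofReal_le_ofReal (by linarith [mem_Ioi.1 ht])
  obtain ⟨φ, hφ, hrem⟩ := exists_tendsto_of_lintegral_lt_top gU₀ gU hcook
  have hdom : ψ ∈ (waveOperator U₀ U).domain := ⟨φ, hφ⟩
  have hΩ : waveOperator U₀ U ⟨ψ, hdom⟩ = φ := tendsto_nhds_unique hdom.choose_spec hφ
  obtain ⟨κ, hκ, hpos⟩ := exists_opNorm_position_remainder_le hA gU gU' (fun f hf u => by
    simp only [add_apply, potentialCLM_apply, potential_phase, map_add]) hJ hrem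
  refine ⟨hdom, fun N hN => ?_, fun hV₀ N hN => ?_⟩
  · rw [hΩ]
    exact hN.of_comparable (comparable_secondMoment hq hκ hpos)
  · rw [hΩ]
    have gU₀' : IsUnitaryGroupOf A U₀ := by
      rw [hH₀, hV₀, perturb_zero] at gU₀
      exact gU₀
    -- A finite averaged moment at one `T` says that each Cesàro mean is defined, hence that `U₀ t
    -- ψ` is in the domain of every `Q_j` for almost every `t` in `(0, T]`.
    obtain ⟨T, hT, hfin⟩ := hN.exists_lt_top
    have hae : ∀ j, ∀ᵐ t ∂volume.restrict (Ioc 0 T), U₀ t ψ ∈ (position μ q j).domain := by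
      intro j
      have h1 : cesaroOpNorm U₀ (position μ q j) T ψ ≠ ∞ := by
        intro htop
        have h2 := ENNReal.sum_lt_top.1 hfin j (Finset.mem_univ j)
        rw [htop] at h2
        simp at h2
      by_contra hne
      refine h1 (if_neg fun hdef => hne hdef.1)
    choose χ η hg using fun j => hA.heisenberg U₀ gU₀' j ψ T hT (hae j)
    exact hN.of_comparable (comparable_averagedSecondMoment hq gU₀ gU hκ hpos hJ hg)

end Scattering

/-! ### The Heisenberg evolution of the position -/

section Heisenberg

variable {E : Type*} [NormedAddCommGroup E] [InnerProductSpace ℂ E]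
  {A Q P : E →ₗ.[ℂ] E} {U M N : ℝ → E ≃ₗᵢ[ℂ] E}

theorem neg_I_smul_I_smul (z : E) : -Complex.I • Complex.I • z = z := by
  rw [smul_smul, neg_mul, Complex.I_mul_I, neg_neg, one_smul]

theorem hasDerivAt_apply_clm_equiv (W : E ≃ₗᵢ[ℂ] E) {x : ℝ → E} {x' : E} {s : ℝ}
    (hx : HasDerivAt x x' s) : HasDerivAt (fun r => W (x r)) (W x') s :=
  (W.toContinuousLinearEquiv.toContinuousLinearMap.restrictScalars
    ℝ).hasFDerivAt.comp_hasDerivAt s hx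

/-- The product rule at `0` for `W (c s) x(s)`. -/
theorem hasDerivAt_group_apply {W : ℝ → E ≃ₗᵢ[ℂ] E} (hW : ∀ ψ, Continuous fun t => W t ψ)
    (hW0 : ∀ ψ, W 0 ψ = ψ) {x : ℝ → E} {ψ x' ν : E} (c : ℝ) (hx : HasDerivAt x x' 0)
    (hx0 : x 0 = ψ) (hν : HasDerivAt (fun s => W (c * s) ψ) ν 0) :
    HasDerivAt (fun s => W (c * s) (x s)) (ν + x') 0 := by
  have h1 := hasDerivAt_isometry_apply_of_eq_zero (W := fun s => W (c * s))
    (fun ψ => (hW ψ).comp (continuous_const.mul continuous_id)) (hx.sub_const ψ)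
    (by rw [hx0, sub_self])
  simp only [mul_zero, hW0] at h1
  refine (hν.add h1).congr_of_eventuallyEq (Eventually.of_forall fun s => ?_)
  simp

theorem hasDerivAt_phaseFactor_mul_sq (t : ℝ) :
    HasDerivAt (fun s : ℝ => phaseFactor (t * s ^ 2)) 0 0 := by
  have h : HasDerivAt (fun s : ℝ => ((-(t * s ^ 2) : ℝ) : ℂ)) ((0 : ℝ) : ℂ) 0 := by
    have := ((hasDerivAt_pow 2 (0 : ℝ)).const_mul t).neg
    simpa using this.ofReal_comp
  have h2 := (h.const_mul Complex.I).cexp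
  simpa [phaseFactor] using h2

/-- If `M` and `U` satisfy Weyl relations with a third unitary group `N`, then a state which is
in the domain of the generator of `M` at two times is so at all times, and the generator evolves
linearly in time. -/
theorem exists_heisenberg_of_weyl (hU : IsUnitaryGroupOf A U) (hM : IsUnitaryGroupOf Q M)
    (hN : IsUnitaryGroupOf P N)
    (hweyl : ∀ t s u, U (-t) (M s (U t u)) = phaseFactor (t * s ^ 2) • N (t * s) (M s u))
    {ψ : E} {t₁ t₂ : ℝ} (ht : t₁ ≠ t₂) (h₁ : U t₁ ψ ∈ Q.domain) (h₂ : U t₂ ψ ∈ Q.domain) :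
    ∃ χ η : E, ∀ t : ℝ, (U t ψ, U t (χ + (t : ℂ) • η)) ∈ Q.graph := by
  -- By the Weyl relation, `U t ψ` in the domain of `Q` makes `s ↦ N (t s) (M s ψ)` differentiable
  -- at `0`; the scalar phase is quadratic in `s` and has derivative zero there.
  have hW : ∀ t, U t ψ ∈ Q.domain →
      ∃ ρ, HasDerivAt (fun s => N (t * s) (M s ψ)) ρ 0 := by
    intro t h
    obtain ⟨y, hy⟩ := LinearPMap.mem_domain_iff.1 h
    have h1 := hasDerivAt_apply_clm_equiv (U (-t)) ((hM.generator _ _).1 hy)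
    have h2 := (hasDerivAt_phaseFactor_mul_sq (-t)).smul h1
    refine ⟨_, h2.congr_of_eventuallyEq (Eventually.of_forall fun s => ?_)⟩
    change N (t * s) (M s ψ) = phaseFactor (-t * s ^ 2) • U (-t) (M s (U t ψ))
    rw [hweyl, smul_smul, ← phaseFactor_add, neg_mul, neg_add_cancel, phaseFactor_zero, one_smul]
  obtain ⟨ρ₁, hρ₁⟩ := hW t₁ h₁
  obtain ⟨ρ₂, hρ₂⟩ := hW t₂ h₂
  -- Comparing the two times cancels the factor `M s`, up to a term that vanishes at `s = 0`. Thus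
  -- `ψ` is in the domain of the generator of `N`.
  have hNψ : HasDerivAt (fun s => N ((t₂ - t₁) * s) ψ) (ρ₂ - ρ₁) 0 := by
    have h3 := hasDerivAt_isometry_apply_of_eq_zero (W := fun s => N ((t₂ - t₁) * s))
      (fun ψ => (hN.continuous ψ).comp (continuous_const.mul continuous_id)) (hρ₁.sub_const ψ)
      (by simp [hN.zero_apply, hM.zero_apply])
    simp only [mul_zero, hN.zero_apply] at h3
    refine (hρ₂.sub h3).congr_of_eventuallyEq (Eventually.of_forall fun s => ?_)
    simp only [Pi.sub_apply, map_sub, ← hN.add_apply]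
    rw [show (t₂ - t₁) * s + t₁ * s = t₂ * s by ring, sub_sub_cancel]
  have hne : t₂ - t₁ ≠ 0 := sub_ne_zero.2 ht.symm
  set ν : E := (t₂ - t₁)⁻¹ • (ρ₂ - ρ₁) with hν
  have hNt : ∀ t : ℝ, HasDerivAt (fun s => N (t * s) ψ) (t • ν) 0 := by
    intro t
    have h4 : HasDerivAt (fun s : ℝ => t / (t₂ - t₁) * s) (t / (t₂ - t₁)) 0 := by
      simpa using (hasDerivAt_id (0 : ℝ)).const_mul (t / (t₂ - t₁))
    have h5 := HasDerivAt.scomp (h := fun s : ℝ => t / (t₂ - t₁) * s) (0 : ℝ)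
      (by rw [mul_zero]; exact hNψ) h4
    refine (h5.congr_deriv ?_).congr_of_eventuallyEq (Eventually.of_forall fun s => ?_)
    · rw [hν, smul_smul, div_eq_mul_inv]
    · simp only [Function.comp_apply]
      congr 2
      field_simp
  -- With `N` differentiable on `ψ`, it can be undone in the relation at time `t₁`, which puts `ψ`
  -- itself in the domain of `Q`.
  have hMψ : HasDerivAt (fun s => M s ψ) ((-t₁) • ν + ρ₁) 0 := by
    have h6 := hasDerivAt_group_apply hN.continuous hN.zero_apply (-t₁) hρ₁
      (by simp [hN.zero_apply, hM.zero_apply]) (hNt (-t₁))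
    refine h6.congr_of_eventuallyEq (Eventually.of_forall fun s => ?_)
    simp only
    rw [← hN.add_apply, neg_mul, neg_add_cancel, hN.zero_apply]
  -- The derivatives at `0` of `M s ψ` and `N s ψ` are `-i Qψ` and `-i Pψ`; so `χ = Qψ` and `η =
  -- Pψ`.
  refine ⟨Complex.I • ((-t₁) • ν + ρ₁), Complex.I • ν, fun t => (hM.generator _ _).2 ?_⟩
  have h7 := hasDerivAt_group_apply hN.continuous hN.zero_apply t hMψ (hM.zero_apply ψ) (hNt t)
  have h8 := hasDerivAt_apply_clm_equiv (U t) ((hasDerivAt_phaseFactor_mul_sq t).smul h7)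
  refine (h8.congr_deriv ?_).congr_of_eventuallyEq (Eventually.of_forall fun s => ?_)
  · simp only [ne_eq, OfNat.ofNat_ne_zero, not_false_eq_true, zero_pow, mul_zero,
      phaseFactor_zero, zero_smul, add_zero, one_smul]
    rw [← map_smul, smul_add, smul_comm (t : ℂ) Complex.I ν, neg_I_smul_I_smul,
      neg_I_smul_I_smul, Complex.coe_smul, add_comm]
  · change M s (U t ψ) = U t (phaseFactor (t * s ^ 2) • N (t * s) (M s ψ))
    rw [← hweyl, hU.apply_neg_apply]

/-- The case of a bounded everywhere defined operator `A` whose commutators `M(-s) A M(s) - A`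
commute with the evolution. -/
theorem exists_heisenberg_of_commutator [CompleteSpace E] (hU : IsUnitaryGroupOf A U)
    (hM : IsUnitaryGroupOf Q M) (hA : ∀ u, u ∈ A.domain) {B : ℝ → E → E}
    (hB : ∀ s u w, (u, w) ∈ A.graph → (M s u, M s (w + B s u)) ∈ A.graph)
    (hBU : ∀ s t u, U t (B s u) = B s (U t u)) {ψ b : E}
    (hb : HasDerivAt (fun s => B s ψ) b 0) (hB0 : B 0 ψ = 0)
    {t₁ : ℝ} (h₁ : U t₁ ψ ∈ Q.domain) :
    ∃ χ η : E, ∀ t : ℝ, (U t ψ, U t (χ + (t : ℂ) • η)) ∈ Q.graph := by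
  -- The derivative in `r` of `U (-r) (M s (U r ψ))` involves only the commutator `B s`, and since
  -- `B s` commutes with the evolution it can be applied to `ψ` first.
  have hint : ∀ s t, U (-t) (M s (U t ψ)) - M s ψ =
      ∫ r in (0 : ℝ)..t, U (-r) (M s (U r (Complex.I • B s ψ))) := by
    intro s t
    have hd : ∀ r, HasDerivAt (fun r => U (-r) (M s (U r ψ)))
        (U (-r) (M s (U r (Complex.I • B s ψ)))) r := by
      intro r
      obtain ⟨w, hw⟩ := LinearPMap.mem_domain_iff.1 (hA ψ)
      obtain ⟨g1, g2⟩ := hU.mem_graph_and_hasDerivAt hw r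
      have g3 := hU.hasDerivAt_neg_apply (hasDerivAt_apply_clm_equiv (M s) g2) (hB s _ _ g1)
      refine g3.congr_deriv ?_
      rw [map_smul (U r), hBU]
      simp [smul_add]
    have hc : Continuous fun r => U (-r) (M s (U r (Complex.I • B s ψ))) :=
      continuous_isometry_apply (W := fun r => U (-r)) hU.continuous_neg continuous_id
        ((M s).continuous.comp (hU.continuous _))
    rw [intervalIntegral.integral_eq_sub_of_hasDerivAt (fun r _ => hd r)
      (hc.intervalIntegrable _ _)]
    simp [hU.zero_apply]
  -- Divide the integral by `s` and let `s → 0`: the integrand tends to the constant `i b`, because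
  -- `M s` tends to the identity and the evolutions cancel.
  have hderiv : ∀ t : ℝ, HasDerivAt (fun s => U (-t) (M s (U t ψ)) - M s ψ)
      (t • Complex.I • b) 0 := by
    intro t
    rw [hasDerivAt_zero_iff_tendsto]
    have hslope := hasDerivAt_zero_iff_tendsto.1 hb
    rw [hB0] at hslope
    have e : ∀ s : ℝ, ((s⁻¹ : ℝ) : ℂ) • (U (-t) (M s (U t ψ)) - M s ψ -
        (U (-t) (M 0 (U t ψ)) - M 0 ψ)) =
        ∫ r in (0 : ℝ)..t, U (-r) (M s (U r (Complex.I • ((s⁻¹ : ℝ) : ℂ) • (B s ψ - 0)))) := by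
      intro s
      rw [hM.zero_apply, hM.zero_apply, hU.neg_apply_apply, sub_self, sub_zero, sub_zero, hint,
        ← intervalIntegral.integral_smul]
      refine intervalIntegral.integral_congr fun r _ => ?_
      simp only [map_smul]
      exact smul_comm _ _ _
    simp_rw [e]
    have elim : t • Complex.I • b = ∫ _ in (0 : ℝ)..t, Complex.I • b := by
      rw [intervalIntegral.integral_const, sub_zero]
    rw [elim]
    have hslope' := hslope.const_smul Complex.I
    refine intervalIntegral.tendsto_integral_filter_of_dominated_convergence
      (fun _ => ‖Complex.I • b‖ + 1) (Eventually.of_forall fun s => ?_) ?_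
      intervalIntegrable_const (Eventually.of_forall fun r _ => ?_)
    · exact (continuous_isometry_apply (W := fun r => U (-r)) hU.continuous_neg continuous_id
        ((M s).continuous.comp (hU.continuous _))).aestronglyMeasurable
    · filter_upwards [hslope'.norm.eventually_le_const (lt_add_one _)] with s hs
      refine Eventually.of_forall fun r _ => ?_
      rw [LinearIsometryEquiv.norm_map, LinearIsometryEquiv.norm_map, LinearIsometryEquiv.norm_map]
      exact hs
    · have h1 := tendsto_isometry_apply (l := 𝓝[≠] (0 : ℝ)) hM.continuous (r := id) (t := 0)
        (tendsto_nhdsWithin_of_tendsto_nhds tendsto_id)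
        (((U r).continuous.tendsto _).comp hslope')
      rw [hM.zero_apply] at h1
      have h2 := ((U (-r)).continuous.tendsto _).comp h1
      rw [hU.neg_apply_apply] at h2
      exact h2
  obtain ⟨y, hy⟩ := LinearPMap.mem_domain_iff.1 h₁
  -- The difference between time `t₁` and time `0` is always differentiable, so one time in the
  -- domain is enough.
  have hMψ : HasDerivAt (fun s => M s ψ) (U (-t₁) (-Complex.I • y) - t₁ • Complex.I • b) 0 := by
    refine ((hasDerivAt_apply_clm_equiv (U (-t₁)) ((hM.generator _ _).1 hy)).sub
      (hderiv t₁)).congr_of_eventuallyEq (Eventually.of_forall fun s => ?_)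
    simp
  refine ⟨Complex.I • (U (-t₁) (-Complex.I • y) - t₁ • Complex.I • b), -b, fun t =>
    (hM.generator _ _).2 ?_⟩
  have h2 := hasDerivAt_apply_clm_equiv (U t) ((hderiv t).add hMψ)
  refine (h2.congr_deriv ?_).congr_of_eventuallyEq (Eventually.of_forall fun s => ?_)
  · rw [← map_smul, smul_add, neg_I_smul_I_smul, smul_neg, smul_neg,
      neg_smul Complex.I ((t : ℂ) • b), neg_neg,
      smul_comm Complex.I (t : ℂ) b, Complex.coe_smul, neg_smul, add_comm]
  · simp [hU.apply_neg_apply]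

end Heisenberg

/-! ### The lattice -/

section LatticeModel

variable {d : ℕ}

theorem ae_count_iff_forall {p : (Fin d → ℤ) → Prop} :
    (∀ᵐ n ∂(Measure.count : Measure (Fin d → ℤ)), p n) ↔ ∀ n, p n := by
  rw [ae_iff, Measure.count_eq_zero_iff, eq_empty_iff_forall_notMem]
  simp

theorem shift_apply (k : Fin d → ℤ) (ψ : L2Z d) (n : Fin d → ℤ) :
    shift k ψ n = ψ (n + k) :=
  ae_count_iff_forall.1 (Lp.coeFn_compMeasurePreserving ψ
    (measurePreserving_add_right Measure.count k)) n

theorem ext_L2Z {ψ φ : L2Z d} (h : ∀ n, ψ n = φ n) : ψ = φ :=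
  Lp.ext (Eventually.of_forall h)

theorem smul_apply_L2Z (c : ℂ) (ψ : L2Z d) (n : Fin d → ℤ) : (c • ψ) n = c * ψ n :=
  ae_count_iff_forall.1 (Lp.coeFn_smul c ψ) n

theorem phaseGroup_apply_L2Z {f : (Fin d → ℤ) → ℝ} (hf : Measurable f) (s : ℝ) (ψ : L2Z d)
    (n : Fin d → ℤ) : phaseGroup Measure.count f hf s ψ n = phaseFactor (s * f n) * ψ n :=
  ae_count_iff_forall.1 (coeFn_phaseGroup hf s ψ) n

theorem shift_shift (k l : Fin d → ℤ) (ψ : L2Z d) : shift k (shift l ψ) = shift (k + l) ψ :=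
  ext_L2Z fun n => by rw [shift_apply, shift_apply, shift_apply, add_assoc]

theorem shift_zero (ψ : L2Z d) : shift 0 ψ = ψ := ext_L2Z fun n => by rw [shift_apply, add_zero]

/-- The shift as a linear isometry. -/
noncomputable def shiftIsometry (k : Fin d → ℤ) : L2Z d →ₗᵢ[ℂ] L2Z d where
  toLinearMap := shift k
  norm_map' ψ := Lp.norm_compMeasurePreserving ψ (measurePreserving_add_right Measure.count k)

theorem shiftIsometry_apply (k : Fin d → ℤ) (ψ : L2Z d) : shiftIsometry k ψ = shift k ψ := rfl

theorem inner_shift (k : Fin d → ℤ) (ψ φ : L2Z d) :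
    inner ℂ (shift k ψ) φ = inner ℂ ψ (shift (-k) φ) := by
  conv_lhs => rw [← shift_zero φ, ← add_neg_cancel k, ← shift_shift]
  exact (shiftIsometry k).inner_map_map _ _

/-- The discrete Laplacian as a bounded operator. -/
noncomputable def discreteLaplacian (d : ℕ) : L2Z d →L[ℂ] L2Z d :=
  ∑ j : Fin d, ((2 : ℂ) • ContinuousLinearMap.id ℂ _ -
    (shiftIsometry (Pi.single j 1)).toContinuousLinearMap -
    (shiftIsometry (Pi.single j (-1))).toContinuousLinearMap)

theorem discreteLaplacian_apply (ψ : L2Z d) : discreteLaplacian d ψ =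
    ∑ j : Fin d, ((2 : ℂ) • ψ - shift (Pi.single j 1) ψ - shift (Pi.single j (-1)) ψ) := by
  rw [discreteLaplacian, sum_apply]
  rfl

theorem mem_graph_toPMap_top_iff {E : Type*} [AddCommGroup E] [Module ℂ E] {T : E →ₗ[ℂ] E}
    {ψ φ : E} : (ψ, φ) ∈ (LinearMap.toPMap T ⊤).graph ↔ φ = T ψ := by
  rw [LinearPMap.mem_graph_iff]
  constructor
  · rintro ⟨y, rfl, rfl⟩
    rfl
  · rintro rfl
    exact ⟨⟨ψ, trivial⟩, rfl, rfl⟩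

theorem negLaplacianZ_eq : negLaplacianZ d =
    LinearMap.toPMap (discreteLaplacian d : L2Z d →ₗ[ℂ] L2Z d) ⊤ := by
  rw [negLaplacianZ]
  congr 1
  ext1 ψ
  change _ = discreteLaplacian d ψ
  rw [discreteLaplacian_apply, LinearMap.sum_apply]
  rfl

theorem mem_graph_negLaplacianZ_iff {ψ φ : L2Z d} :
    (ψ, φ) ∈ (negLaplacianZ d).graph ↔ φ = discreteLaplacian d ψ := by
  rw [negLaplacianZ_eq, mem_graph_toPMap_top_iff]
  rfl

theorem inner_discreteLaplacian (ψ φ : L2Z d) :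
    inner ℂ (discreteLaplacian d ψ) φ = inner ℂ ψ (discreteLaplacian d φ) := by
  rw [discreteLaplacian_apply, discreteLaplacian_apply, sum_inner, inner_sum]
  refine Finset.sum_congr rfl fun j _ => ?_
  rw [inner_sub_left, inner_sub_left, inner_sub_right, inner_sub_right, inner_shift, inner_shift,
    inner_smul_left, inner_smul_right, ← Pi.single_neg, ← Pi.single_neg, neg_neg, map_ofNat]
  ring

/-- The lattice Laplacian is a bounded symmetric perturbation of the zero operator, which generates
the constant group. -/
theorem exists_isUnitaryGroupOf_negLaplacianZ : ∃ U, IsUnitaryGroupOf (negLaplacianZ d) U := by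
  have h0 : IsUnitaryGroupOf (LinearMap.toPMap (0 : L2Z d →ₗ[ℂ] L2Z d) ⊤) (fun _ => 1) := by
    refine ⟨rfl, fun _ _ => (one_mul 1).symm, fun ψ => continuous_const, fun ψ φ => ?_⟩
    rw [mem_graph_toPMap_top_iff, LinearMap.zero_apply]
    constructor
    · rintro rfl
      rw [smul_zero]
      exact hasDerivAt_const _ _
    · intro h
      have := h.unique (hasDerivAt_const (0 : ℝ) ψ)
      simpa using this
  obtain ⟨W, hW⟩ := h0.exists_vadd (B := discreteLaplacian d) inner_discreteLaplacian
  refine ⟨W, ?_⟩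
  convert hW using 1
  refine LinearPMap.eq_of_eq_graph (Submodule.ext fun ⟨ψ, φ⟩ => ?_)
  rw [mem_graph_negLaplacianZ_iff, mem_graph_vadd_iff, mem_graph_toPMap_top_iff]
  exact sub_eq_zero.symm

theorem measurable_latticePosition : Measurable (latticePosition (d := d)) :=
  Measurable.of_discrete

/-- The unitary group generated by the `j`-th lattice coordinate. -/
noncomputable abbrev latticePhase (j : Fin d) : ℝ → L2Z d ≃ₗᵢ[ℂ] L2Z d :=
  phaseGroup Measure.count (fun n => latticePosition n j)
    (measurable_coord measurable_latticePosition j)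

theorem shift_latticePhase (k : Fin d → ℤ) (j : Fin d) (s : ℝ) (ψ : L2Z d) :
    shift k (latticePhase j s ψ) = latticePhase j s (phaseFactor (s * k j) • shift k ψ) := by
  refine ext_L2Z fun n => ?_
  rw [shift_apply, phaseGroup_apply_L2Z, phaseGroup_apply_L2Z, smul_apply_L2Z, shift_apply,
    ← mul_assoc, ← phaseFactor_add]
  congr 2
  simp only [latticePosition, Pi.add_apply]
  push_cast
  ring

/-- The difference `M(-s) (-Δ) M(s) - (-Δ)` for the unitary group `M` of the `j`-th coordinate. -/
noncomputable def latticeCommutator (j : Fin d) (s : ℝ) (ψ : L2Z d) : L2Z d :=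
  ∑ i : Fin d, ((1 - phaseFactor (s * (Pi.single i 1 : Fin d → ℤ) j)) • shift (Pi.single i 1) ψ +
    (1 - phaseFactor (s * (Pi.single i (-1) : Fin d → ℤ) j)) • shift (Pi.single i (-1)) ψ)

theorem discreteLaplacian_latticePhase (j : Fin d) (s : ℝ) (ψ : L2Z d) :
    discreteLaplacian d (latticePhase j s ψ) =
      latticePhase j s (discreteLaplacian d ψ + latticeCommutator j s ψ) := by
  rw [discreteLaplacian_apply, discreteLaplacian_apply, latticeCommutator,
    ← Finset.sum_add_distrib, map_sum]
  refine Finset.sum_congr rfl fun i _ => ?_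
  rw [shift_latticePhase, shift_latticePhase, ← map_smul, ← map_sub, ← map_sub]
  congr 1
  rw [sub_smul, sub_smul, one_smul, one_smul]
  abel

/-- Each of the `2 d` unit shifts changes the `j`-th coordinate by at most one, so its phase differs
from `1` by at most `|s|`. -/
theorem norm_latticeCommutator_le (j : Fin d) (s : ℝ) (ψ : L2Z d) :
    ‖latticeCommutator j s ψ‖ ≤ |s| * (2 * d * ‖ψ‖) := by
  have h1 : ∀ (i : Fin d) (m : ℤ), |m| = 1 → ‖(1 - phaseFactor (s * (Pi.single i m : Fin d → ℤ) j)) •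
      shift (Pi.single i m) ψ‖ ≤ |s| * ‖ψ‖ := by
    intro i m hm
    rw [norm_smul, norm_sub_rev]
    have h2 : ‖shift (Pi.single i m) ψ‖ = ‖ψ‖ := (shiftIsometry (Pi.single i m)).norm_map ψ
    rw [h2]
    refine mul_le_mul_of_nonneg_right ((norm_phaseFactor_sub_one_le _).trans ?_) (norm_nonneg _)
    rw [abs_mul]
    refine mul_le_of_le_one_right (abs_nonneg _) ?_
    rw [Pi.single_apply]
    split_ifs
    · exact_mod_cast hm.le
    · simp
  rw [latticeCommutator]
  refine (norm_sum_le_of_le _ (fun i _ => norm_add_le_of_le (h1 i 1 rfl) (h1 i (-1) rfl))).trans_eq ?_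
  rw [Finset.sum_const, Finset.card_univ, Fintype.card_fin, nsmul_eq_mul]
  ring

theorem shift_discreteLaplacian (k : Fin d → ℤ) (ψ : L2Z d) :
    shift k (discreteLaplacian d ψ) = discreteLaplacian d (shift k ψ) := by
  rw [discreteLaplacian_apply, discreteLaplacian_apply, map_sum]
  refine Finset.sum_congr rfl fun i _ => ?_
  rw [map_sub, map_sub, map_smul, shift_shift, shift_shift, shift_shift, shift_shift,
    add_comm k, add_comm k]

/-- Shifts commute with the Laplacian, hence with the evolution. The lattice commutators are
combinations of shifts, so they are constants of the free motion. -/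
theorem shift_evolution {U : ℝ → L2Z d ≃ₗᵢ[ℂ] L2Z d} (hU : IsUnitaryGroupOf (negLaplacianZ d) U)
    (k : Fin d → ℤ) (t : ℝ) (ψ : L2Z d) : U t (shift k ψ) = shift k (U t ψ) := by
  have hd : ∀ s, HasDerivAt (fun r => U (-r) (shiftIsometry k (U r ψ))) 0 s := by
    intro s
    obtain ⟨h1, h2⟩ := hU.mem_graph_and_hasDerivAt (mem_graph_negLaplacianZ_iff.2 rfl) (ψ := ψ) s
    have h3 : HasDerivAt (fun r => shiftIsometry k (U r ψ))
        (shiftIsometry k (-Complex.I • U s (discreteLaplacian d ψ))) s :=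
      ((shiftIsometry k).toContinuousLinearMap.restrictScalars
        ℝ).hasFDerivAt.comp_hasDerivAt s h2
    have h4 := hU.hasDerivAt_neg_apply h3 (mem_graph_negLaplacianZ_iff.2 rfl)
    refine h4.congr_deriv ?_
    rw [mem_graph_negLaplacianZ_iff.1 h1, shiftIsometry_apply, shiftIsometry_apply,
      ← shift_discreteLaplacian, map_smul, neg_smul, add_neg_cancel, map_zero]
  have h1 := is_const_of_deriv_eq_zero (fun s => (hd s).differentiableAt)
    (fun s => (hd s).deriv) t 0
  simp only [neg_zero, hU.zero_apply, shiftIsometry_apply] at h1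
  rw [← h1, hU.apply_neg_apply]

theorem isFreeModel_lattice (d : ℕ) : IsFreeModel (latticePosition (d := d))
    measurable_latticePosition (negLaplacianZ d) (momentumZ d) where
  exists_group := exists_isUnitaryGroupOf_negLaplacianZ
  exists_conj := by
    -- On the lattice the commutator is bounded, so no energy term is needed.
    refine ⟨(2 * d) ^ 2, 0, by positivity, le_rfl, fun j s hs _ u w huw =>
      ⟨latticeCommutator j s u, ?_, ?_⟩⟩
    · rw [mem_graph_negLaplacianZ_iff] at huw ⊢
      rw [huw, discreteLaplacian_latticePhase]
    · rw [zero_mul, add_zero, ← mul_pow, ← mul_pow]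
      have := norm_latticeCommutator_le j s u
      rw [abs_of_pos hs] at this
      exact pow_le_pow_left₀ (norm_nonneg _) this 2
  exists_approx := by
    refine ⟨‖discreteLaplacian d‖, norm_nonneg _, fun u hu ε hε =>
      ⟨u, discreteLaplacian d u, mem_graph_negLaplacianZ_iff.2 rfl, by simpa using hε, ?_⟩⟩
    have h1 : ‖u‖ ≤ (s1Norm latticePosition (momentumZ d) u).toReal := by
      have := ENNReal.toReal_mono hu.ne (enorm_le_s1Norm (q := latticePosition) (momentumZ d) u)
      rwa [toReal_enorm] at this
    calc RCLike.re (inner ℂ u (discreteLaplacian d u)) ≤ ‖u‖ * ‖discreteLaplacian d u‖ :=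
          (RCLike.re_le_norm _).trans (norm_inner_le_norm _ _)
      _ ≤ ‖u‖ * (‖discreteLaplacian d‖ * ‖u‖) := by
          gcongr; exact (discreteLaplacian d).le_opNorm u
      _ = ‖discreteLaplacian d‖ * ‖u‖ ^ 2 := by ring
      _ ≤ _ := by gcongr
  heisenberg U hU j ψ T hT hae := by
    have : (volume.restrict (Ioc 0 T)) ≠ 0 := by
      rw [Ne, Measure.restrict_eq_zero, Real.volume_Ioc]
      simpa using hT
    have : (ae (volume.restrict (Ioc 0 T))).NeBot := ae_neBot.2 this
    obtain ⟨t₁, ht₁⟩ := hae.exists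
    have hder : ∀ a : ℝ, HasDerivAt (fun s : ℝ => 1 - phaseFactor (s * a)) (-(-Complex.I * a)) 0 :=
      fun a => (hasDerivAt_phaseFactor_mul a).const_sub 1
    refine exists_heisenberg_of_commutator hU
      (isUnitaryGroupOf_phaseGroup (measurable_coord measurable_latticePosition j))
      (fun u => trivial) (B := latticeCommutator j) (fun s u w huw => ?_) (fun s t u => ?_)
      (HasDerivAt.fun_sum fun i _ => (HasDerivAt.fun_add
        ((hder _).smul_const _) ((hder _).smul_const _))) ?_ ht₁
    · rw [mem_graph_negLaplacianZ_iff] at huw ⊢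
      rw [huw, discreteLaplacian_latticePhase]
    · simp only [latticeCommutator, map_sum, map_add, map_smul, shift_evolution hU]
    · simp [latticeCommutator, phaseFactor_zero]

end LatticeModel

/-! ### Fourier multipliers on `L²(ℝ^d)` -/

section FourierMultiplier

variable {d : ℕ}

open FourierTransform TemperedDistribution
open scoped SchwartzMap

theorem mem_graph_realization_iff
    {T : 𝓢'(EuclideanSpace ℝ (Fin d), ℂ) →L[ℂ] 𝓢'(EuclideanSpace ℝ (Fin d), ℂ)}
    {ψ φ : L2R d} :
    (ψ, φ) ∈ (realization d T).graph ↔ T (toDistribution d ψ) = toDistribution d φ := by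
  rw [LinearPMap.mem_graph_iff]
  constructor
  · rintro ⟨y, rfl, rfl⟩
    exact y.2.choose_spec.symm
  · intro h
    have hψ : ψ ∈ (realization d T).domain := ⟨φ, h.symm⟩
    exact ⟨⟨ψ, hψ⟩, rfl, toDistribution_injective d (hψ.choose_spec.trans h)⟩

/-- The symbol `g` is unbounded, so `g ψ` is at first only a distribution. Multiplication by `(1 +
‖x‖²)⁻¹` turns both sides into bounded multiples of `L²` functions, which can be compared almost
everywhere; the positive factor is then cancelled. -/
theorem smulLeftCLM_toDistribution_eq_iff {g : EuclideanSpace ℝ (Fin d) → ℝ}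
    (hg : (fun x => (g x : ℂ)).HasTemperateGrowth) {C : ℝ} (hC : ∀ x, |g x| ≤ C * (1 + ‖x‖ ^ 2))
    {ψ φ : L2R d} :
    smulLeftCLM ℂ (fun x => (g x : ℂ)) (toDistribution d ψ) = toDistribution d φ ↔
      (ψ, φ) ∈ (mulOperator volume g).graph := by
  rw [mem_graph_mulOperator_iff]
  constructor
  · intro h
    set r : EuclideanSpace ℝ (Fin d) → ℝ := fun x => (1 + ‖x‖ ^ 2) ^ (-1 : ℝ) with hr
    have hr0 : ∀ x, 0 < r x := fun x => by positivity
    have hrg : (fun x => (r x : ℂ)).HasTemperateGrowth := by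
      rw [hr]
      fun_prop
    have hr1 : ∀ x, r x * (1 + ‖x‖ ^ 2) = 1 := fun x => by
      rw [hr]
      simp only
      rw [Real.rpow_neg_one]
      exact inv_mul_cancel₀ (by positivity)
    have hm1 : MemLp (fun x => (r x : ℂ)) ∞ (volume : Measure (EuclideanSpace ℝ (Fin d))) := by
      refine memLp_top_of_bound hrg.1.continuous.aestronglyMeasurable 1
        (Eventually.of_forall fun x => ?_)
      rw [Complex.norm_real, Real.norm_of_nonneg (hr0 x).le, ← hr1 x]
      exact le_mul_of_one_le_right (hr0 x).le (by nlinarith [sq_nonneg ‖x‖])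
    have hm2 : MemLp ((fun x => (g x : ℂ)) * fun x => (r x : ℂ)) ∞
        (volume : Measure (EuclideanSpace ℝ (Fin d))) := by
      refine memLp_top_of_bound (hg.1.continuous.mul hrg.1.continuous).aestronglyMeasurable C
        (Eventually.of_forall fun x => ?_)
      rw [Pi.mul_apply, norm_mul, Complex.norm_real, Complex.norm_real,
        Real.norm_of_nonneg (hr0 x).le, Real.norm_eq_abs]
      calc |g x| * r x ≤ C * (1 + ‖x‖ ^ 2) * r x :=
            mul_le_mul_of_nonneg_right (hC x) (hr0 x).le
        _ = C * (r x * (1 + ‖x‖ ^ 2)) := by ring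
        _ = C := by rw [hr1, mul_one]
    have h1 := congrArg (smulLeftCLM ℂ fun x => (r x : ℂ)) h
    rw [smulLeftCLM_smulLeftCLM_apply hg hrg] at h1
    have h2 := toDistribution_injective d
      ((Lp.toTemperedDistribution_smul_eq (r := 2) (hg.mul hrg) hm2 ψ).trans (h1.trans
        (Lp.toTemperedDistribution_smul_eq (r := 2) hrg hm1 φ).symm))
    filter_upwards [Lp.coeFn_lpSMul (r := 2) (hm2.toLp _) ψ, hm2.coeFn_toLp,
      Lp.coeFn_lpSMul (r := 2) (hm1.toLp _) φ, hm1.coeFn_toLp] with x e1 e2 e3 e4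
    rw [h2, e3] at e1
    simp only [Pi.smul_apply', e2, e4, Pi.mul_apply, smul_eq_mul] at e1
    refine mul_left_cancel₀ (Complex.ofReal_ne_zero.2 (hr0 x).ne') (e1.trans ?_)
    ring
  · intro h
    ext u
    simp only [Lp.toTemperedDistributionCLM_apply, smulLeftCLM_apply_apply,
      Lp.toTemperedDistribution_apply]
    refine integral_congr_ae ?_
    filter_upwards [h] with x hx
    rw [hx, SchwartzMap.smulLeftCLM_apply_apply hg, smul_eq_mul, smul_eq_mul, smul_eq_mul]
    ring

/-- The Fourier transform on `L²(ℝ^d)`. -/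
noncomputable abbrev fourierL2 (d : ℕ) : L2R d ≃ₗᵢ[ℂ] L2R d :=
  Lp.fourierTransformₗᵢ (EuclideanSpace ℝ (Fin d)) ℂ

theorem fourier_toDistribution (ψ : L2R d) :
    𝓕 (toDistribution d ψ) = toDistribution d (fourierL2 d ψ) :=
  Lp.fourier_toTemperedDistribution_eq ψ

/-- The Fourier transform diagonalizes the maximal realization exactly, domain included, so
questions of domain for `-Δ` and `-2i∂_j` become questions about multiplication operators. -/
theorem mem_graph_realization_fourierMultiplierCLM_iff {g : EuclideanSpace ℝ (Fin d) → ℝ}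
    (hg : (fun x => (g x : ℂ)).HasTemperateGrowth) {C : ℝ} (hC : ∀ x, |g x| ≤ C * (1 + ‖x‖ ^ 2))
    {ψ φ : L2R d} :
    (ψ, φ) ∈ (realization d (fourierMultiplierCLM ℂ fun x => (g x : ℂ))).graph ↔
      (fourierL2 d ψ, fourierL2 d φ) ∈ (mulOperator volume g).graph := by
  rw [mem_graph_realization_iff, fourierMultiplierCLM_apply, fourier_toDistribution,
    ← smulLeftCLM_toDistribution_eq_iff hg hC, ← fourier_toDistribution φ]
  constructor
  · intro h
    rw [← h, fourier_fourierInv_eq]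
  · intro h
    rw [h, fourierInv_fourier_eq]

/-- The symbol of `-Δ`. -/
noncomputable def laplacianSymbol (d : ℕ) (ξ : EuclideanSpace ℝ (Fin d)) : ℝ :=
  (2 * Real.pi) ^ 2 * ‖ξ‖ ^ 2

/-- The symbol of `-2i∂_j`. -/
noncomputable def momentumSymbol {d : ℕ} (j : Fin d) (ξ : EuclideanSpace ℝ (Fin d)) : ℝ :=
  4 * Real.pi * ξ j

theorem mem_graph_negLaplacianR_iff {ψ φ : L2R d} : (ψ, φ) ∈ (negLaplacianR d).graph ↔
    (fourierL2 d ψ, fourierL2 d φ) ∈ (mulOperator volume (laplacianSymbol d)).graph := by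
  have hg : (fun x => (laplacianSymbol d x : ℂ)).HasTemperateGrowth := by
    unfold laplacianSymbol
    fun_prop
  rw [← mem_graph_realization_fourierMultiplierCLM_iff (C := (2 * Real.pi) ^ 2) hg,
    negLaplacianR]
  · congr! 3
    ext1 f
    have h2 : (fun x : EuclideanSpace ℝ (Fin d) => (laplacianSymbol d x : ℂ)) =
        ((2 * Real.pi) ^ 2 : ℂ) • fun x => Complex.ofReal (‖x‖ ^ 2) := by
      ext x
      simp [laplacianSymbol]
    rw [h2, fourierMultiplierCLM_smul (by fun_prop), neg_apply, laplacianCLM_apply,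
      laplacian_eq_fourierMultiplierCLM, neg_smul, neg_neg, ← Complex.coe_smul]
    simp
  · intro x
    rw [laplacianSymbol, abs_of_nonneg (by positivity)]
    gcongr
    linarith

theorem mem_graph_momentumR_iff {j : Fin d} {ψ φ : L2R d} : (ψ, φ) ∈ (momentumR d j).graph ↔
    (fourierL2 d ψ, fourierL2 d φ) ∈ (mulOperator volume (momentumSymbol j)).graph := by
  have h1 : ∀ x : EuclideanSpace ℝ (Fin d),
      inner ℝ x (EuclideanSpace.single j (1 : ℝ)) = x j := fun x => by
    simp [EuclideanSpace.inner_single_right]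
  have h2 : (fun x : EuclideanSpace ℝ (Fin d) => (momentumSymbol j x : ℂ)) =
      (4 * Real.pi : ℂ) •
        fun x => ((inner ℝ x (EuclideanSpace.single j (1 : ℝ)) : ℝ) : ℂ) := by
    ext x
    simp [momentumSymbol, ← h1]
  have hg : (fun x : EuclideanSpace ℝ (Fin d) =>
      ((inner ℝ x (EuclideanSpace.single j (1 : ℝ)) : ℝ) : ℂ)).HasTemperateGrowth := by
    fun_prop
  have hg' : (fun x : EuclideanSpace ℝ (Fin d) => (momentumSymbol j x : ℂ)).HasTemperateGrowth := by
    simp_rw [momentumSymbol, ← h1]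
    fun_prop
  rw [← mem_graph_realization_fourierMultiplierCLM_iff (C := 4 * Real.pi) hg', momentumR]
  · congr! 3
    ext1 f
    rw [h2, fourierMultiplierCLM_smul hg, smul_apply, smul_apply]
    change (-2 * Complex.I) • LineDeriv.lineDerivOp (EuclideanSpace.single j (1 : ℝ)) f = _
    rw [lineDeriv_eq_fourierMultiplierCLM, smul_smul]
    congr 1
    linear_combination (-4 * Real.pi : ℂ) * Complex.I_mul_I
  · intro x
    rw [momentumSymbol, abs_mul, abs_of_nonneg (by positivity)]
    have := PiLp.norm_apply_le x j
    rw [Real.norm_eq_abs] at this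
    gcongr
    nlinarith [sq_nonneg (‖x‖ - 1), norm_nonneg x]

end FourierMultiplier

/-! ### The continuum -/

theorem IsUnitaryGroupOf.conj {E : Type*} [NormedAddCommGroup E] [InnerProductSpace ℂ E]
    {A A' : E →ₗ.[ℂ] E} {W : ℝ → E ≃ₗᵢ[ℂ] E} (hW : IsUnitaryGroupOf A' W) (Φ : E ≃ₗᵢ[ℂ] E)
    (h : ∀ ψ φ, (ψ, φ) ∈ A.graph ↔ (Φ ψ, Φ φ) ∈ A'.graph) :
    IsUnitaryGroupOf A fun t => (Φ.trans (W t)).trans Φ.symm where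
  zero := by
    ext x
    simp [hW.zero_apply]
  add s t := by
    ext x
    simp [hW.add_apply]
  continuous ψ := Φ.symm.continuous.comp (hW.continuous _)
  generator ψ φ := by
    rw [h, hW.generator]
    constructor
    · intro h1
      simpa using hasDerivAt_apply_clm_equiv Φ.symm h1
    · intro h1
      simpa using hasDerivAt_apply_clm_equiv Φ h1

theorem exists_mem_graph_of_opNorm_lt_top {E : Type*} [NormedAddCommGroup E]
    [InnerProductSpace ℂ E] {A : E →ₗ.[ℂ] E} {ψ : E} (h : opNorm A ψ < ∞) :
    ∃ φ, (ψ, φ) ∈ A.graph := by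
  by_contra! hne
  rw [opNorm, dif_neg fun hψ => hne _ (A.mem_graph ⟨ψ, hψ⟩)] at h
  exact lt_irrefl _ h

/-! ### Integrated pointwise estimates in `L²` -/

section L2

variable {X : Type*} [MeasurableSpace X] {μ : Measure X}

theorem norm_sq_L2_eq_integral (u : Lp ℂ 2 μ) : ‖u‖ ^ 2 = ∫ x, ‖u x‖ ^ 2 ∂μ := by
  rw [← inner_self_eq_norm_sq (𝕜 := ℂ) u, L2.inner_def, ← integral_re (L2.integrable_inner _ _)]
  simp only [inner_self_eq_norm_sq]

theorem integrable_norm_sq_L2 (u : Lp ℂ 2 μ) : Integrable (fun x => ‖u x‖ ^ 2) μ := by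
  simpa only [inner_self_eq_norm_sq] using (L2.integrable_inner (𝕜 := ℂ) u u).re

theorem norm_sq_L2_le_of_ae {b u w : Lp ℂ 2 μ} {K₁ K₂ : ℝ}
    (h : ∀ᵐ x ∂μ, ‖b x‖ ^ 2 ≤ K₁ * ‖u x‖ ^ 2 + K₂ * RCLike.re (inner ℂ (u x) (w x))) :
    ‖b‖ ^ 2 ≤ K₁ * ‖u‖ ^ 2 + K₂ * RCLike.re (inner ℂ u w) := by
  have hi := (L2.integrable_inner (𝕜 := ℂ) u w).re
  rw [norm_sq_L2_eq_integral, norm_sq_L2_eq_integral, L2.inner_def,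
    ← integral_re (L2.integrable_inner _ _), ← integral_const_mul, ← integral_const_mul,
    ← integral_add ((integrable_norm_sq_L2 u).const_mul _) (hi.const_mul _)]
  exact integral_mono_ae (integrable_norm_sq_L2 b)
    (((integrable_norm_sq_L2 u).const_mul _).add (hi.const_mul _)) h

theorem re_inner_L2_le_of_ae {ι : Type*} {s : Finset ι} {v w : Lp ℂ 2 μ} {y : ι → Lp ℂ 2 μ}
    {K : ℝ} (h : ∀ᵐ x ∂μ, RCLike.re (inner ℂ (v x) (w x)) ≤ ∑ i ∈ s, K * ‖y i x‖ ^ 2) :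
    RCLike.re (inner ℂ v w) ≤ ∑ i ∈ s, K * ‖y i‖ ^ 2 := by
  simp_rw [norm_sq_L2_eq_integral, ← integral_const_mul]
  rw [L2.inner_def, ← integral_re (L2.integrable_inner _ _),
    ← integral_finsetSum _ fun i _ => (integrable_norm_sq_L2 (y i)).const_mul K]
  exact integral_mono_ae (L2.integrable_inner (𝕜 := ℂ) v w).re
    (integrable_finsetSum _ fun i _ => (integrable_norm_sq_L2 (y i)).const_mul K) h

end L2

section ContinuumModel

variable {d : ℕ}

/-- The unitary group generated by the `j`-th coordinate of `ℝ^d`. -/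
noncomputable abbrev coordPhase (j : Fin d) : ℝ → L2R d ≃ₗᵢ[ℂ] L2R d :=
  phaseGroup volume (fun x : EuclideanSpace ℝ (Fin d) => id x j) (measurable_coord measurable_id j)

/-- The translation `ψ ↦ ψ(· + a)` on `L²(ℝ^d)`. -/
noncomputable def translation (a : EuclideanSpace ℝ (Fin d)) : L2R d →ₗᵢ[ℂ] L2R d :=
  Lp.compMeasurePreservingₗᵢ ℂ (fun x => x + a) (measurePreserving_add_right volume a)

theorem coeFn_translation (a : EuclideanSpace ℝ (Fin d)) (ψ : L2R d) :
    translation a ψ =ᵐ[volume] fun x => ψ (x + a) :=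
  Lp.coeFn_compMeasurePreserving ψ (measurePreserving_add_right volume a)

/-- The displacement of the momentum caused by `e^{-i s Q_j}`. -/
noncomputable def boost (j : Fin d) (s : ℝ) : EuclideanSpace ℝ (Fin d) :=
  (s / (2 * Real.pi)) • EuclideanSpace.single j (1 : ℝ)

theorem two_pi_mul_inner_boost (j : Fin d) (s : ℝ) (x : EuclideanSpace ℝ (Fin d)) :
    2 * Real.pi * inner ℝ (boost j s) x = s * x j := by
  rw [boost, real_inner_smul_left, EuclideanSpace.inner_single_left]
  simp only [map_one, one_mul]
  field_simp

/-- Completing the square; the boost is `s / (2π)` times a unit vector because of the `2π` in the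
Fourier transform. The linear term produces the momentum in the commutator and in the Weyl relation,
the term `s ^ 2` the scalar phase. -/
theorem laplacianSymbol_add_boost (j : Fin d) (s : ℝ) (ξ : EuclideanSpace ℝ (Fin d)) :
    laplacianSymbol d (ξ + boost j s) = laplacianSymbol d ξ + s * momentumSymbol j ξ + s ^ 2 := by
  have h1 := two_pi_mul_inner_boost j s ξ
  have h2 := two_pi_mul_inner_boost j s (boost j s)
  have h3 : boost j s j = s / (2 * Real.pi) := by simp [boost]
  rw [h3, real_inner_self_eq_norm_sq] at h2
  rw [real_inner_comm] at h1
  have h4 : (2 * Real.pi) ^ 2 * ‖boost j s‖ ^ 2 = s ^ 2 := by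
    have : (2 * Real.pi) * (s * (s / (2 * Real.pi))) = s ^ 2 := by field_simp
    rw [← this, ← h2]
    ring
  rw [laplacianSymbol, laplacianSymbol, momentumSymbol, norm_add_sq_real, mul_add, mul_add, h4]
  linear_combination 4 * Real.pi * h1

open FourierTransform in
-- Both sides are continuous in `ψ`, so it is enough to take Schwartz functions, where the inverse
-- Fourier transform is an integral and a translation of the integration variable produces the
-- phase.
theorem fourierL2_symm_translation (j : Fin d) (s : ℝ) (ψ : L2R d) :
    (fourierL2 d).symm (translation (boost j s) ψ) = coordPhase j s ((fourierL2 d).symm ψ) := by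
  revert ψ
  refine congrFun (DenseRange.equalizer (SchwartzMap.denseRange_toLpCLM (F := ℂ)
    (E := EuclideanSpace ℝ (Fin d)) (μ := volume) (p := 2) ENNReal.ofNat_ne_top)
    ((fourierL2 d).symm.continuous.comp (translation _).continuous)
    ((coordPhase j s).continuous.comp (fourierL2 d).symm.continuous) ?_)
  ext1 f
  have e1 : translation (boost j s) (f.toLp 2 volume) =
      (f.compSubConstCLM ℂ (-boost j s)).toLp 2 volume := by
    refine Lp.ext ?_
    filter_upwards [coeFn_translation (boost j s) (f.toLp 2 volume),
      (f.compSubConstCLM ℂ (-boost j s)).coeFn_toLp 2 volume,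
      (measurePreserving_add_right volume (boost j s)).quasiMeasurePreserving.ae
        (f.coeFn_toLp 2 volume)] with x h1 h2 h3
    rw [h1, h2, h3, SchwartzMap.compSubConstCLM_apply, sub_neg_eq_add]
  change (fourierL2 d).symm (translation (boost j s) (f.toLp 2 volume)) =
    coordPhase j s ((fourierL2 d).symm (f.toLp 2 volume))
  rw [e1]
  change 𝓕⁻ ((f.compSubConstCLM ℂ (-boost j s)).toLp 2 volume) = coordPhase j s
    (𝓕⁻ (f.toLp 2 volume))
  rw [SchwartzMap.toLp_fourierInv_eq, SchwartzMap.toLp_fourierInv_eq]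
  refine Lp.ext ?_
  filter_upwards [(𝓕⁻ (f.compSubConstCLM ℂ (-boost j s))).coeFn_toLp 2 volume,
    coeFn_phaseGroup (measurable_coord measurable_id j) s ((𝓕⁻ f).toLp 2 volume),
    (𝓕⁻ f).coeFn_toLp 2 volume] with x h1 h2 h3
  rw [h1, h2, h3, SchwartzMap.fourierInv_coe, SchwartzMap.fourierInv_coe, Real.fourierInv_eq',
    Real.fourierInv_eq', ← integral_const_mul,
    ← integral_add_right_eq_self (fun v => phaseFactor (s * id x j) * _) (boost j s)]
  refine integral_congr_ae (Eventually.of_forall fun v => ?_)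
  simp only [SchwartzMap.compSubConstCLM_apply, sub_neg_eq_add, smul_eq_mul, ← mul_assoc,
    phaseFactor, ← Complex.exp_add, inner_add_left, mul_add, two_pi_mul_inner_boost, id_eq]
  congr 2
  push_cast
  ring

/-- On the Fourier side `e^{-i s Q_j}` is a translation. -/
theorem coeFn_fourierL2_coordPhase (j : Fin d) (s : ℝ) (ψ : L2R d) :
    fourierL2 d (coordPhase j s ψ) =ᵐ[volume] fun ξ => fourierL2 d ψ (ξ + boost j s) := by
  have h := fourierL2_symm_translation j s (fourierL2 d ψ)
  rw [LinearIsometryEquiv.symm_apply_apply] at h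
  rw [← h, LinearIsometryEquiv.apply_symm_apply]
  exact coeFn_translation _ _

/-! ### The free and momentum groups, and the energy bounds, on the Fourier side -/

theorem measurable_laplacianSymbol : Measurable (laplacianSymbol d) := by
  unfold laplacianSymbol
  fun_prop

theorem measurable_momentumSymbol (j : Fin d) : Measurable (momentumSymbol j) := by
  unfold momentumSymbol
  fun_prop

/-- The free evolution `e^{itΔ}`. -/
noncomputable def freeGroup (d : ℕ) (t : ℝ) : L2R d ≃ₗᵢ[ℂ] L2R d :=
  ((fourierL2 d).trans (phaseGroup volume (laplacianSymbol d) measurable_laplacianSymbol t)).trans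
    (fourierL2 d).symm

/-- The unitary group generated by `-2i∂_j`. -/
noncomputable def momentumGroup (j : Fin d) (t : ℝ) : L2R d ≃ₗᵢ[ℂ] L2R d :=
  ((fourierL2 d).trans (phaseGroup volume (momentumSymbol j) (measurable_momentumSymbol j) t)).trans
    (fourierL2 d).symm

theorem isUnitaryGroupOf_freeGroup : IsUnitaryGroupOf (negLaplacianR d) (freeGroup d) :=
  (isUnitaryGroupOf_phaseGroup measurable_laplacianSymbol).conj (fourierL2 d)
    fun _ _ => mem_graph_negLaplacianR_iff

theorem isUnitaryGroupOf_momentumGroup (j : Fin d) :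
    IsUnitaryGroupOf (momentumR d j) (momentumGroup j) :=
  (isUnitaryGroupOf_phaseGroup (measurable_momentumSymbol j)).conj (fourierL2 d)
    fun _ _ => mem_graph_momentumR_iff

theorem coeFn_fourierL2_freeGroup (t : ℝ) (ψ : L2R d) :
    fourierL2 d (freeGroup d t ψ) =ᵐ[volume]
      fun ξ => phaseFactor (t * laplacianSymbol d ξ) * fourierL2 d ψ ξ := by
  have h := coeFn_phaseGroup (μ := volume) (measurable_laplacianSymbol (d := d)) t (fourierL2 d ψ)
  rw [← (fourierL2 d).apply_symm_apply (phaseGroup volume _ _ t (fourierL2 d ψ))] at h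
  exact h

theorem coeFn_fourierL2_momentumGroup (j : Fin d) (t : ℝ) (ψ : L2R d) :
    fourierL2 d (momentumGroup j t ψ) =ᵐ[volume]
      fun ξ => phaseFactor (t * momentumSymbol j ξ) * fourierL2 d ψ ξ := by
  have h := coeFn_phaseGroup (μ := volume) (measurable_momentumSymbol j) t (fourierL2 d ψ)
  rw [← (fourierL2 d).apply_symm_apply (phaseGroup volume _ _ t (fourierL2 d ψ))] at h
  exact h

/-- The Weyl relation between the free evolution and the position. -/
theorem freeGroup_neg_coordPhase_freeGroup (j : Fin d) (t s : ℝ) (ψ : L2R d) :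
    freeGroup d (-t) (coordPhase j s (freeGroup d t ψ)) =
      phaseFactor (t * s ^ 2) • momentumGroup j (t * s) (coordPhase j s ψ) := by
  refine (fourierL2 d).injective (Lp.ext ?_)
  rw [map_smul]
  filter_upwards [coeFn_fourierL2_freeGroup (-t) (coordPhase j s (freeGroup d t ψ)),
    coeFn_fourierL2_coordPhase j s (freeGroup d t ψ),
    (measurePreserving_add_right volume (boost j s)).quasiMeasurePreserving.ae
      (coeFn_fourierL2_freeGroup t ψ),
    Lp.coeFn_smul (phaseFactor (t * s ^ 2))
      (fourierL2 d (momentumGroup j (t * s) (coordPhase j s ψ))),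
    coeFn_fourierL2_momentumGroup j (t * s) (coordPhase j s ψ),
    coeFn_fourierL2_coordPhase j s ψ] with ξ h1 h2 h3 h4 h5 h6
  rw [h1, h2, h3, h4, Pi.smul_apply, h5, h6, smul_eq_mul, ← mul_assoc, ← mul_assoc,
    ← phaseFactor_add, ← phaseFactor_add, laplacianSymbol_add_boost]
  congr 2
  ring

theorem abs_momentumSymbol_le (j : Fin d) (ξ : EuclideanSpace ℝ (Fin d)) :
    |momentumSymbol j ξ| ≤ 1 + laplacianSymbol d ξ := by
  have h := PiLp.norm_apply_le ξ j
  rw [Real.norm_eq_abs] at h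
  rw [momentumSymbol, laplacianSymbol, abs_mul, abs_of_nonneg (by positivity)]
  calc 4 * Real.pi * |ξ j| ≤ 4 * Real.pi * ‖ξ‖ := by gcongr
    _ ≤ _ := by nlinarith [sq_nonneg (2 * Real.pi * ‖ξ‖ - 1)]

theorem momentumSymbol_sq_le (j : Fin d) (ξ : EuclideanSpace ℝ (Fin d)) :
    momentumSymbol j ξ ^ 2 ≤ 4 * laplacianSymbol d ξ := by
  have h := PiLp.norm_apply_le ξ j
  rw [Real.norm_eq_abs] at h
  have h2 : ξ j ^ 2 ≤ ‖ξ‖ ^ 2 := by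
    rw [← sq_abs (ξ j)]
    gcongr
  rw [momentumSymbol, laplacianSymbol]
  nlinarith [mul_le_mul_of_nonneg_left h2 (sq_nonneg Real.pi)]

theorem laplacianSymbol_nonneg (ξ : EuclideanSpace ℝ (Fin d)) : 0 ≤ laplacianSymbol d ξ := by
  unfold laplacianSymbol
  positivity

theorem four_mul_laplacianSymbol (ξ : EuclideanSpace ℝ (Fin d)) :
    4 * laplacianSymbol d ξ = ∑ j, momentumSymbol j ξ ^ 2 := by
  simp_rw [laplacianSymbol, momentumSymbol, EuclideanSpace.norm_sq_eq, mul_pow, Real.norm_eq_abs,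
    sq_abs, ← Finset.mul_sum]
  ring

theorem re_inner_ofReal_mul_self (a : ℝ) (z : ℂ) :
    RCLike.re (inner ℂ z ((a : ℂ) * z)) = a * ‖z‖ ^ 2 := by
  rw [← smul_eq_mul, inner_smul_right, ← inner_self_eq_norm_sq (𝕜 := ℂ) z]
  exact Complex.re_ofReal_mul a _

/-- The commutator of `-Δ` and `e^{-i s Q_j}` is bounded in terms of the energy. -/
theorem exists_commutator_coordPhase (j : Fin d) {s : ℝ} (hs : 0 < s) (hs1 : s ≤ 1) {u w : L2R d}
    (huw : (u, w) ∈ (negLaplacianR d).graph) : ∃ b : L2R d,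
      (coordPhase j s u, coordPhase j s (w + b)) ∈ (negLaplacianR d).graph ∧
      ‖b‖ ^ 2 ≤ s ^ 2 * (2 * ‖u‖ ^ 2 + 8 * RCLike.re (inner ℂ u w)) := by
  rw [mem_graph_negLaplacianR_iff, mem_graph_mulOperator_iff] at huw
  -- Conjugation by `e^{-isQ_j}` turns `-Δ` into `-Δ - s Ξ_j + s²`, so `f` is the symbol of the
  -- correction.
  set f : EuclideanSpace ℝ (Fin d) → ℝ := fun ξ => s ^ 2 - s * momentumSymbol j ξ with hf
  have hfm : Measurable f := by
    have := measurable_momentumSymbol j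
    fun_prop
  have hmem : MemLp (fun ξ => (f ξ : ℂ) * fourierL2 d u ξ) 2
      (volume : Measure (EuclideanSpace ℝ (Fin d))) := by
    refine MemLp.of_le (((Lp.memLp (fourierL2 d u)).norm.const_mul 2).add
      (Lp.memLp (fourierL2 d w)).norm) (aestronglyMeasurable_mul hfm _) ?_
    filter_upwards [huw] with ξ hξ
    have h1 := abs_momentumSymbol_le j ξ
    have h0 := laplacianSymbol_nonneg ξ
    have h2 : |f ξ| ≤ 2 + laplacianSymbol d ξ := by
      rw [hf]
      refine (abs_sub _ _).trans ?_
      rw [abs_mul, abs_of_pos hs, abs_of_nonneg (sq_nonneg s)]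
      nlinarith [abs_nonneg (momentumSymbol j ξ)]
    rw [Pi.add_apply, hξ, norm_mul, norm_mul, Complex.norm_real, Complex.norm_real,
      Real.norm_of_nonneg h0, Real.norm_eq_abs, ← add_mul, norm_mul, norm_norm,
      Real.norm_of_nonneg (by positivity : 0 ≤ 2 + laplacianSymbol d ξ)]
    gcongr
  set b : L2R d := (fourierL2 d).symm (hmem.toLp _) with hb
  have hbF : fourierL2 d b =ᵐ[volume] fun ξ => (f ξ : ℂ) * fourierL2 d u ξ := by
    rw [hb, LinearIsometryEquiv.apply_symm_apply]
    exact hmem.coeFn_toLp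
  refine ⟨b, ?_, ?_⟩
  · rw [mem_graph_negLaplacianR_iff, mem_graph_mulOperator_iff]
    have hsum : fourierL2 d (w + b) =ᵐ[volume]
        fun ξ => ((laplacianSymbol d ξ + f ξ : ℝ) : ℂ) * fourierL2 d u ξ := by
      rw [map_add]
      filter_upwards [Lp.coeFn_add (fourierL2 d w) (fourierL2 d b), huw, hbF] with ξ h1 h2 h3
      rw [h1, Pi.add_apply, h2, h3]
      push_cast
      ring
    filter_upwards [coeFn_fourierL2_coordPhase j s u, coeFn_fourierL2_coordPhase j s (w + b),
      (measurePreserving_add_right volume (boost j s)).quasiMeasurePreserving.ae hsum]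
      with ξ h1 h2 h3
    rw [h1, h2, h3, laplacianSymbol_add_boost]
    congr 2
    -- The boost raises the symbol of `Ξ_j` by `2 s`, so the `s ^ 2` from the Laplacian and the `s ^
    -- 2` in `f` cancel against `-2 s ^ 2`.
    have h4 : momentumSymbol j (ξ + boost j s) = momentumSymbol j ξ + 2 * s := by
      simp only [momentumSymbol, boost, PiLp.add_apply, PiLp.smul_apply, PiLp.single_apply,
        if_true, smul_eq_mul]
      field_simp
      ring
    rw [hf]
    simp only
    rw [h4]
    ring
  · rw [← (fourierL2 d).norm_map b, ← (fourierL2 d).norm_map u,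
      ← (fourierL2 d).inner_map_map u w, mul_add, ← mul_assoc, ← mul_assoc]
    refine norm_sq_L2_le_of_ae ?_
    filter_upwards [huw, hbF] with ξ h1 h2
    rw [h1, h2, re_inner_ofReal_mul_self, norm_mul, mul_pow, Complex.norm_real, Real.norm_eq_abs,
      sq_abs, ← mul_assoc, ← add_mul]
    refine mul_le_mul_of_nonneg_right ?_ (sq_nonneg _)
    have h3 := momentumSymbol_sq_le j ξ
    have h4 : f ξ ^ 2 = s ^ 2 * (s - momentumSymbol j ξ) ^ 2 := by
      rw [hf]
      ring
    rw [h4, mul_assoc, ← mul_add]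
    refine mul_le_mul_of_nonneg_left ?_ (sq_nonneg s)
    -- With `m` the symbol of `Ξ_j`, `(s - m)² ≤ 2 s² + 2 m²`, where `s ≤ 1` and `m²` is at most
    -- four times the symbol of `-Δ`. This gives the constants `2` and `8`.
    nlinarith [sq_nonneg (s + momentumSymbol j ξ)]

/-- States in `S₁` are limits of states in the domain of `-Δ` with controlled energy. -/
theorem exists_mem_graph_norm_sub_lt {u : L2R d} (hu : s1Norm id (momentumR d) u < ∞) {ε : ℝ}
    (hε : 0 < ε) : ∃ v w : L2R d, (v, w) ∈ (negLaplacianR d).graph ∧ ‖v - u‖ < ε ∧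
      RCLike.re (inner ℂ v w) ≤ 1 * (s1Norm id (momentumR d) u).toReal ^ 2 := by
  have hsum := sum_opNorm_momentum_le_s1Norm (q := id) (momentumR d) u
  have hfin : s1Norm id (momentumR d) u ^ 2 < ∞ := ENNReal.pow_lt_top hu
  have hlt : ∀ j, opNorm (momentumR d j) u < ∞ := fun j => by
    have h1 := (Finset.single_le_sum (f := fun j => (opNorm (momentumR d j) u / 2) ^ 2)
      (fun _ _ => zero_le) (Finset.mem_univ j)).trans_lt (hsum.trans_lt hfin)
    by_contra h2
    rw [not_lt_top_iff] at h2
    simp [h2, ENNReal.top_div] at h1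
  choose y hy using fun j => exists_mem_graph_of_opNorm_lt_top (hlt j)
  have hyF := fun j => mem_graph_mulOperator_iff.1 (mem_graph_momentumR_iff.1 (hy j))
  have hmS : ∀ n : ℕ, MeasurableSet (Metric.closedBall (0 : EuclideanSpace ℝ (Fin d)) n) :=
    fun n => Metric.isClosed_closedBall.measurableSet
  -- Cut off the momentum at radius `n`. The symbol of `-Δ` is bounded there, so the truncated state
  -- is in the domain, and its energy is at most `∑ ‖½ Ξ_j u‖²`.
  have hv : ∀ n : ℕ, MemLp ((Metric.closedBall 0 (n : ℝ)).indicator (fourierL2 d u)) 2 volume :=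
    fun n => (Lp.memLp _).indicator (hmS n)
  have hlim : Tendsto (fun n => (hv n).toLp _) atTop (𝓝 (fourierL2 d u)) := by
    refine tendsto_Lp_of_dominated (fun n => (hv n).coeFn_toLp) (EventuallyEq.refl _ _)
      (Lp.memLp (fourierL2 d u)) (fun n ξ => ?_) (fun ξ => ?_)
    · by_cases h : ξ ∈ Metric.closedBall (0 : EuclideanSpace ℝ (Fin d)) n
      · simp [indicator_of_mem h]
      · simp [indicator_of_notMem h]
    · refine tendsto_const_nhds.congr' ?_
      filter_upwards [eventually_ge_atTop ⌈‖ξ‖⌉₊] with n hn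
      rw [indicator_of_mem]
      rw [mem_closedBall_zero_iff]
      exact (Nat.le_ceil _).trans (Nat.cast_le.2 hn)
  obtain ⟨n, hn⟩ := ((tendsto_iff_norm_sub_tendsto_zero.1 hlim).eventually_lt_const hε).exists
  have hw : MemLp (fun ξ => (laplacianSymbol d ξ : ℂ) *
      (Metric.closedBall 0 (n : ℝ)).indicator (fourierL2 d u) ξ) 2 volume := by
    have hm : MemLp ((Metric.closedBall 0 (n : ℝ)).indicator
        fun ξ => (laplacianSymbol d ξ : ℂ)) ∞ (volume : Measure (EuclideanSpace ℝ (Fin d))) := by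
      refine memLp_top_of_bound ((Complex.measurable_ofReal.comp
        measurable_laplacianSymbol).indicator (hmS n)).aestronglyMeasurable
        ((2 * Real.pi) ^ 2 * n ^ 2) (Eventually.of_forall fun ξ => ?_)
      by_cases h : ξ ∈ Metric.closedBall (0 : EuclideanSpace ℝ (Fin d)) n
      · rw [indicator_of_mem h, Complex.norm_real, Real.norm_of_nonneg (laplacianSymbol_nonneg ξ),
          laplacianSymbol]
        rw [mem_closedBall_zero_iff] at h
        gcongr
      · rw [indicator_of_notMem h, norm_zero]
        positivity
    refine ((Lp.memLp (fourierL2 d u)).mul (r := 2) hm).ae_eq (Eventually.of_forall fun ξ => ?_)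
    simp only [Pi.mul_apply]
    by_cases h : ξ ∈ Metric.closedBall (0 : EuclideanSpace ℝ (Fin d)) n
    · rw [indicator_of_mem h, indicator_of_mem h]
    · rw [indicator_of_notMem h, indicator_of_notMem h, zero_mul, mul_zero]
  refine ⟨(fourierL2 d).symm ((hv n).toLp _), (fourierL2 d).symm (hw.toLp _), ?_, ?_, ?_⟩
  · rw [mem_graph_negLaplacianR_iff, mem_graph_mulOperator_iff,
      LinearIsometryEquiv.apply_symm_apply, LinearIsometryEquiv.apply_symm_apply]
    filter_upwards [(hv n).coeFn_toLp, hw.coeFn_toLp] with ξ h1 h2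
    rw [h1, h2]
  · rwa [← (fourierL2 d).norm_map, map_sub, LinearIsometryEquiv.apply_symm_apply]
  · rw [(fourierL2 d).symm.inner_map_map, one_mul]
    have h1 : RCLike.re (inner ℂ ((hv n).toLp _) (hw.toLp _)) ≤
        ∑ j, 4⁻¹ * ‖fourierL2 d (y j)‖ ^ 2 := by
      refine re_inner_L2_le_of_ae ?_
      filter_upwards [(hv n).coeFn_toLp, hw.coeFn_toLp, ae_all_iff.2 hyF] with ξ h1 h2 h3
      -- The identity `-Δ = ∑ (½ Ξ_j)²` on symbols; it explains the factor `½` in the `S₁` norm and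
      -- the constant `1` here.
      have h4 : ∑ j, 4⁻¹ * ‖fourierL2 d (y j) ξ‖ ^ 2 =
          laplacianSymbol d ξ * ‖fourierL2 d u ξ‖ ^ 2 := by
        simp_rw [h3, norm_mul, mul_pow, Complex.norm_real, Real.norm_eq_abs, sq_abs,
          ← Finset.mul_sum, ← Finset.sum_mul, ← four_mul_laplacianSymbol]
        ring
      rw [h1, h2, h4, re_inner_ofReal_mul_self]
      gcongr
      · exact laplacianSymbol_nonneg ξ
      · exact norm_indicator_le_norm_self _ _
    refine h1.trans ?_
    have h2 : ∑ j, (opNorm (momentumR d j) u / 2) ^ 2 =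
        ENNReal.ofReal (∑ j, 4⁻¹ * ‖fourierL2 d (y j)‖ ^ 2) := by
      rw [ENNReal.ofReal_sum_of_nonneg fun _ _ => by positivity]
      refine Finset.sum_congr rfl fun j _ => ?_
      rw [opNorm_eq_of_mem_graph (hy j), LinearIsometryEquiv.norm_map,
        show 4⁻¹ * ‖y j‖ ^ 2 = (‖y j‖ / 2) ^ 2 by ring, ENNReal.ofReal_pow (by positivity),
        ENNReal.ofReal_div_of_pos two_pos, ofReal_norm, ENNReal.ofReal_ofNat]
    rw [h2] at hsum
    rw [← ENNReal.toReal_pow]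
    exact (ENNReal.ofReal_le_iff_le_toReal hfin.ne).1 hsum

/-- The continuum `ℝ^d` satisfies the assumptions of the scattering theory. -/
theorem isFreeModel_continuum (d : ℕ) :
    IsFreeModel id measurable_id (negLaplacianR d) (momentumR d) where
  exists_group := ⟨_, isUnitaryGroupOf_freeGroup⟩
  exists_conj := ⟨2, 8, by norm_num, by norm_num, fun j _ hs hs1 _ _ huw =>
    exists_commutator_coordPhase j hs hs1 huw⟩
  exists_approx := ⟨1, zero_le_one, fun _ hu _ hε => exists_mem_graph_norm_sub_lt hu hε⟩
  heisenberg U hU j ψ T hT hae := by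
    -- Any group generated by `-Δ` is the explicit one, for which the Weyl relation is available.
    obtain rfl := hU.unique hU.dense_domain isUnitaryGroupOf_freeGroup
    have h0 : (volume.restrict (Ioc 0 T)) ≠ 0 := by
      rw [Ne, Measure.restrict_eq_zero, Real.volume_Ioc]
      simpa using hT
    have : (ae (volume.restrict (Ioc 0 T))).NeBot := ae_neBot.2 h0
    obtain ⟨t₁, ht₁⟩ := hae.exists
    -- A property that holds almost everywhere on an interval of positive length holds at two
    -- distinct times, as the Weyl argument requires.
    obtain ⟨t₂, ht₂, hne⟩ := (hae.and (Measure.ae_ne _ t₁)).exists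
    exact exists_heisenberg_of_weyl isUnitaryGroupOf_freeGroup
      (isUnitaryGroupOf_phaseGroup (measurable_coord measurable_id j))
      (isUnitaryGroupOf_momentumGroup j) (freeGroup_neg_coordPhase_freeGroup j) hne.symm ht₁ ht₂

end ContinuumModel

end Ballistic

open Ballistic in
theorem mainTheorem8 (d : ℕ) :
    (∀ (V₀ V : Lp ℝ ∞ (volume : Measure (EuclideanSpace ℝ (Fin d)))) (ψ : L2R d)
      (H₀ H : L2R d →ₗ.[ℂ] L2R d) (U₀ U : ℝ → L2R d ≃ₗᵢ[ℂ] L2R d),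
      H₀ = perturb (negLaplacianR d) V₀ → H = perturb H₀ V →
      U₀ = propagator H₀ → U = propagator H →
      ∫⁻ t in Ioi (0 : ℝ), ENNReal.ofReal (1 + t) *
          s1Norm id (momentumR d) (potential V (U₀ t ψ)) < ∞ →
        ∃ h : ψ ∈ (waveOperator U₀ U).domain,
          (∀ N : TransportNotion, N.Holds (secondMoment id U₀ ψ) →
            N.Holds (secondMoment id U (waveOperator U₀ U ⟨ψ, h⟩))) ∧
          (V₀ = 0 → ∀ N : TransportNotion, N.Holds (averagedSecondMoment id U₀ ψ) →
            N.Holds (averagedSecondMoment id U (waveOperator U₀ U ⟨ψ, h⟩)))) ∧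
    (∀ (V₀ V : Lp ℝ ∞ (Measure.count : Measure (Fin d → ℤ))) (ψ : L2Z d)
      (H₀ H : L2Z d →ₗ.[ℂ] L2Z d) (U₀ U : ℝ → L2Z d ≃ₗᵢ[ℂ] L2Z d),
      H₀ = perturb (negLaplacianZ d) V₀ → H = perturb H₀ V →
      U₀ = propagator H₀ → U = propagator H →
      ∫⁻ t in Ioi (0 : ℝ), ENNReal.ofReal (1 + t) *
          s1Norm latticePosition (momentumZ d) (potential V (U₀ t ψ)) < ∞ →
        ∃ h : ψ ∈ (waveOperator U₀ U).domain,
          (∀ N : TransportNotion, N.Holds (secondMoment latticePosition U₀ ψ) →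
            N.Holds (secondMoment latticePosition U (waveOperator U₀ U ⟨ψ, h⟩))) ∧
          (V₀ = 0 → ∀ N : TransportNotion, N.Holds (averagedSecondMoment latticePosition U₀ ψ) →
            N.Holds (averagedSecondMoment latticePosition U
              (waveOperator U₀ U ⟨ψ, h⟩)))) :=
  ⟨fun V₀ V ψ H₀ H U₀ U hH₀ hH hU₀ hU hJ =>
    (isFreeModel_continuum d).transport_waveOperator V₀ V ψ H₀ H U₀ U hH₀ hH hU₀ hU hJ,
  fun V₀ V ψ H₀ H U₀ U hH₀ hH hU₀ hU hJ =>
    (isFreeModel_lattice d).transport_waveOperator V₀ V ψ H₀ H U₀ U hH₀ hH hU₀ hU hJ⟩
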